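/- **Setting.** Let $(\mathcal X,D)$ be a nonempty compact metric space of diameter at most $1$, and let $d\ge 0$, $\kappa>0$ be such that for every $r\in(0,1]$ the space can be covered by at most $\kappa r^{-d}$ closed balls of radius $r$ (for instance, $d$ is the covering dimension of $\mathcal X$, that is, the least such exponent, and $\kappa$ is a corresponding multiplier). Let $\mu:\mathcal X\to[0,1]$ be $1$-Lipschitz with maximizer $x_*$. In each round $t=1,\dots,T$ ($T\ge 2$) the agent pulls an arm $x_t$ and observes $y_t=\mu(x_t)+\eta_t+c_t$, where, conditionally on the past and on $x_t$, the noise $\eta_t$ is sub-Gaussian with parameter $1$ (in particular has mean zero), and where the corruption $c_t$, $|c_t|\le 1$, is chosen by a strong adversary, who may use the whole past, $x_t$ and $\eta_t$. Let $C=\sum_{t=1}^T|c_t|$ be the total corruption (unknown to the agent) and $Regret_T=T\mu(x_*)-\sum_{t=1}^T\mu(x_t)$. **Robust Zooming with level $w$ and rate $\delta'$.** Write $n(x)$ for the number of pulls of $x$, $f(x)$ for the average of the observed rewards of $x$, and $r(x)=\sqrt{(4\ln T+2\ln(2/\delta'))/n(x)}+w/n(x)$. Start with no active arms, $J=\emptyset$,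 and active space $\mathcal X_{act}=\mathcal X$. In each round: (removal) if $f(v)-f(u)\ge r(v)+2r(u)$ for some $u,v\in J$, remove one such $u$ from $J$ and the closed ball $\mathcal B(u,r(u))$ from $\mathcal X_{act}$; (activation) if $\mathcal X_{act}\not\subseteq\bigcup_{v\in J}\mathcal B(v,r(v))$, add to $J$ and pull an arbitrary uncovered arm of $\mathcal X_{act}$; (selection) otherwise pull an arm of $J$ that maximizes $f(v)+2r(v)$, ties broken arbitrarily. Then update $n$ and $f$. **BoB Robust Zooming with rate $\delta\in(0,1)$.** Let $H=\lceil T^{(d+2)/(d+4)}\rceil$, $N=\lceil\log_2T\rceil$, $M=\lceil T/H\rceil$, $\alpha=2\sqrt{\ln(3NM/\delta)}$, $\gamma=\min\{\tfrac35,\,2\sqrt{3N\ln N/(5M)}\}$, and $w_i=1$ for $i=1,\dots,N$. The rounds are split into $M$ consecutive batches of length $H$ (the last may be shorter). At the start of a batch, an index $i'$ is drawn, given the past, with probabilities $p_i=(1-\gamma)w_i/\sum_jw_j+\gamma/N$, and in this batch Robust Zooming is run afresh with level $2^{i'}$ and rate $\delta/3$. After a complete batch with observed total reward $S$, put $g=S/\bigl(2H+\sqrt{2H\ln(12T/(H\delta))}\bigr)$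 and multiply every $w_i$ by $\exp\bigl(\tfrac{\gamma}{3N}\bigl(\tfrac{g}{p_i}\mathbf 1[i=i']+\tfrac{\alpha}{p_i\sqrt{NM}}\bigr)\bigr)$ (the EXP3.P update). **Theorem.** There are constants $A$ and $p\in\mathbb N$, depending only on $d$ and $\kappa$, such that for all $T\ge2$, all $\delta\in(0,1)$ and every instance, strong adversary and run as above, with probability at least $1-\delta$, $$Regret_T\le A\,\bigl(\ln(T/\delta)\bigr)^p\Bigl(T^{\frac{d+3}{d+4}}+C^{\frac1{d+1}}\,T^{\frac{d+2}{d+3}}\Bigr).$$ -/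

import Mathlib

open MeasureTheory ProbabilityTheory
open scoped NNReal ENNReal

namespace BoB

/-! ### The metric space -/

/-- The `r`-covering number of the metric space `X` is at most `κ * r ^ (-d)` for every radius
`r ∈ (0, 1]`.  The covering dimension is the least `d ≥ 0` for which this holds for some `κ`. -/
def HasCoveringBound (X : Type*) [MetricSpace X] (d κ : ℝ) : Prop :=
  ∀ r : ℝ≥0, 0 < r → r ≤ 1 →
    ((Metric.coveringNumber r (Set.univ : Set X) : ℕ∞) : ℝ≥0∞) ≤
      ENNReal.ofReal (κ * (r : ℝ) ^ (-d))

/-! ### The base algorithm: Robust Zooming -/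

/-- The confidence radius of an arm that has been pulled `n` times, for horizon `T`, probability
rate `δ` and corruption level `C`. -/
noncomputable def radius (T : ℕ) (δ C : ℝ) (n : ℕ) : ℝ :=
  √((4 * Real.log T + 2 * Real.log (2 / δ)) / n) + C / n

/-- The memory of the Robust Zooming algorithm: active arms, active space, and for each arm its
number of pulls and its average observed reward. -/
structure ZoomState (X : Type*) where
  arms : Set X
  space : Set X
  count : X → ℕ
  mean : X → ℝ

namespace ZoomState

variable {X : Type*}

/-- The memory of a freshly started Robust Zooming algorithm. -/
def init (X : Type*) : ZoomState X where
  arms := ∅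
  space := Set.univ
  count := fun _ => 0
  mean := fun _ => 0

/-- `u` is dominated by `v`, both being active. Here `r n` is the confidence radius of an arm that
has been pulled `n` times. -/
def Dominated (r : ℕ → ℝ) (s : ZoomState X) (u v : X) : Prop :=
  u ∈ s.arms ∧ v ∈ s.arms ∧ r (s.count v) + 2 * r (s.count u) ≤ s.mean v - s.mean u

/-- The removal step: if some active arm is dominated, one such arm and its confidence ball are
removed (which one is arbitrary); otherwise nothing happens. -/
def Removal [MetricSpace X] (r : ℕ → ℝ) (s s' : ZoomState X) : Prop :=
  (∃ u v, s.Dominated r u v ∧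
    s' = { s with
      arms := s.arms \ {u}
      space := s.space \ Metric.closedBall u (r (s.count u)) }) ∨
  ((¬ ∃ u v, s.Dominated r u v) ∧ s' = s)

/-- The region covered by the confidence balls of the active arms. -/
def covered [MetricSpace X] (r : ℕ → ℝ) (s : ZoomState X) : Set X :=
  ⋃ v ∈ s.arms, Metric.closedBall v (r (s.count v))

open Classical in
/-- The memory after the arm `x` has been activated. -/
noncomputable def activate (s : ZoomState X) (x : X) : ZoomState X :=
  { s with
    arms := insert x s.arms
    count := Function.update s.count x 0
    mean := Function.update s.mean x 0 }

/-- The choice of the arm `x`: if the active space is not covered, an arbitrary uncovered arm of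
it is activated and pulled; otherwise an active arm of maximal index is pulled, ties being broken
arbitrarily. -/
def Pull [MetricSpace X] (r : ℕ → ℝ) (s : ZoomState X) (x : X) (s' : ZoomState X) : Prop :=
  (¬ s.space ⊆ s.covered r ∧ x ∈ s.space ∧ x ∉ s.covered r ∧ s' = s.activate x) ∨
  (s.space ⊆ s.covered r ∧ x ∈ s.arms ∧
    (∀ v ∈ s.arms, s.mean v + 2 * r (s.count v) ≤ s.mean x + 2 * r (s.count x)) ∧ s' = s)

open Classical in
/-- The memory after the reward `y` has been observed for the arm `x`. -/
noncomputable def observe (s : ZoomState X) (x : X) (y : ℝ) : ZoomState X :=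
  { s with
    count := Function.update s.count x (s.count x + 1)
    mean := Function.update s.mean x ((s.mean x * s.count x + y) / (s.count x + 1)) }

/-- One round of Robust Zooming, started in the memory `s`, may pull the arm `x` and, after
observing the reward `y`, end in the memory `s'`. -/
def Round [MetricSpace X] (r : ℕ → ℝ) (s : ZoomState X) (x : X) (y : ℝ) (s' : ZoomState X) :
    Prop :=
  ∃ s₁ s₂, s.Removal r s₁ ∧ s₁.Pull r x s₂ ∧ s' = s₂.observe x y

end ZoomState

/-! ### The master algorithm: EXP3.P -/

/-- The EXP3.P probability of action `j`, with exploration rate `γ` and weights `w`. -/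
noncomputable def exp3Prob {N : ℕ} (γ : ℝ) (w : Fin N → ℝ) (j : Fin N) : ℝ :=
  (1 - γ) * (w j / ∑ k, w k) + γ / N

/-- The EXP3.P weights after `b` steps, over `N` actions and with horizon `M`, if action `i b` is
played and the reward `g b` is received in step `b`. -/
noncomputable def exp3Weight {N : ℕ} (M : ℕ) (α γ : ℝ) (i : ℕ → Fin N) (g : ℕ → ℝ) :
    ℕ → Fin N → ℝ
  | 0, _ => 1
  | b + 1, j =>
      let w := exp3Weight M α γ i g b
      w j * Real.exp (γ / (3 * N) *
        ((if i b = j then g b / exp3Prob γ w j else 0) +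
          α / (exp3Prob γ w j * √((N : ℝ) * M))))

/-! ### Bandit-over-Bandit Robust Zooming -/

/-- The number `⌈log₂ T⌉` of base algorithms. -/
def numBase (T : ℕ) : ℕ := Nat.clog 2 T

/-- The corruption level `2 ^ i` of the `i`-th base algorithm, `i = 1, …, N`
(`j = i - 1` counts from zero). -/
def level {N : ℕ} (j : Fin N) : ℝ := 2 ^ ((j : ℕ) + 1)

/-- The batch length `T ^ ((d + 2) / (d + 4))`, rounded up. -/
noncomputable def batchLength (d : ℝ) (T : ℕ) : ℕ := ⌈(T : ℝ) ^ ((d + 2) / (d + 4))⌉₊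

/-- The number `⌈T / H⌉` of batches, which is the horizon of EXP3.P. -/
noncomputable def numBatch (T H : ℕ) : ℕ := ⌈(T : ℝ) / H⌉₊

/-- The EXP3.P parameter `α` for `N` actions, `M` steps and probability rate `δ / 3`. -/
noncomputable def alpha (N M : ℕ) (δ : ℝ) : ℝ := 2 * √(Real.log (3 * N * M / δ))

/-- The EXP3.P exploration rate `γ` for `N` actions and `M` steps. -/
noncomputable def gamma (N M : ℕ) : ℝ := min (3 / 5) (2 * √(3 * N * Real.log N / (5 * M)))

/-- The sum of the observed rewards `y` over the `b`-th batch of length `H`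
(rounds and batches count from zero), divided by its high-probability bound. -/
noncomputable def batchReward (T H : ℕ) (δ : ℝ) (y : ℕ → ℝ) (b : ℕ) : ℝ :=
  (∑ t ∈ Finset.Ico (b * H) ((b + 1) * H), y t) /
    (2 * H + √(2 * H * Real.log (12 * T / (H * δ))))

/-- The probability with which the base algorithm `j` is chosen for the `b`-th batch, given the
base algorithms `i` chosen and the rewards `y` observed in the earlier batches. -/
noncomputable def masterProb (T H : ℕ) (δ : ℝ) (i : ℕ → Fin (numBase T)) (y : ℕ → ℝ) (b : ℕ)
    (j : Fin (numBase T)) : ℝ :=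
  let γ := gamma (numBase T) (numBatch T H)
  exp3Prob γ
    (exp3Weight (numBatch T H) (alpha (numBase T) (numBatch T H) δ) γ i (batchReward T H δ y) b) j

/-! ### The interaction

Rounds are numbered `0, …, T - 1`. In the filtration `ℱ`, the σ-algebra `ℱ (2 * t)` describes what
has happened before round `t`, and `ℱ (2 * t + 1)` describes this together with the choice of the
arm of round `t` (and of the base algorithm, if a batch starts in round `t`). The noise and the
corruption of round `t` are known at `2 * t + 2`. -/

section Interaction

variable {X Ω : Type*} [mΩ : MeasurableSpace Ω]

/-- The corrupted reward `μ (x t) + η t + c t` of round `t`. -/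
def reward (μ : X → ℝ) (x : ℕ → Ω → X) (η c : ℕ → Ω → ℝ) (t : ℕ) (ω : Ω) : ℝ :=
  μ (x t ω) + η t ω + c t ω

/-- The noise `η` and the corruption `c` come from a stochastic environment and a strong adversary:
given the past and the current arm, the noise is sub-Gaussian with parameter `1`
(so that it has mean zero), and the corruption of a round, which is at most `1`, may depend on
the whole past and on the arm and the noise of that round. -/
structure IsEnvironment (P : Measure Ω) (ℱ : Filtration ℕ mΩ) (T : ℕ) (η c : ℕ → Ω → ℝ) :
    Prop where
  measurable_noise : ∀ t < T, Measurable[ℱ (2 * t + 2)] (η t)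
  integrable_exp_noise : ∀ t < T, ∀ l : ℝ, Integrable (fun ω => Real.exp (l * η t ω)) P
  subgaussian_noise : ∀ t < T, ∀ l : ℝ,
    P[fun ω => Real.exp (l * η t ω) | ℱ (2 * t + 1)] ≤ᵐ[P] fun _ => Real.exp (l ^ 2 / 2)
  measurable_corruption : ∀ t < T, Measurable[ℱ (2 * t + 2)] (c t)
  corruption_le_one : ∀ t < T, ∀ ω, |c t ω| ≤ 1

/-- The chosen base algorithms `i` (one for each batch) and the pulled arms `x` are those of
Bandit-over-Bandit Robust Zooming with horizon `T`, batch length `H` and probability rate `δ`,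
when the observed rewards are `y`. -/
structure IsRun [MetricSpace X] [MeasurableSpace X] (P : Measure Ω) (ℱ : Filtration ℕ mΩ)
    (T H : ℕ) (δ : ℝ) (i : ℕ → Ω → Fin (numBase T)) (x : ℕ → Ω → X) (y : ℕ → Ω → ℝ) :
    Prop where
  measurable_base : ∀ b, b * H < T → Measurable[ℱ (2 * (b * H) + 1)] (i b)
  measurable_arm : ∀ t < T, Measurable[ℱ (2 * t + 1)] (x t)
  /-- At the start of a batch the base algorithm is drawn by EXP3.P. -/
  law_base : ∀ b, b * H < T → ∀ j,
    P[(i b ⁻¹' {j}).indicator (fun _ => (1 : ℝ)) | ℱ (2 * (b * H))] =ᵐ[P]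
      fun ω => masterProb T H δ (fun k => i k ω) (fun t => y t ω) b j
  /-- In each batch the chosen base algorithm is run afresh, with probability rate `δ / 3`;
  `s t` is its memory at the start of round `t`, before a possible restart. -/
  zooming : ∀ ω, ∃ s : ℕ → ZoomState X, ∀ t < T,
    ZoomState.Round (radius T (δ / 3) (level (i (t / H) ω)))
      (if H ∣ t then ZoomState.init X else s t) (x t ω) (y t ω) (s (t + 1))

/-- The regret over `T` rounds, `xopt` being an optimal arm. -/
def regret (μ : X → ℝ) (xopt : X) (T : ℕ) (x : ℕ → Ω → X) (ω : Ω) : ℝ :=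
  T * μ xopt - ∑ t ∈ Finset.range T, μ (x t ω)

/-- The total corruption spent by the adversary on the pulled arms. -/
def totalCorruption (T : ℕ) (c : ℕ → Ω → ℝ) (ω : Ω) : ℝ :=
  ∑ t ∈ Finset.range T, |c t ω|

end Interaction

end BoB

/-!
On a path on which all empirical averages are accurate, Robust Zooming removes an arm only if a
better one is active, so an optimal arm is never lost and every pulled arm has a gap of at
most six times its confidence radius. As distinct pulled arms are separated by the smaller of their
radii, the covering bound limits the number of arms with a large radius, and hence the regret.

The master algorithm is EXP3.P with the batches as its steps. It is compared with the base
algorithm whose level lies between `C` and `2 * C + 2`, where `C` is the total corruption. The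
regret bound of that algorithm is available only in the batches in which it is played, but there it
bounds the reward from below by a constant `v`; as the importance estimate in the other batches
consists of the bias alone, this suffices to compare the master with an action of constant reward
`v`.

Both the importance estimates and the noise are controlled by exponential supermartingales. The
noise bound applies to any random set of rounds that is decided before the noise is drawn. This
covers the batches and, by a union bound over the round of the first pull and the number of pulls,
the averages of the arms, although there may be uncountably many arms.
-/

namespace BoB

/-! ### Concentration -/

section Concentration

variable {Ω : Type*} {m mΩ : MeasurableSpace Ω} {P : Measure Ω}

/-- The conditional mean of `exp D` given `m` is at most `1`, so that `D` may be an increment of the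
logarithm of a nonnegative supermartingale. Lower integrals spare an integrability assumption. -/
def ExpMomentLEOne (P : Measure Ω) (m : MeasurableSpace Ω) (D : Ω → ℝ) : Prop :=
  ∀ A, MeasurableSet[m] A → ∫⁻ ω in A, ENNReal.ofReal (Real.exp (D ω)) ∂P ≤ P A

theorem ExpMomentLEOne.lintegral_mul_le {D : Ω → ℝ} (h : ExpMomentLEOne P m D) (hm : m ≤ mΩ)
    (hD : Measurable D) {f : Ω → ℝ≥0∞} (hf : Measurable[m] f) :
    ∫⁻ ω, ENNReal.ofReal (Real.exp (D ω)) * f ω ∂P ≤ ∫⁻ ω, f ω ∂P := by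
  have hdensity : ∫⁻ ω, ENNReal.ofReal (Real.exp (D ω)) * f ω ∂P =
      ∫⁻ ω, f ω ∂(P.withDensity fun ω => ENNReal.ofReal (Real.exp (D ω))) :=
    (lintegral_withDensity_eq_lintegral_mul P hD.exp.ennreal_ofReal (hf.mono hm le_rfl)).symm
  rw [hdensity, ← lintegral_trim hm hf, ← lintegral_trim hm hf]
  refine lintegral_mono' (Measure.le_iff.2 fun A hA => ?_) le_rfl
  rw [trim_measurableSet_eq hm hA, trim_measurableSet_eq hm hA, withDensity_apply _ (hm A hA)]
  exact h A hA

theorem ExpMomentLEOne.indicator {D : Ω → ℝ} (h : ExpMomentLEOne P m D) (hm : m ≤ mΩ) {B : Set Ω}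
    (hB : MeasurableSet[m] B) : ExpMomentLEOne P m (B.indicator D) := by
  intro A hA
  rw [← lintegral_inter_add_sdiff _ A (hm B hB), ← measure_inter_add_sdiff A (hm B hB)]
  refine add_le_add ?_ (le_of_eq ?_)
  · calc ∫⁻ ω in A ∩ B, ENNReal.ofReal (Real.exp (B.indicator D ω)) ∂P
        = ∫⁻ ω in A ∩ B, ENNReal.ofReal (Real.exp (D ω)) ∂P :=
          setLIntegral_congr_fun (hm _ (hA.inter hB)) fun _ hω => by
            simp only [hω.2, Set.indicator_of_mem]
      _ ≤ P (A ∩ B) := h _ (hA.inter hB)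
  · calc ∫⁻ ω in A \ B, ENNReal.ofReal (Real.exp (B.indicator D ω)) ∂P
        = ∫⁻ _ in A \ B, 1 ∂P :=
          setLIntegral_congr_fun ((hm _ hA).diff (hm _ hB)) fun ω hω => by simp [hω.2]
      _ = P (A \ B) := by simp

theorem expMomentLEOne_of_condExp_le_one [IsFiniteMeasure P] (hm : m ≤ mΩ) {D : Ω → ℝ}
    (hint : Integrable (fun ω => Real.exp (D ω)) P)
    (hle : P[fun ω => Real.exp (D ω) | m] ≤ᵐ[P] fun _ => 1) : ExpMomentLEOne P m D := by
  intro A hA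
  calc ∫⁻ ω in A, ENNReal.ofReal (Real.exp (D ω)) ∂P
      = ENNReal.ofReal (∫ ω in A, Real.exp (D ω) ∂P) :=
        (ofReal_integral_eq_lintegral_ofReal hint.integrableOn
          (ae_of_all _ fun ω => (Real.exp_pos _).le)).symm
    _ ≤ ENNReal.ofReal (∫ _ in A, (1 : ℝ) ∂P) := by
        rw [← setIntegral_condExp hm hint hA]
        exact ENNReal.ofReal_le_ofReal (setIntegral_mono_ae integrable_condExp.integrableOn
          (integrable_const _).integrableOn hle)
    _ = P A := by simp

theorem expMomentLEOne_of_subgaussian [IsFiniteMeasure P] (hm : m ≤ mΩ) {η : Ω → ℝ} {l : ℝ}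
    (hint : Integrable (fun ω => Real.exp (l * η ω)) P)
    (hsub : P[fun ω => Real.exp (l * η ω) | m] ≤ᵐ[P] fun _ => Real.exp (l ^ 2 / 2)) :
    ExpMomentLEOne P m fun ω => l * η ω - l ^ 2 / 2 := by
  have hexp : (fun ω => Real.exp (l * η ω - l ^ 2 / 2)) =
      Real.exp (-(l ^ 2 / 2)) • fun ω => Real.exp (l * η ω) := by
    funext ω
    rw [Pi.smul_apply, smul_eq_mul, ← Real.exp_add]
    ring_nf
  refine expMomentLEOne_of_condExp_le_one hm (by rw [hexp]; exact hint.smul _) ?_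
  rw [hexp]
  filter_upwards [condExp_smul (Real.exp (-(l ^ 2 / 2))) (fun ω => Real.exp (l * η ω)) m (μ := P),
    hsub] with ω hω hle
  rw [hω, Pi.smul_apply, smul_eq_mul, Real.exp_neg]
  exact (inv_mul_le_one₀ (Real.exp_pos _)).2 hle

theorem setLIntegral_eq_lintegral_condProb_mul [IsFiniteMeasure P] (hm : m ≤ mΩ) {B : Set Ω}
    (hB : MeasurableSet B) {p : Ω → ℝ} (hp : P[B.indicator (fun _ => (1 : ℝ)) | m] =ᵐ[P] p)
    (hpm : Measurable[m] p) (hp0 : ∀ ω, 0 ≤ p ω) {F : Ω → ℝ≥0∞} (hF : Measurable[m] F) :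
    ∫⁻ ω in B, F ω ∂P = ∫⁻ ω, ENNReal.ofReal (p ω) * F ω ∂P := by
  have hpint : Integrable p P := integrable_condExp.congr hp
  have hset : ∀ S, MeasurableSet[m] S → ∫ ω in S, p ω ∂P = P.real (S ∩ B) := fun S hS => by
    rw [← setIntegral_congr_ae (g := p) (hm S hS) (hp.mono fun ω h _ => h),
      setIntegral_condExp hm ((integrable_const (1 : ℝ)).indicator hB) hS,
      setIntegral_indicator hB]
    simp
  have htrim : (P.restrict B).trim hm =
      (P.withDensity fun ω => ENNReal.ofReal (p ω)).trim hm := by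
    refine @Measure.ext Ω m _ _ fun S hS => ?_
    rw [trim_measurableSet_eq hm hS, trim_measurableSet_eq hm hS, withDensity_apply _ (hm S hS),
      Measure.restrict_apply (hm S hS),
      ← ofReal_integral_eq_lintegral_ofReal hpint.integrableOn (ae_of_all _ hp0), hset S hS]
    simp
  rw [← lintegral_trim hm hF, htrim, lintegral_trim hm hF]
  exact lintegral_withDensity_eq_lintegral_mul P (hpm.mono hm le_rfl).ennreal_ofReal
    (hF.mono hm le_rfl)

theorem condExp_indicator_compl [IsFiniteMeasure P] (hm : m ≤ mΩ) {B : Set Ω}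
    (hB : MeasurableSet B) {p : Ω → ℝ} (hp : P[B.indicator (fun _ => (1 : ℝ)) | m] =ᵐ[P] p) :
    P[Bᶜ.indicator (fun _ => (1 : ℝ)) | m] =ᵐ[P] fun ω => 1 - p ω := by
  have hcompl : Bᶜ.indicator (fun _ => (1 : ℝ)) = (fun _ => 1) - B.indicator (fun _ => 1) :=
    Set.indicator_compl B _
  rw [hcompl]
  filter_upwards [condExp_sub (integrable_const (1 : ℝ))
    ((integrable_const (1 : ℝ)).indicator hB) m (μ := P), hp] with ω hω hpω
  rw [hω, Pi.sub_apply, hpω, condExp_const hm]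

theorem expMomentLEOne_ite [IsFiniteMeasure P] (hm : m ≤ mΩ) {B : Set Ω}
    [DecidablePred (· ∈ B)] (hB : MeasurableSet B) {p D₁ D₀ : Ω → ℝ}
    (hp : P[B.indicator (fun _ => (1 : ℝ)) | m] =ᵐ[P] p) (hpm : Measurable[m] p)
    (hp01 : ∀ ω, p ω ∈ Set.Icc 0 1) (h₁ : Measurable[m] D₁) (h₀ : Measurable[m] D₀)
    (hle : ∀ ω, p ω * Real.exp (D₁ ω) + (1 - p ω) * Real.exp (D₀ ω) ≤ 1) :
    ExpMomentLEOne P m fun ω => if ω ∈ B then D₁ ω else D₀ ω := by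
  intro A hA
  have hp0 : ∀ ω, 0 ≤ p ω := fun ω => (hp01 ω).1
  have hq0 : ∀ ω, 0 ≤ 1 - p ω := fun ω => sub_nonneg.2 (hp01 ω).2
  have hF : ∀ {D : Ω → ℝ}, Measurable[m] D →
      Measurable[m] (A.indicator fun ω => ENNReal.ofReal (Real.exp (D ω))) := fun hD =>
    (hD.exp.ennreal_ofReal).indicator hA
  have hon : ∫⁻ ω in B, A.indicator
      (fun ω => ENNReal.ofReal (Real.exp (if ω ∈ B then D₁ ω else D₀ ω))) ω ∂P =
      ∫⁻ ω in B, A.indicator (fun ω => ENNReal.ofReal (Real.exp (D₁ ω))) ω ∂P :=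
    setLIntegral_congr_fun hB fun ω hω => by
      by_cases hωA : ω ∈ A <;> simp [hωA, hω]
  have hoff : ∫⁻ ω in Bᶜ, A.indicator
      (fun ω => ENNReal.ofReal (Real.exp (if ω ∈ B then D₁ ω else D₀ ω))) ω ∂P =
      ∫⁻ ω in Bᶜ, A.indicator (fun ω => ENNReal.ofReal (Real.exp (D₀ ω))) ω ∂P :=
    setLIntegral_congr_fun hB.compl fun ω hω => by
      by_cases hωA : ω ∈ A <;> simp [hωA, Set.notMem_of_mem_compl hω]
  have hmeas : Measurable[m] fun ω => ENNReal.ofReal (p ω) *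
      A.indicator (fun ω => ENNReal.ofReal (Real.exp (D₁ ω))) ω := hpm.ennreal_ofReal.mul (hF h₁)
  rw [← lintegral_indicator (hm A hA), ← lintegral_add_compl _ hB, hon, hoff,
    setLIntegral_eq_lintegral_condProb_mul hm hB hp hpm hp0 (hF h₁),
    setLIntegral_eq_lintegral_condProb_mul hm hB.compl (condExp_indicator_compl hm hB hp)
      (hpm.const_sub 1) hq0 (hF h₀),
    ← lintegral_add_left (hmeas.mono hm le_rfl), ← lintegral_indicator_one (hm A hA)]
  refine lintegral_mono fun ω => ?_
  by_cases hωA : ω ∈ A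
  · simp only [hωA, Set.indicator_of_mem, Pi.one_apply]
    rw [← ENNReal.ofReal_mul (hp0 ω), ← ENNReal.ofReal_mul (hq0 ω),
      ← ENNReal.ofReal_add (mul_nonneg (hp0 ω) (Real.exp_pos _).le)
        (mul_nonneg (hq0 ω) (Real.exp_pos _).le)]
    exact ENNReal.ofReal_le_one.2 (hle ω)
  · simp [hωA]

section Chernoff

variable [IsProbabilityMeasure P] {ℱ : Filtration ℕ mΩ} {τ : ℕ → ℕ} {D : ℕ → Ω → ℝ} {n : ℕ}

theorem lintegral_exp_sum_le_one (hτ : Monotone τ)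
    (hD : ∀ b < n, Measurable[ℱ (τ (b + 1))] (D b))
    (hstep : ∀ b < n, ExpMomentLEOne P (ℱ (τ b)) (D b)) :
    ∫⁻ ω, ENNReal.ofReal (Real.exp (∑ b ∈ Finset.range n, D b ω)) ∂P ≤ 1 := by
  induction n with
  | zero => simp
  | succ n ih =>
    have hpast : Measurable[ℱ (τ n)]
        fun ω => ENNReal.ofReal (Real.exp (∑ b ∈ Finset.range n, D b ω)) :=
      (Finset.measurable_sum _ fun b hb => (hD b (by simp at hb; omega)).mono
        (ℱ.mono (hτ (Finset.mem_range.1 hb))) le_rfl).exp.ennreal_ofReal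
    calc ∫⁻ ω, ENNReal.ofReal (Real.exp (∑ b ∈ Finset.range (n + 1), D b ω)) ∂P
        = ∫⁻ ω, ENNReal.ofReal (Real.exp (D n ω)) *
            ENNReal.ofReal (Real.exp (∑ b ∈ Finset.range n, D b ω)) ∂P := by
          refine lintegral_congr fun ω => ?_
          rw [Finset.sum_range_succ, add_comm, Real.exp_add,
            ENNReal.ofReal_mul (Real.exp_pos _).le]
      _ ≤ ∫⁻ ω, ENNReal.ofReal (Real.exp (∑ b ∈ Finset.range n, D b ω)) ∂P :=
          (hstep n n.lt_succ_self).lintegral_mul_le (ℱ.le _)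
            ((hD n n.lt_succ_self).mono (ℱ.le _) le_rfl) hpast
      _ ≤ 1 := ih (fun b hb => hD b (hb.trans n.lt_succ_self))
          fun b hb => hstep b (hb.trans n.lt_succ_self)

theorem measure_le_sum_le_exp_neg (hτ : Monotone τ)
    (hD : ∀ b < n, Measurable[ℱ (τ (b + 1))] (D b))
    (hstep : ∀ b < n, ExpMomentLEOne P (ℱ (τ b)) (D b)) (a : ℝ) :
    P {ω | a ≤ ∑ b ∈ Finset.range n, D b ω} ≤ ENNReal.ofReal (Real.exp (-a)) := by
  have hmeas : Measurable fun ω => ENNReal.ofReal (Real.exp (∑ b ∈ Finset.range n, D b ω)) :=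
    (Finset.measurable_sum _ fun b hb =>
      (hD b (Finset.mem_range.1 hb)).mono (ℱ.le _) le_rfl).exp.ennreal_ofReal
  calc P {ω | a ≤ ∑ b ∈ Finset.range n, D b ω}
      ≤ P {ω | ENNReal.ofReal (Real.exp a) ≤
          ENNReal.ofReal (Real.exp (∑ b ∈ Finset.range n, D b ω))} :=
        measure_mono fun ω hω => ENNReal.ofReal_le_ofReal (Real.exp_le_exp.2 hω)
    _ ≤ (∫⁻ ω, ENNReal.ofReal (Real.exp (∑ b ∈ Finset.range n, D b ω)) ∂P) /
          ENNReal.ofReal (Real.exp a) :=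
        meas_ge_le_lintegral_div hmeas.aemeasurable (by simp [Real.exp_pos])
          ENNReal.ofReal_ne_top
    _ ≤ 1 / ENNReal.ofReal (Real.exp a) :=
        ENNReal.div_le_div_right (lintegral_exp_sum_le_one hτ hD hstep) _
    _ = ENNReal.ofReal (Real.exp (-a)) := by
        rw [Real.exp_neg, ENNReal.ofReal_inv_of_pos (Real.exp_pos a), one_div]

end Chernoff

open Classical in
theorem sum_indicator_const_mul_sub {n : ℕ} (s : Finset ℕ) (B : ℕ → Set Ω)
    (η : ℕ → Ω → ℝ) (l C : ℝ) {ω : Ω} (hω : (s.filter fun t => ω ∈ B t).card = n) :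
    ∑ t ∈ s, (B t).indicator (fun ω => l * η t ω - C) ω =
      l * ∑ t ∈ s with ω ∈ B t, η t ω - n * C := by
  simp only [Set.indicator_apply]
  rw [← Finset.sum_filter, Finset.sum_sub_distrib, ← Finset.mul_sum, Finset.sum_const, hω,
    nsmul_eq_mul]

variable [IsProbabilityMeasure P] {ℱ : Filtration ℕ mΩ} {T : ℕ} {η c : ℕ → Ω → ℝ}

theorem IsEnvironment.measure_le_sum_indicator_le (hE : IsEnvironment P ℱ T η c)
    {B : ℕ → Set Ω} (hB : ∀ t < T, MeasurableSet[ℱ (2 * t + 1)] (B t)) (l a : ℝ) :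
    P {ω | a ≤ ∑ t ∈ Finset.range T, (B t).indicator (fun ω => l * η t ω - l ^ 2 / 2) ω} ≤
      ENNReal.ofReal (Real.exp (-a)) := by
  refine measure_le_sum_le_exp_neg (ℱ := ℱ) (τ := fun t => 2 * t + 1)
    (fun s t h => by dsimp only; omega) (fun t ht => ?_)
    (fun t ht => (expMomentLEOne_of_subgaussian (ℱ.le _) (hE.integrable_exp_noise t ht l)
      (hE.subgaussian_noise t ht l)).indicator (ℱ.le _) (hB t ht)) a
  have hη : Measurable[ℱ (2 * (t + 1) + 1)] (η t) :=
    (hE.measurable_noise t ht).mono (ℱ.mono (by omega)) le_rfl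
  exact ((hη.const_mul l).sub_const _).indicator (ℱ.mono (by omega) _ (hB t ht))

open Classical in
theorem IsEnvironment.measure_sqrt_lt_abs_sum_noise_le (hE : IsEnvironment P ℱ T η c)
    {B : ℕ → Set Ω} (hB : ∀ t < T, MeasurableSet[ℱ (2 * t + 1)] (B t)) {n : ℕ} (hn : 0 < n)
    {a : ℝ} (ha : 0 ≤ a) :
    P {ω | ((Finset.range T).filter fun t => ω ∈ B t).card = n ∧
        √(2 * a * n) < |∑ t ∈ Finset.range T with ω ∈ B t, η t ω|} ≤
      ENNReal.ofReal (2 * Real.exp (-a)) := by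
  have : (0 : ℝ) < n := by exact_mod_cast hn
  -- the exponent that is optimal in Chernoff's bound
  set l := √(2 * a / n) with hl
  have hl2 : n * (l ^ 2 / 2) = a := by
    rw [Real.sq_sqrt (by positivity)]
    field_simp
  have hln : l * √(2 * a * n) = 2 * a := by
    rw [hl, ← Real.sqrt_mul (by positivity),
      show 2 * a / n * (2 * a * n) = (2 * a) ^ 2 by field_simp, Real.sqrt_sq (by positivity)]
  let exceeds (k : ℝ) : Set Ω :=
    {ω | a ≤ ∑ t ∈ Finset.range T, (B t).indicator (fun ω => k * η t ω - k ^ 2 / 2) ω}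
  calc _ ≤ P (exceeds l ∪ exceeds (-l)) := by
        refine measure_mono fun ω ⟨hcard, hlt⟩ => ?_
        have hexceeds : ∀ k, a ≤ k * ∑ t ∈ Finset.range T with ω ∈ B t, η t ω - n * (k ^ 2 / 2) →
            ω ∈ exceeds k := fun k hk => by
          rwa [← sum_indicator_const_mul_sub _ B η k _ hcard] at hk
        rcases lt_abs.1 hlt with h | h
        · refine Or.inl (hexceeds l ?_)
          linarith [mul_le_mul_of_nonneg_left h.le (Real.sqrt_nonneg _ : 0 ≤ l)]
        · refine Or.inr (hexceeds (-l) ?_)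
          rw [neg_sq]
          linarith [mul_le_mul_of_nonneg_left h.le (Real.sqrt_nonneg _ : 0 ≤ l)]
    _ ≤ ENNReal.ofReal (Real.exp (-a)) + ENNReal.ofReal (Real.exp (-a)) :=
        (measure_union_le _ _).trans (add_le_add (hE.measure_le_sum_indicator_le hB l a)
          (hE.measure_le_sum_indicator_le hB (-l) a))
    _ = ENNReal.ofReal (2 * Real.exp (-a)) := by
        rw [← ENNReal.ofReal_add (Real.exp_pos _).le (Real.exp_pos _).le, two_mul]

end Concentration

/-! ### Robust Zooming on accurate averages -/

section Zooming

variable {X : Type*}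

open Classical in
/-- The number of pulls of `v` in the first `k` rounds. -/
noncomputable def pulls (x : ℕ → X) (k : ℕ) (v : X) : ℕ :=
  ((Finset.range k).filter fun t => x t = v).card

open Classical in
/-- The sum of `y` over the pulls of `v` in the first `k` rounds. -/
noncomputable def pullSum (x : ℕ → X) (y : ℕ → ℝ) (k : ℕ) (v : X) : ℝ :=
  ∑ t ∈ Finset.range k with x t = v, y t

/-- The averages of `y` over the pulls of each arm in the first `k` rounds lie within the confidence
radius `r` of `μ`. -/
def IsAccurate (r : ℕ → ℝ) (μ : X → ℝ) (x : ℕ → X) (y : ℕ → ℝ) (k : ℕ) : Prop :=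
  ∀ v, 0 < pulls x k v → |pullSum x y k v / pulls x k v - μ v| ≤ r (pulls x k v)

/-- The properties of a confidence radius, as a function of the number of pulls, on which the
analysis of Robust Zooming rests. The value at `0` is irrelevant. -/
structure IsConfidenceRadius (r : ℕ → ℝ) : Prop where
  pos : ∀ n, 0 < n → 0 < r n
  one_le : 1 ≤ r 1
  succ_le : ∀ n, 0 < n → r (n + 1) ≤ r n
  le_two_mul_succ : ∀ n, 0 < n → r n ≤ 2 * r (n + 1)

theorem pulls_zero (x : ℕ → X) (v : X) : pulls x 0 v = 0 := by simp [pulls]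

theorem pulls_succ_self (x : ℕ → X) (k : ℕ) : pulls x (k + 1) (x k) = pulls x k (x k) + 1 := by
  simp [pulls, Finset.range_add_one, Finset.filter_insert]

theorem pulls_succ_of_ne (x : ℕ → X) (k : ℕ) {v : X} (h : v ≠ x k) :
    pulls x (k + 1) v = pulls x k v := by
  simp [pulls, Finset.range_add_one, Finset.filter_insert, h.symm]

theorem pullSum_zero (x : ℕ → X) (y : ℕ → ℝ) (v : X) : pullSum x y 0 v = 0 := by simp [pullSum]

theorem pullSum_succ_self (x : ℕ → X) (y : ℕ → ℝ) (k : ℕ) :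
    pullSum x y (k + 1) (x k) = pullSum x y k (x k) + y k := by
  simp [pullSum, Finset.range_add_one, Finset.filter_insert, add_comm]

theorem pullSum_succ_of_ne (x : ℕ → X) (y : ℕ → ℝ) (k : ℕ) {v : X} (h : v ≠ x k) :
    pullSum x y (k + 1) v = pullSum x y k v := by
  simp [pullSum, Finset.range_add_one, Finset.filter_insert, h.symm]

variable [MetricSpace X] {r : ℕ → ℝ} {μ : X → ℝ} {xopt : X} {x : ℕ → X} {y : ℕ → ℝ} {k : ℕ}
  {s s' : ZoomState X}

theorem ZoomState.Pull.arms_eq {z : X} (hs : s.Pull r z s') : s'.arms = insert z s.arms := by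
  rcases hs with ⟨-, -, -, rfl⟩ | ⟨-, hz, -, rfl⟩
  exacts [rfl, (Set.insert_eq_of_mem hz).symm]

theorem ZoomState.Pull.space_eq {z : X} (hs : s.Pull r z s') : s'.space = s.space := by
  rcases hs with ⟨-, -, -, rfl⟩ | ⟨-, -, -, rfl⟩ <;> rfl

/-- The invariants of Robust Zooming after `k` rounds: the memory is in step with the history, an
arm that was ever pulled is active or its ball has been removed, pulled arms are separated by their
radii, an optimal arm survives, and pulled arms have small gaps. -/
structure ZoomInvariant (r : ℕ → ℝ) (μ : X → ℝ) (xopt : X) (x : ℕ → X) (y : ℕ → ℝ) (k : ℕ)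
    (s : ZoomState X) : Prop where
  count_eq : ∀ v, s.count v = pulls x k v
  mean_mul : ∀ v, s.mean v * pulls x k v = pullSum x y k v
  pulls_pos : ∀ v ∈ s.arms, 0 < pulls x k v
  removed : ∀ u, 0 < pulls x k u →
    u ∈ s.arms ∨ Disjoint (Metric.closedBall u (r (pulls x k u))) s.space
  separated : ∀ u v, 0 < pulls x k u → 0 < pulls x k v → u ≠ v →
    min (r (pulls x k u)) (r (pulls x k v)) < dist u v
  optimal : xopt ∈ s.space ∨ ∃ v ∈ s.arms, μ v = μ xopt
  gap_le : ∀ v, 0 < pulls x k v → μ xopt - μ v ≤ 6 * r (pulls x k v)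

namespace ZoomInvariant

theorem init : ZoomInvariant r μ xopt x y 0 (ZoomState.init X) where
  count_eq v := by simp only [ZoomState.init, pulls_zero]
  mean_mul v := by simp only [pulls_zero, pullSum_zero, Nat.cast_zero, mul_zero]
  pulls_pos v hv := hv.elim
  removed u hu := by simp [pulls_zero] at hu
  separated u v hu := by simp [pulls_zero] at hu
  optimal := Or.inl (Set.mem_univ xopt)
  gap_le v hv := by simp [pulls_zero] at hv

theorem abs_mean_sub_le (h : ZoomInvariant r μ xopt x y k s) (hacc : IsAccurate r μ x y k)
    {v : X} (hv : v ∈ s.arms) : |s.mean v - μ v| ≤ r (s.count v) := by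
  have hpos := h.pulls_pos v hv
  have hmean : s.mean v = pullSum x y k v / pulls x k v :=
    eq_div_of_mul_eq (by exact_mod_cast hpos.ne') (h.mean_mul v)
  rw [hmean, h.count_eq]
  exact hacc v hpos

theorem radius_pos (h : ZoomInvariant r μ xopt x y k s) (hr : IsConfidenceRadius r)
    {v : X} (hv : v ∈ s.arms) : 0 < r (s.count v) :=
  hr.pos _ (by rw [h.count_eq]; exact h.pulls_pos v hv)

theorem add_radius_le_of_dominated (h : ZoomInvariant r μ xopt x y k s)
    (hacc : IsAccurate r μ x y k) {u v : X} (huv : s.Dominated r u v) :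
    μ u + r (s.count u) ≤ μ v := by
  obtain ⟨hu, hv, hle⟩ := huv
  linarith [(abs_le.1 (h.abs_mean_sub_le hacc hu)).1, (abs_le.1 (h.abs_mean_sub_le hacc hv)).2]

theorem removal (h : ZoomInvariant r μ xopt x y k s) (hr : IsConfidenceRadius r)
    (hμ : LipschitzWith 1 μ) (hopt : ∀ x, μ x ≤ μ xopt) (hacc : IsAccurate r μ x y k)
    (hs : s.Removal r s') : ZoomInvariant r μ xopt x y k s' := by
  rcases hs with ⟨u, v, huv, rfl⟩ | ⟨-, rfl⟩
  swap; · exact h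
  have hbetter : μ u + r (s.count u) ≤ μ v := h.add_radius_le_of_dominated hacc huv
  have hru : 0 < r (s.count u) := h.radius_pos hr huv.1
  refine ⟨h.count_eq, h.mean_mul, fun w hw => h.pulls_pos w hw.1, fun w hw => ?_, h.separated, ?_,
    h.gap_le⟩
  · by_cases hwu : w = u
    · subst hwu
      rw [← h.count_eq]
      exact Or.inr Set.disjoint_sdiff_right
    · exact (h.removed w hw).imp (fun hw => ⟨hw, hwu⟩) fun hw => hw.mono_right Set.sdiff_subset
  · rcases h.optimal with hspace | ⟨w, hw, hwopt⟩
    · by_cases hball : xopt ∈ Metric.closedBall u (r (s.count u))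
      · have hclose : μ xopt ≤ μ u + dist xopt u := by simpa using hμ.le_add_mul xopt u
        refine Or.inr ⟨v, ⟨huv.2.1, ?_⟩, le_antisymm (hopt v) ?_⟩
        · rintro rfl
          linarith
        · linarith [Metric.mem_closedBall.1 hball]
      · exact Or.inl ⟨hspace, hball⟩
    · refine Or.inr ⟨w, ⟨hw, ?_⟩, hwopt⟩
      rintro rfl
      linarith [hopt v]

theorem lt_dist_of_notMem_covered (h : ZoomInvariant r μ xopt x y k s) {z : X}
    (hsp : z ∈ s.space) (hcov : z ∉ s.covered r) {u : X} (hu : 0 < pulls x k u) :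
    r (pulls x k u) < dist z u := by
  rw [← not_le, ← Metric.mem_closedBall]
  intro hmem
  rcases h.removed u hu with harm | hdisj
  · exact hcov (Set.mem_biUnion harm (by rwa [h.count_eq]))
  · exact Set.disjoint_left.1 hdisj hmem hsp

theorem pulls_eq_zero_of_notMem_covered (h : ZoomInvariant r μ xopt x y k s)
    (hr : IsConfidenceRadius r) {z : X} (hsp : z ∈ s.space) (hcov : z ∉ s.covered r) :
    pulls x k z = 0 := by
  by_contra hne
  have hlt := h.lt_dist_of_notMem_covered hsp hcov (Nat.pos_of_ne_zero hne)
  rw [dist_self] at hlt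
  exact (hr.pos _ (Nat.pos_of_ne_zero hne)).not_gt hlt

theorem exists_optimistic (h : ZoomInvariant r μ xopt x y k s) (hr : IsConfidenceRadius r)
    (hμ : LipschitzWith 1 μ) (hacc : IsAccurate r μ x y k) (hcov : s.space ⊆ s.covered r) :
    ∃ v ∈ s.arms, μ xopt ≤ s.mean v + 2 * r (s.count v) := by
  rcases h.optimal with hspace | ⟨v, hv, hvopt⟩
  · obtain ⟨v, hv, hball⟩ := Set.mem_iUnion₂.1 (hcov hspace)
    have hclose : μ xopt ≤ μ v + dist xopt v := by simpa using hμ.le_add_mul xopt v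
    exact ⟨v, hv, by
      linarith [(abs_le.1 (h.abs_mean_sub_le hacc hv)).1, Metric.mem_closedBall.1 hball]⟩
  · exact ⟨v, hv, by
      linarith [(abs_le.1 (h.abs_mean_sub_le hacc hv)).1, h.radius_pos hr hv]⟩

theorem count_eq_of_pull (h : ZoomInvariant r μ xopt x y k s) (hr : IsConfidenceRadius r)
    (hs : s.Pull r (x k) s') (v : X) : s'.count v = pulls x k v := by
  rcases hs with ⟨-, hsp, hcov, rfl⟩ | ⟨-, -, -, rfl⟩
  · by_cases hv : v = x k
    · subst hv
      simp [ZoomState.activate, h.pulls_eq_zero_of_notMem_covered hr hsp hcov]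
    · simp [ZoomState.activate, hv, h.count_eq]
  · exact h.count_eq v

theorem mean_mul_of_pull (h : ZoomInvariant r μ xopt x y k s) (hr : IsConfidenceRadius r)
    (hs : s.Pull r (x k) s') (v : X) : s'.mean v * pulls x k v = pullSum x y k v := by
  rcases hs with ⟨-, hsp, hcov, rfl⟩ | ⟨-, -, -, rfl⟩
  · by_cases hv : v = x k
    · subst hv
      rw [← h.mean_mul, h.pulls_eq_zero_of_notMem_covered hr hsp hcov, Nat.cast_zero, mul_zero,
        mul_zero]
    · simp [ZoomState.activate, hv, h.mean_mul]
  · exact h.mean_mul v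

theorem min_radius_succ_lt_dist_of_pull (h : ZoomInvariant r μ xopt x y k s)
    (hr : IsConfidenceRadius r) (hs : s.Pull r (x k) s') {u : X} (huk : u ≠ x k)
    (hu : 0 < pulls x k u) :
    min (r (pulls x (k + 1) u)) (r (pulls x (k + 1) (x k))) < dist u (x k) := by
  rw [pulls_succ_of_ne x k huk, pulls_succ_self]
  rcases hs with ⟨-, hsp, hcov, -⟩ | ⟨-, harm, -, -⟩
  · rw [dist_comm]
    exact (min_le_left _ _).trans_lt (h.lt_dist_of_notMem_covered hsp hcov hu)
  · have hpos := h.pulls_pos _ harm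
    exact (min_le_min_left _ (hr.succ_le _ hpos)).trans_lt (h.separated u (x k) hu hpos huk)

theorem gap_le_of_pull (h : ZoomInvariant r μ xopt x y k s) (hr : IsConfidenceRadius r)
    (hs : s.Pull r (x k) s') (hμ : LipschitzWith 1 μ) (hμ01 : ∀ x, μ x ∈ Set.Icc (0 : ℝ) 1)
    (hacc : IsAccurate r μ x y k) : μ xopt - μ (x k) ≤ 6 * r (pulls x k (x k) + 1) := by
  rcases hs with ⟨-, hsp, hcov, -⟩ | ⟨hcov, harm, hmax, -⟩
  · rw [h.pulls_eq_zero_of_notMem_covered hr hsp hcov]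
    linarith [(hμ01 xopt).2, (hμ01 (x k)).1, hr.one_le]
  · obtain ⟨v, hv, hle⟩ := h.exists_optimistic hr hμ hacc hcov
    have hindex := hmax v hv
    have hmean := (abs_le.1 (h.abs_mean_sub_le hacc harm)).2
    rw [h.count_eq (x k)] at hindex hmean
    linarith [hr.le_two_mul_succ _ (h.pulls_pos _ harm)]

theorem separated_of_pull (h : ZoomInvariant r μ xopt x y k s) (hr : IsConfidenceRadius r)
    (hs : s.Pull r (x k) s') (u v : X) (hu : 0 < pulls x (k + 1) u) (hv : 0 < pulls x (k + 1) v)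
    (huv : u ≠ v) : min (r (pulls x (k + 1) u)) (r (pulls x (k + 1) v)) < dist u v := by
  by_cases huk : u = x k
  · subst huk
    rw [pulls_succ_of_ne x k huv.symm] at hv
    rw [min_comm, dist_comm]
    exact h.min_radius_succ_lt_dist_of_pull hr hs huv.symm hv
  · rw [pulls_succ_of_ne x k huk] at hu
    by_cases hvk : v = x k
    · subst hvk
      exact h.min_radius_succ_lt_dist_of_pull hr hs huv hu
    · rw [pulls_succ_of_ne x k hvk] at hv
      rw [pulls_succ_of_ne x k huk, pulls_succ_of_ne x k hvk]
      exact h.separated u v hu hv huv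

theorem mean_observe_mul_of_pull (h : ZoomInvariant r μ xopt x y k s) (hr : IsConfidenceRadius r)
    (hs : s.Pull r (x k) s') (v : X) :
    (s'.observe (x k) (y k)).mean v * pulls x (k + 1) v = pullSum x y (k + 1) v := by
  by_cases hv : v = x k
  · subst hv
    have hne : (pulls x k (x k) : ℝ) + 1 ≠ 0 := by positivity
    simp only [ZoomState.observe, Function.update_self, h.count_eq_of_pull hr hs,
      h.mean_mul_of_pull hr hs, pulls_succ_self, pullSum_succ_self]
    push_cast
    field_simp
  · simp [ZoomState.observe, hv, h.mean_mul_of_pull hr hs, pulls_succ_of_ne, pullSum_succ_of_ne]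

theorem pull_observe (h : ZoomInvariant r μ xopt x y k s) (hr : IsConfidenceRadius r)
    (hs : s.Pull r (x k) s') (hμ : LipschitzWith 1 μ) (hμ01 : ∀ x, μ x ∈ Set.Icc (0 : ℝ) 1)
    (hacc : IsAccurate r μ x y k) :
    ZoomInvariant r μ xopt x y (k + 1) (s'.observe (x k) (y k)) where
  count_eq v := by
    by_cases hv : v = x k
    · subst hv
      simp [ZoomState.observe, h.count_eq_of_pull hr hs, pulls_succ_self]
    · simp [ZoomState.observe, hv, h.count_eq_of_pull hr hs, pulls_succ_of_ne]
  mean_mul := h.mean_observe_mul_of_pull hr hs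
  pulls_pos v hv := by
    by_cases hvk : v = x k
    · rw [hvk, pulls_succ_self]
      exact Nat.succ_pos _
    · rw [pulls_succ_of_ne x k hvk]
      exact h.pulls_pos v (Set.mem_of_mem_insert_of_ne (hs.arms_eq ▸ hv) hvk)
  removed u hu := by
    change u ∈ s'.arms ∨ Disjoint _ s'.space
    rw [hs.arms_eq, hs.space_eq]
    by_cases huk : u = x k
    · exact Or.inl (huk ▸ Set.mem_insert _ _)
    · rw [pulls_succ_of_ne x k huk] at hu ⊢
      exact (h.removed u hu).imp_left (Set.mem_insert_of_mem _)
  separated := h.separated_of_pull hr hs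
  optimal := by
    change xopt ∈ s'.space ∨ ∃ v ∈ s'.arms, μ v = μ xopt
    rw [hs.arms_eq, hs.space_eq]
    exact h.optimal.imp_right fun ⟨v, hv, hvopt⟩ => ⟨v, Set.mem_insert_of_mem _ hv, hvopt⟩
  gap_le v hv := by
    by_cases hvk : v = x k
    · rw [hvk, pulls_succ_self]
      exact h.gap_le_of_pull hr hs hμ hμ01 hacc
    · rw [pulls_succ_of_ne x k hvk] at hv ⊢
      exact h.gap_le v hv

theorem of_round (hr : IsConfidenceRadius r) (hμ : LipschitzWith 1 μ)
    (hμ01 : ∀ x, μ x ∈ Set.Icc (0 : ℝ) 1) (hopt : ∀ x, μ x ≤ μ xopt) {σ : ℕ → ZoomState X}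
    (h0 : σ 0 = ZoomState.init X) (hacc : ∀ j < k, IsAccurate r μ x y j)
    (hσ : ∀ j < k, ZoomState.Round r (σ j) (x j) (y j) (σ (j + 1))) :
    ZoomInvariant r μ xopt x y k (σ k) := by
  induction k with
  | zero => rw [h0]; exact init
  | succ k ih =>
    obtain ⟨s₁, s₂, hremoval, hpull, hobserve⟩ := hσ k k.lt_succ_self
    have hk := ih (fun j hj => hacc j (hj.trans k.lt_succ_self))
      fun j hj => hσ j (hj.trans k.lt_succ_self)
    rw [hobserve]
    exact (hk.removal hr hμ hopt (hacc k k.lt_succ_self) hremoval).pull_observe hr hpull hμ hμ01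
      (hacc k k.lt_succ_self)

end ZoomInvariant

end Zooming

/-! ### Regret of Robust Zooming -/

section ConfidenceRadius

/-- The confidence radius `√(L / n) + w / n` of an arm after `n` pulls: the radius of Robust Zooming
with level `w`, for `L = 4 ln T + 2 ln (2 / δ)`. -/
noncomputable def confidenceRadius (L w : ℝ) (n : ℕ) : ℝ := √(L / n) + w / n

variable {L w : ℝ}

theorem isConfidenceRadius_confidenceRadius (hL : 0 ≤ L) (hw : 1 ≤ w) :
    IsConfidenceRadius (confidenceRadius L w) where
  pos n hn := by unfold confidenceRadius; positivity
  one_le := by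
    have := Real.sqrt_nonneg (L / (1 : ℕ))
    simp only [confidenceRadius, Nat.cast_one, div_one] at this ⊢
    linarith
  succ_le n hn := by
    have : (0 : ℝ) < n := by exact_mod_cast hn
    unfold confidenceRadius
    gcongr <;> simp
  le_two_mul_succ n hn := by
    have hn' : (0 : ℝ) < n := by exact_mod_cast hn
    have hdiv : ∀ a : ℝ, 0 ≤ a → a / n ≤ 2 * (a / (n + 1 : ℕ)) := fun a ha => by
      rw [← mul_div_assoc, div_le_div_iff₀ hn' (by positivity)]
      have hn1 : (1 : ℝ) ≤ n := by exact_mod_cast hn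
      push_cast
      nlinarith
    have hsqrt : √(L / n) ≤ 2 * √(L / (n + 1 : ℕ)) := by
      refine Real.sqrt_le_iff.2 ⟨by positivity, ?_⟩
      rw [mul_pow, Real.sq_sqrt (by positivity)]
      have : 0 ≤ L / (n + 1 : ℕ) := by positivity
      linarith [hdiv L hL]
    unfold confidenceRadius
    linarith [hdiv w (by linarith)]

theorem natCast_mul_confidenceRadius {n : ℕ} (hn : 0 < n) :
    n * confidenceRadius L w n = √(L * n) + w := by
  have hn' : (0 : ℝ) < n := by exact_mod_cast hn
  have hsq : L * (n : ℝ) = (n : ℝ) ^ 2 * (L / n) := by field_simp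
  rw [confidenceRadius, mul_add, mul_div_cancel₀ _ hn'.ne', hsq, Real.sqrt_mul (by positivity),
    Real.sqrt_sq hn'.le]

end ConfidenceRadius

section CauchySchwarz

theorem sum_sqrt_mul_le {ι : Type*} (s : Finset ι) {L : ℝ} (hL : 0 ≤ L) {a : ι → ℝ}
    (ha : ∀ i ∈ s, 0 ≤ a i) : ∑ i ∈ s, √(L * a i) ≤ √(L * s.card * ∑ i ∈ s, a i) := by
  refine Real.le_sqrt_of_sq_le ?_
  calc (∑ i ∈ s, √(L * a i)) ^ 2 ≤ s.card * ∑ i ∈ s, √(L * a i) ^ 2 := sq_sum_le_card_mul_sum_sq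
    _ = s.card * ∑ i ∈ s, L * a i := by
      rw [Finset.sum_congr rfl fun i hi => Real.sq_sqrt (mul_nonneg hL (ha i hi))]
    _ = L * s.card * ∑ i ∈ s, a i := by rw [← Finset.mul_sum]; ring

end CauchySchwarz

section ZoomingRegret

variable {X : Type*}

open Classical in
theorem sum_range_comp_eq_sum_pulls_mul (f : X → ℝ) (x : ℕ → X) (k : ℕ) :
    ∑ t ∈ Finset.range k, f (x t) = ∑ v ∈ (Finset.range k).image x, pulls x k v * f v := by
  rw [Finset.sum_comp f x]
  exact Finset.sum_congr rfl fun v _ => by rw [nsmul_eq_mul]; rfl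

variable [MetricSpace X] {d κ : ℝ}

theorem HasCoveringBound.coveringNumber_ne_top (h : HasCoveringBound X d κ) {r : ℝ≥0} (hr : 0 < r)
    (hr1 : r ≤ 1) : Metric.coveringNumber r (Set.univ : Set X) ≠ ⊤ := fun htop => by
  simpa [htop] using h r hr hr1

theorem HasCoveringBound.secondCountableTopology (h : HasCoveringBound X d κ) :
    SecondCountableTopology X := by
  refine Metric.secondCountable_of_almost_dense_set fun ε hε => ?_
  set r : ℝ≥0 := min 1 ⟨ε, hε.le⟩
  have hr : 0 < r := lt_min one_pos hε
  have hcover := Metric.isCover_minimalCover (h.coveringNumber_ne_top hr (min_le_left _ _))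
  refine ⟨Metric.minimalCover r Set.univ, Metric.finite_minimalCover.countable, fun x => ?_⟩
  obtain ⟨y, hy, hxy⟩ := hcover (Set.mem_univ x)
  refine ⟨y, hy, ?_⟩
  have hdist : edist x y ≤ r := hxy
  rw [edist_nndist, ENNReal.coe_le_coe] at hdist
  exact hdist.trans (min_le_right _ _)

theorem HasCoveringBound.card_le (h : HasCoveringBound X d κ) (hκ : 0 ≤ κ) {ρ : ℝ}
    (hρ : 0 < ρ) (hρ1 : ρ ≤ 1) (V : Finset X)
    (hV : ∀ u ∈ V, ∀ v ∈ V, u ≠ v → ρ < dist u v) : (V.card : ℝ) ≤ κ * (ρ / 2) ^ (-d) := by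
  obtain ⟨ε, rfl⟩ : ∃ ε : ℝ≥0, ρ = 2 * ε :=
    ⟨⟨ρ / 2, by positivity⟩, (mul_div_cancel₀ ρ two_ne_zero).symm⟩
  have hε : 0 < ε := by exact_mod_cast (pos_of_mul_pos_right hρ zero_le_two)
  have hε1 : ε ≤ 1 := by rw [← NNReal.coe_le_coe, NNReal.coe_one]; linarith
  have hsep : Metric.IsSeparated ((2 * ε : ℝ≥0) : ℝ≥0∞) (V : Set X) := by
    intro u hu v hv huv
    rw [edist_nndist, ENNReal.coe_lt_coe, ← NNReal.coe_lt_coe]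
    exact hV u hu v hv huv
  have hcard : (V : Set X).encard ≤ Metric.coveringNumber ε (Set.univ : Set X) :=
    (hsep.encard_le_packingNumber (Set.subset_univ _)).trans
      ((Metric.packingNumber_two_mul_le_externalCoveringNumber ε _).trans
        (Metric.externalCoveringNumber_le_coveringNumber ε _))
  have hle := (ENat.toENNReal_le.2 hcard).trans (h ε hε hε1)
  rw [Set.encard_coe_eq_coe_finsetCard, ENat.toENNReal_coe, ← ENNReal.ofReal_natCast] at hle
  rw [mul_div_cancel_left₀ _ two_ne_zero]
  exact (ENNReal.ofReal_le_ofReal_iff (by positivity)).1 hle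

variable {L w : ℝ} {μ : X → ℝ} {xopt : X} {x : ℕ → X} {y : ℕ → ℝ} {H : ℕ} {s : ZoomState X}

namespace ZoomInvariant

theorem card_le_radius {r : ℕ → ℝ} (h : ZoomInvariant r μ xopt x y H s)
    (hX : HasCoveringBound X d κ) (hκ : 0 ≤ κ) {ρ : ℝ} (hρ : 0 < ρ) (hρ1 : ρ ≤ 1) {V : Finset X}
    (hV : ∀ v ∈ V, 0 < pulls x H v ∧ ρ ≤ r (pulls x H v)) :
    (V.card : ℝ) ≤ κ * (ρ / 2) ^ (-d) :=
  hX.card_le hκ hρ hρ1 V fun u hu v hv huv =>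
    (le_min (hV u hu).2 (hV v hv).2).trans_lt (h.separated u v (hV u hu).1 (hV v hv).1 huv)

theorem pulls_mul_gap_le (h : ZoomInvariant (confidenceRadius L w) μ xopt x y H s) {ρ : ℝ}
    (hρ : 0 ≤ ρ) {v : X} (hv : 0 < pulls x H v) :
    pulls x H v * (μ xopt - μ v) ≤ 6 * (ρ * pulls x H v +
      if ρ ≤ confidenceRadius L w (pulls x H v) then √(L * pulls x H v) + w else 0) := by
  have hn : (0 : ℝ) ≤ pulls x H v := Nat.cast_nonneg _
  have hgap := mul_le_mul_of_nonneg_left (h.gap_le v hv) hn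
  split_ifs with hif
  · linarith [natCast_mul_confidenceRadius (L := L) (w := w) hv, mul_nonneg hρ hn]
  · linarith [mul_le_mul_of_nonneg_right (not_le.1 hif).le hn]

/- Arms of radius below `ρ` have gaps below `6ρ`; the number of the others is controlled by their
separation. -/
open Classical in
theorem sum_gap_le (h : ZoomInvariant (confidenceRadius L w) μ xopt x y H s)
    (hX : HasCoveringBound X d κ) (hκ : 0 ≤ κ) (hL : 0 ≤ L) (hw : 0 ≤ w) {ρ : ℝ} (hρ : 0 < ρ)
    (hρ1 : ρ ≤ 1) :
    ∑ t ∈ Finset.range H, (μ xopt - μ (x t)) ≤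
      6 * (ρ * H + √(L * (κ * (ρ / 2) ^ (-d)) * H) + κ * (ρ / 2) ^ (-d) * w) := by
  set K := κ * (ρ / 2) ^ (-d)
  set V := (Finset.range H).image x
  have hpos : ∀ v ∈ V, 0 < pulls x H v := fun v hv => by
    obtain ⟨t, ht, rfl⟩ := Finset.mem_image.1 hv
    exact Finset.card_pos.2 ⟨t, Finset.mem_filter.2 ⟨ht, rfl⟩⟩
  have hsum : ∑ v ∈ V, (pulls x H v : ℝ) = H := by
    simpa using (sum_range_comp_eq_sum_pulls_mul (fun _ => 1) x H).symm
  set W := V.filter fun v => ρ ≤ confidenceRadius L w (pulls x H v)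
  have hWV : W ⊆ V := Finset.filter_subset _ _
  have hcard : (W.card : ℝ) ≤ K := h.card_le_radius hX hκ hρ hρ1 fun v hv =>
    ⟨hpos v (hWV hv), (Finset.mem_filter.1 hv).2⟩
  have hsumW : ∑ v ∈ W, (pulls x H v : ℝ) ≤ H :=
    (Finset.sum_le_sum_of_subset_of_nonneg hWV fun _ _ _ => Nat.cast_nonneg _).trans_eq hsum
  have hsqrt : ∑ v ∈ W, √(L * pulls x H v) ≤ √(L * K * H) :=
    (sum_sqrt_mul_le W hL fun _ _ => Nat.cast_nonneg _).trans (by gcongr)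
  calc ∑ t ∈ Finset.range H, (μ xopt - μ (x t))
      = ∑ v ∈ V, pulls x H v * (μ xopt - μ v) :=
        sum_range_comp_eq_sum_pulls_mul (fun v => μ xopt - μ v) x H
    _ ≤ ∑ v ∈ V, 6 * (ρ * pulls x H v +
          if ρ ≤ confidenceRadius L w (pulls x H v) then √(L * pulls x H v) + w else 0) :=
        Finset.sum_le_sum fun v hv => h.pulls_mul_gap_le hρ.le (hpos v hv)
    _ = 6 * (ρ * H + (∑ v ∈ W, √(L * pulls x H v) + W.card * w)) := by
        rw [← Finset.mul_sum, Finset.sum_add_distrib, ← Finset.mul_sum, hsum, ← Finset.sum_filter,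
          Finset.sum_add_distrib, Finset.sum_const, nsmul_eq_mul]
    _ ≤ 6 * (ρ * H + (√(L * K * H) + K * w)) := by gcongr
    _ = 6 * (ρ * H + √(L * K * H) + K * w) := by ring

end ZoomInvariant

theorem rpow_neg_mul_le_rpow_mul {ρ a H e d : ℝ} (hH : 0 < H) (ha : 0 ≤ a) (hρ : 0 < ρ)
    (he : 0 < d + e) (h : (a / H) ^ (1 / (d + e)) ≤ ρ) : ρ ^ (-d) * a ≤ ρ ^ e * H := by
  have hpow : a / H ≤ ρ ^ (d + e) := by
    rwa [one_div, Real.rpow_inv_le_iff_of_pos (by positivity) hρ.le he] at h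
  calc ρ ^ (-d) * a ≤ ρ ^ (-d) * (ρ ^ (d + e) * H) := by
        gcongr; exact (div_le_iff₀ hH).1 hpow
    _ = ρ ^ e * H := by rw [← mul_assoc, ← Real.rpow_add hρ, neg_add_cancel_left]

/- The scale `ρ` balances the three terms of `ZoomInvariant.sum_gap_le`. -/
theorem ZoomInvariant.sum_gap_le_max
    (h : ZoomInvariant (confidenceRadius L w) μ xopt x y H s) (hd : 0 ≤ d)
    (hX : HasCoveringBound X d κ) (hκ : 0 ≤ κ) (hL : 0 ≤ L) (hw : 0 ≤ w)
    (hμ01 : ∀ x, μ x ∈ Set.Icc (0 : ℝ) 1) (hH : 0 < H) :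
    ∑ t ∈ Finset.range H, (μ xopt - μ (x t)) ≤
      6 * (1 + √(L * (κ * 2 ^ d)) + κ * 2 ^ d) *
        (H * max ((H : ℝ) ^ (-(1 / (d + 2)))) ((w / H) ^ (1 / (d + 1)))) := by
  have hH' : (0 : ℝ) < H := by exact_mod_cast hH
  set ρ := max ((H : ℝ) ^ (-(1 / (d + 2)))) ((w / H) ^ (1 / (d + 1)))
  have hρ : 0 < ρ := lt_max_of_lt_left (Real.rpow_pos_of_pos hH' _)
  set K := κ * (2 : ℝ) ^ d
  have hK0 : 0 ≤ K := by positivity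
  rcases le_or_gt ρ 1 with hle | hgt
  · have hK : κ * (ρ / 2) ^ (-d) = K * ρ ^ (-d) := by
      rw [Real.div_rpow hρ.le zero_le_two, Real.rpow_neg zero_le_two, div_inv_eq_mul]; ring
    have hpull : ρ ^ (-d) * 1 ≤ ρ ^ (2 : ℝ) * H := by
      refine rpow_neg_mul_le_rpow_mul hH' zero_le_one hρ (by positivity) ?_
      rw [one_div, Real.inv_rpow hH'.le, ← Real.rpow_neg hH'.le]
      exact le_max_left _ _
    have hcorr : ρ ^ (-d) * w ≤ ρ ^ (1 : ℝ) * H :=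
      rpow_neg_mul_le_rpow_mul hH' hw hρ (by positivity) (le_max_right _ _)
    rw [mul_one, Real.rpow_two] at hpull
    rw [Real.rpow_one] at hcorr
    have hsqrt : √(L * (K * ρ ^ (-d)) * H) ≤ √(L * K) * (H * ρ) := by
      calc √(L * (K * ρ ^ (-d)) * H) ≤ √(L * (K * (ρ ^ 2 * H)) * H) := by gcongr
        _ = √(L * K * (H * ρ) ^ 2) := by congr 1; ring
        _ = √(L * K) * (H * ρ) := by
          rw [Real.sqrt_mul (by positivity), Real.sqrt_sq (by positivity)]
    have hsum := h.sum_gap_le hX hκ hL hw hρ hle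
    rw [hK] at hsum
    linarith [mul_le_mul_of_nonneg_left hcorr hK0]
  · calc ∑ t ∈ Finset.range H, (μ xopt - μ (x t)) ≤ ∑ _ ∈ Finset.range H, (1 : ℝ) :=
          Finset.sum_le_sum fun t _ => by linarith [(hμ01 xopt).2, (hμ01 (x t)).1]
      _ = 1 * (H * 1) := by simp
      _ ≤ 6 * (1 + √(L * K) + K) * (H * ρ) := by
          have := Real.sqrt_nonneg (L * K)
          gcongr
          linarith

end ZoomingRegret

/-! ### The EXP3.P inequality along a path -/

section ImportanceEstimate

variable {ι : Type*} [DecidableEq ι]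

/-- The EXP3.P estimate of the reward of action `j` when action `i`, drawn with the probabilities
`p`, has earned the reward `g`: the importance weighted reward, biased upwards by `β / p j`. -/
noncomputable def importanceEstimate (β g : ℝ) (p : ι → ℝ) (i j : ι) : ℝ :=
  (if i = j then g / p j else 0) + β / p j

variable {β g : ℝ} {p : ι → ℝ}

theorem abs_importanceEstimate_le (hβ : 0 ≤ β) (hg : |g| ≤ 1) (hp : ∀ j, 0 < p j) (i j : ι) :
    |importanceEstimate β g p i j| ≤ (1 + β) / p j := by
  have habs : |if i = j then g / p j else 0| ≤ 1 / p j := by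
    split_ifs
    · rw [abs_div, abs_of_pos (hp j)]
      exact div_le_div_of_nonneg_right hg (hp j).le
    · simpa only [abs_zero] using (one_div_pos.2 (hp j)).le
  rw [add_div]
  refine (abs_add_le _ _).trans (add_le_add habs ?_)
  rw [abs_of_nonneg (div_nonneg hβ (hp j).le)]

variable [Fintype ι]

theorem sum_mul_importanceEstimate (hp : ∀ j, 0 < p j) (i : ι) :
    ∑ j, p j * importanceEstimate β g p i j = g + Fintype.card ι * β := by
  have hterm : ∀ j, p j * importanceEstimate β g p i j = (if i = j then g else 0) + β := fun j => by
    have := (hp j).ne'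
    unfold importanceEstimate
    split_ifs
    · field_simp
    · rw [zero_add, zero_add, mul_div_cancel₀ _ this]
  simp [hterm, Finset.sum_add_distrib]

theorem neg_sum_importanceEstimate_le (hβ : 0 ≤ β) (hg : |g| ≤ 1) (hp : ∀ j, 0 < p j) (i : ι) :
    -∑ j, importanceEstimate β g p i j ≤ 1 / p i := by
  have hsum : g / p i ≤ ∑ j, importanceEstimate β g p i j := by
    simp only [importanceEstimate, Finset.sum_add_distrib, Finset.sum_ite_eq, Finset.mem_univ,
      if_true]
    exact le_add_of_nonneg_right (Finset.sum_nonneg fun j _ => div_nonneg hβ (hp j).le)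
  have hle : -g / p i ≤ 1 / p i :=
    div_le_div_of_nonneg_right (by linarith [(abs_le.1 hg).1]) (hp i).le
  rw [neg_div] at hle
  linarith

theorem sum_mul_sq_importanceEstimate_le (hg : |g| ≤ 1) (hp : ∀ j, 0 < p j) (i : ι) :
    ∑ j, p j * importanceEstimate β g p i j ^ 2 ≤ 2 * (1 / p i + β ^ 2 * ∑ j, 1 / p j) := by
  have hterm : ∀ j, p j * importanceEstimate β g p i j ^ 2 ≤
      2 * ((if i = j then 1 / p j else 0) + β ^ 2 * (1 / p j)) := fun j => by
    have hp' := (hp j).ne'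
    have hg2 : (if i = j then g else 0) ^ 2 ≤ if i = j then (1 : ℝ) else 0 := by
      split_ifs
      · exact (sq_le_one_iff_abs_le_one g).2 hg
      · norm_num
    calc p j * importanceEstimate β g p i j ^ 2 = ((if i = j then g else 0) + β) ^ 2 / p j := by
          rw [importanceEstimate]
          split_ifs
          · field_simp
          · rw [zero_add, zero_add]; field_simp
      _ ≤ 2 * ((if i = j then 1 else 0) + β ^ 2) / p j :=
          div_le_div_of_nonneg_right (add_sq_le.trans (by gcongr)) (hp j).le
      _ = 2 * ((if i = j then 1 / p j else 0) + β ^ 2 * (1 / p j)) := by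
          split_ifs <;> ring
  refine (Finset.sum_le_sum fun j _ => hterm j).trans_eq ?_
  rw [← Finset.mul_sum, Finset.sum_add_distrib, Finset.sum_ite_eq, ← Finset.mul_sum,
    if_pos (Finset.mem_univ i)]

end ImportanceEstimate

theorem log_sum_mul_exp_sub_log_sum_le {ι : Type*} [Fintype ι] [Nonempty ι] {w z : ι → ℝ}
    (hw : ∀ j, 0 < w j) (hz : ∀ j, |z j| ≤ 1) :
    Real.log (∑ j, w j * Real.exp (z j)) - Real.log (∑ j, w j) ≤
      ∑ j, w j / (∑ k, w k) * (z j + z j ^ 2) := by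
  have hexp : ∀ j, Real.exp (z j) ≤ 1 + z j + z j ^ 2 := fun j => by
    linarith [(abs_le.1 (Real.abs_exp_sub_one_sub_id_le (hz j))).2]
  have hW : 0 < ∑ k, w k := Finset.sum_pos (fun k _ => hw k) Finset.univ_nonempty
  have hW' : 0 < ∑ j, w j * Real.exp (z j) :=
    Finset.sum_pos (fun k _ => mul_pos (hw k) (Real.exp_pos _)) Finset.univ_nonempty
  rw [← Real.log_div hW'.ne' hW.ne']
  refine (Real.log_le_sub_one_of_pos (div_pos hW' hW)).trans (sub_le_iff_le_add.2 ?_)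
  calc (∑ j, w j * Real.exp (z j)) / ∑ k, w k
      ≤ (∑ j, w j * (1 + z j + z j ^ 2)) / ∑ k, w k := by
        gcongr with j
        exacts [(hw j).le, hexp j]
    _ = ∑ j, (w j / (∑ k, w k) * (z j + z j ^ 2) + w j / ∑ k, w k) := by
        rw [Finset.sum_div]
        exact Finset.sum_congr rfl fun j _ => by ring
    _ = ∑ j, w j / (∑ k, w k) * (z j + z j ^ 2) + 1 := by
        rw [Finset.sum_add_distrib, ← Finset.sum_div, div_self hW.ne']

section Exp3

variable {N : ℕ} {γ : ℝ} {w : Fin N → ℝ}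

theorem div_le_exp3Prob (hγ : γ ≤ 1) (hw : ∀ j, 0 < w j) (j : Fin N) :
    γ / N ≤ exp3Prob γ w j :=
  le_add_of_nonneg_left (mul_nonneg (sub_nonneg.2 hγ)
    (div_nonneg (hw j).le (Finset.sum_nonneg fun k _ => (hw k).le)))

theorem exp3Prob_pos (hγ0 : 0 < γ) (hγ : γ ≤ 1) (hw : ∀ j, 0 < w j) (j : Fin N) :
    0 < exp3Prob γ w j :=
  (div_pos hγ0 (by exact_mod_cast j.pos)).trans_le (div_le_exp3Prob hγ hw j)

theorem sum_exp3Prob [NeZero N] (γ : ℝ) (hw : ∀ j, 0 < w j) : ∑ j, exp3Prob γ w j = 1 := by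
  have hW : 0 < ∑ k, w k := Finset.sum_pos (fun k _ => hw k) Finset.univ_nonempty
  simp only [exp3Prob, Finset.sum_add_distrib, ← Finset.mul_sum, ← Finset.sum_div,
    div_self hW.ne', Finset.sum_const, Finset.card_univ, Fintype.card_fin, nsmul_eq_mul]
  have := NeZero.ne (N : ℝ)
  field_simp
  ring

theorem exp3Prob_le_one (hγ0 : 0 < γ) (hγ : γ ≤ 1) (hw : ∀ j, 0 < w j) (j : Fin N) :
    exp3Prob γ w j ≤ 1 := by
  have : NeZero N := ⟨j.pos.ne'⟩
  rw [← sum_exp3Prob γ hw]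
  exact Finset.single_le_sum (fun k _ => (exp3Prob_pos hγ0 hγ hw k).le) (Finset.mem_univ j)

theorem sum_one_div_exp3Prob_le (hγ0 : 0 < γ) (hγ : γ ≤ 1) (hw : ∀ j, 0 < w j) :
    ∑ j, 1 / exp3Prob γ w j ≤ N * (N / γ) := by
  have hterm : ∀ j, 1 / exp3Prob γ w j ≤ N / γ := fun j => by
    have hN : (0 : ℝ) < N := by exact_mod_cast j.pos
    rw [← one_div_div γ]
    exact one_div_le_one_div_of_le (div_pos hγ0 hN) (div_le_exp3Prob hγ hw j)
  exact (Finset.sum_le_sum fun j _ => hterm j).trans_eq (by simp)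

theorem one_sub_mul_log_sum_mul_exp_le [NeZero N] (hγ0 : 0 ≤ γ) (hγ : γ ≤ 1) {z : Fin N → ℝ}
    (hw : ∀ j, 0 < w j) (hz : ∀ j, |z j| ≤ 1) :
    (1 - γ) * (Real.log (∑ j, w j * Real.exp (z j)) - Real.log (∑ j, w j)) ≤
      ∑ j, exp3Prob γ w j * z j + γ / N * (-∑ j, z j) + ∑ j, exp3Prob γ w j * z j ^ 2 := by
  have hmix : ∀ j, (1 - γ) * (w j / ∑ k, w k) = exp3Prob γ w j - γ / N := fun j => by
    rw [exp3Prob, add_sub_cancel_right]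
  calc (1 - γ) * (Real.log (∑ j, w j * Real.exp (z j)) - Real.log (∑ j, w j))
      ≤ (1 - γ) * ∑ j, w j / (∑ k, w k) * (z j + z j ^ 2) :=
        mul_le_mul_of_nonneg_left (log_sum_mul_exp_sub_log_sum_le hw hz) (sub_nonneg.2 hγ)
    _ = ∑ j, (exp3Prob γ w j - γ / N) * (z j + z j ^ 2) := by
        simp only [Finset.mul_sum, ← mul_assoc, hmix]
    _ ≤ ∑ j, (exp3Prob γ w j * z j + γ / N * (-z j) + exp3Prob γ w j * z j ^ 2) :=
        Finset.sum_le_sum fun j _ => by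
          have : 0 ≤ γ / N * z j ^ 2 := by positivity
          linarith
    _ = _ := by
        rw [Finset.sum_add_distrib, Finset.sum_add_distrib, ← Finset.mul_sum,
          Finset.sum_neg_distrib]

theorem abs_mul_importanceEstimate_le_one {β g : ℝ} (hγ0 : 0 < γ) (hγ : γ ≤ 1) (hβ0 : 0 ≤ β)
    (hβ : β ≤ 2) (hg : |g| ≤ 1) (hw : ∀ j, 0 < w j) (i j : Fin N) :
    |γ / (3 * N) * importanceEstimate β g (exp3Prob γ w) i j| ≤ 1 := by
  have hN : (0 : ℝ) < N := by exact_mod_cast i.pos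
  have hpos := exp3Prob_pos hγ0 hγ hw
  have hε : 0 < γ / (3 * N) := by positivity
  rw [abs_mul, abs_of_pos hε]
  calc γ / (3 * N) * |importanceEstimate β g (exp3Prob γ w) i j|
      ≤ γ / (3 * N) * ((1 + β) / exp3Prob γ w j) := by
        gcongr
        exact abs_importanceEstimate_le hβ0 hg hpos i j
    _ ≤ γ / (3 * N) * ((1 + 2) / (γ / N)) := by
        gcongr
        exact div_le_exp3Prob hγ hw j
    _ = 1 := by field_simp; norm_num

theorem exp3_log_potential_step_le {β g : ℝ} (hγ0 : 0 < γ) (hγ : γ ≤ 1) (hβ0 : 0 ≤ β) (hβ : β ≤ 2)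
    (hg : |g| ≤ 1) (hw : ∀ j, 0 < w j) (i : Fin N) :
    (1 - γ) * (Real.log (∑ j, w j * Real.exp (γ / (3 * N) *
        importanceEstimate β g (exp3Prob γ w) i j)) - Real.log (∑ j, w j)) ≤
      γ / (3 * N) * (g + N * β + 5 / 3 * (γ / N) * (1 / exp3Prob γ w i) + 2 / 3 * N * β ^ 2) := by
  have : NeZero N := ⟨i.pos.ne'⟩
  have hN : (0 : ℝ) < N := by exact_mod_cast i.pos
  set ε := γ / (3 * N) with hε
  have : 0 < ε := by positivity
  set p := exp3Prob γ w
  have hp : ∀ j, 0 < p j := exp3Prob_pos hγ0 hγ hw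
  set e := importanceEstimate β g p i
  calc (1 - γ) * (Real.log (∑ j, w j * Real.exp (ε * e j)) - Real.log (∑ j, w j))
      ≤ ∑ j, p j * (ε * e j) + γ / N * (-∑ j, ε * e j) + ∑ j, p j * (ε * e j) ^ 2 :=
        one_sub_mul_log_sum_mul_exp_le hγ0.le hγ hw
          (abs_mul_importanceEstimate_le_one hγ0 hγ hβ0 hβ hg hw i)
    _ = ε * ∑ j, p j * e j + γ / N * (ε * -∑ j, e j) + ε ^ 2 * ∑ j, p j * e j ^ 2 := by
        simp only [Finset.mul_sum, ← Finset.sum_neg_distrib]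
        congr 1
        · congr 1 <;> exact Finset.sum_congr rfl fun j _ => by ring
        · exact Finset.sum_congr rfl fun j _ => by ring
    _ ≤ ε * (g + N * β) + γ / N * (ε * (1 / p i)) +
          ε ^ 2 * (2 * (1 / p i + β ^ 2 * (N * (N / γ)))) := by
        have hmean : ∑ j, p j * e j = g + N * β := by
          rw [sum_mul_importanceEstimate hp, Fintype.card_fin]
        have hneg : -∑ j, e j ≤ 1 / p i := neg_sum_importanceEstimate_le hβ0 hg hp i
        have hsq : ∑ j, p j * e j ^ 2 ≤ 2 * (1 / p i + β ^ 2 * (N * (N / γ))) :=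
          (sum_mul_sq_importanceEstimate_le hg hp i).trans (by
            gcongr; exact sum_one_div_exp3Prob_le hγ0 hγ hw)
        rw [hmean]
        gcongr
    _ = ε * (g + N * β + 5 / 3 * (γ / N) * (1 / p i) + 2 / 3 * N * β ^ 2) := by
        have := (hp i).ne'
        rw [hε]
        field_simp
        ring

variable (M : ℕ) (α : ℝ) (i : ℕ → Fin N) (g : ℕ → ℝ)

theorem exp3Weight_pos (γ : ℝ) (b : ℕ) (j : Fin N) : 0 < exp3Weight M α γ i g b j := by
  induction b generalizing j with
  | zero => exact one_pos
  | succ b ih => exact mul_pos (ih j) (Real.exp_pos _)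

theorem exp3Weight_succ (γ : ℝ) (b : ℕ) (j : Fin N) :
    exp3Weight M α γ i g (b + 1) j = exp3Weight M α γ i g b j * Real.exp (γ / (3 * N) *
      importanceEstimate (α / √((N : ℝ) * M)) (g b) (exp3Prob γ (exp3Weight M α γ i g b))
        (i b) j) := by
  rw [importanceEstimate, div_div, mul_comm (√((N : ℝ) * M))]
  rfl

theorem log_exp3Weight (γ : ℝ) (n : ℕ) (j : Fin N) :
    Real.log (exp3Weight M α γ i g n j) = γ / (3 * N) * ∑ b ∈ Finset.range n,
      importanceEstimate (α / √((N : ℝ) * M)) (g b) (exp3Prob γ (exp3Weight M α γ i g b))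
        (i b) j := by
  induction n with
  | zero => simp [exp3Weight]
  | succ n ih =>
    rw [exp3Weight_succ, Real.log_mul (exp3Weight_pos M α i g γ n j).ne' (Real.exp_pos _).ne',
      Real.log_exp, ih, Finset.sum_range_succ, mul_add]

/- The potential `log ∑ w` dominates `log w j` and grows by little more than the rewards. -/
theorem exp3_sum_importanceEstimate_le {m : ℕ} {β : ℝ} (hγ0 : 0 < γ) (hγ : γ ≤ 1)
    (hβ0 : 0 ≤ β) (hβ : β ≤ 2) (hαβ : α / √((N : ℝ) * M) = β) (hg : ∀ b < m, |g b| ≤ 1)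
    (j : Fin N) :
    (1 - γ) * ∑ b ∈ Finset.range m,
        importanceEstimate β (g b) (exp3Prob γ (exp3Weight M α γ i g b)) (i b) j ≤
      ∑ b ∈ Finset.range m, g b + 3 * N * Real.log N / γ + m * (N * β) +
        5 / 3 * (γ / N) * ∑ b ∈ Finset.range m,
          1 / exp3Prob γ (exp3Weight M α γ i g b) (i b) + m * (2 / 3 * N * β ^ 2) := by
  have : NeZero N := ⟨j.pos.ne'⟩
  have hN : (0 : ℝ) < N := by exact_mod_cast j.pos
  subst hαβ
  set β := α / √((N : ℝ) * M)
  set w := exp3Weight M α γ i g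
  set S := ∑ b ∈ Finset.range m, importanceEstimate β (g b) (exp3Prob γ (w b)) (i b) j
  have hw : ∀ b k, 0 < w b k := exp3Weight_pos M α i g γ
  have hupper : (1 - γ) * (Real.log (∑ k, w m k) - Real.log N) ≤
      ∑ b ∈ Finset.range m, γ / (3 * N) * (g b + N * β +
        5 / 3 * (γ / N) * (1 / exp3Prob γ (w b) (i b)) + 2 / 3 * N * β ^ 2) := by
    have hinit : Real.log N = Real.log (∑ k, w 0 k) := by simp [w, exp3Weight]
    rw [hinit, ← Finset.sum_range_sub (fun b => Real.log (∑ k, w b k)), Finset.mul_sum]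
    refine Finset.sum_le_sum fun b hb => ?_
    simp only [w, exp3Weight_succ M α i g γ b]
    exact exp3_log_potential_step_le hγ0 hγ hβ0 hβ (hg b (Finset.mem_range.1 hb)) (hw b) (i b)
  have hlower : γ / (3 * N) * S ≤ Real.log (∑ k, w m k) := by
    rw [← log_exp3Weight]
    exact Real.log_le_log (hw m j)
      (Finset.single_le_sum (fun k _ => (hw m k).le) (Finset.mem_univ j))
  have hlogN : (1 - γ) * Real.log N ≤ Real.log N := by
    nlinarith [Real.log_natCast_nonneg N]
  have hscale : γ / (3 * N) * (3 * N * Real.log N / γ) = Real.log N := by field_simp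
  simp only [← Finset.mul_sum, Finset.sum_add_distrib, Finset.sum_const, Finset.card_range,
    nsmul_eq_mul] at hupper
  refine le_of_mul_le_mul_left ?_ (by positivity : 0 < γ / (3 * N))
  linarith [mul_le_mul_of_nonneg_left hlower (sub_nonneg.2 hγ)]

end Exp3

/-! ### The random choices of the master algorithm -/

section Sampling

/-- In step `b` an index `i b` is drawn, given the past at time `τ b`, with the probabilities
`p b`; the draw is known when the next step begins, at time `τ (b + 1)`. -/
structure IsSampledFrom {Ω ι : Type*} {mΩ : MeasurableSpace Ω} (P : Measure Ω)
    (ℱ : Filtration ℕ mΩ) (τ : ℕ → ℕ) (n : ℕ) (i : ℕ → Ω → ι) (p : ℕ → Ω → ι → ℝ) : Prop where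
  measurableSet_draw : ∀ b < n, ∀ j, MeasurableSet[ℱ (τ (b + 1))] (i b ⁻¹' {j})
  measurable_prob : ∀ b < n, ∀ j, Measurable[ℱ (τ b)] fun ω => p b ω j
  condExp_draw : ∀ b < n, ∀ j,
    P[(i b ⁻¹' {j}).indicator (fun _ => (1 : ℝ)) | ℱ (τ b)] =ᵐ[P] fun ω => p b ω j

variable {Ω ι : Type*} [DecidableEq ι] {mΩ : MeasurableSpace Ω} {P : Measure Ω}
  [IsProbabilityMeasure P] {ℱ : Filtration ℕ mΩ} {τ : ℕ → ℕ} {n : ℕ} {i : ℕ → Ω → ι}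
  {p : ℕ → Ω → ι → ℝ}

theorem IsSampledFrom.measure_le_sum_ite_le (h : IsSampledFrom P ℱ τ n i p) (hτ : Monotone τ)
    {j : ι} (hp : ∀ b ω, p b ω j ∈ Set.Icc 0 1) {f₁ f₀ : ℝ → ℝ} (hf₁ : Measurable f₁)
    (hf₀ : Measurable f₀)
    (hf : ∀ b ω, p b ω j * Real.exp (f₁ (p b ω j)) +
      (1 - p b ω j) * Real.exp (f₀ (p b ω j)) ≤ 1) (a : ℝ) :
    P {ω | a ≤ ∑ b ∈ Finset.range n, if i b ω = j then f₁ (p b ω j) else f₀ (p b ω j)} ≤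
      ENNReal.ofReal (Real.exp (-a)) := by
  refine measure_le_sum_le_exp_neg (ℱ := ℱ) hτ (fun b hb => ?_) (fun b hb => ?_) a
  · have hpb := (h.measurable_prob b hb j).mono (ℱ.mono (hτ b.le_succ)) le_rfl
    exact Measurable.ite (h.measurableSet_draw b hb j) (hf₁.comp hpb) (hf₀.comp hpb)
  · have hpb := h.measurable_prob b hb j
    let _ : DecidablePred (· ∈ i b ⁻¹' {j}) := fun ω => inferInstanceAs (Decidable (i b ω = j))
    exact expMomentLEOne_ite (ℱ.le _) (ℱ.le _ _ (h.measurableSet_draw b hb j))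
      (h.condExp_draw b hb j) hpb (hp b) (hf₁.comp hpb) (hf₀.comp hpb) (hf b)

theorem exp_neg_le_one_sub_add_sq {z : ℝ} (hz : 0 ≤ z) : Real.exp (-z) ≤ 1 - z + z ^ 2 := by
  rcases le_or_gt z 1 with h | h
  · have habs := Real.abs_exp_sub_one_sub_id_le (x := -z) (by rwa [abs_neg, abs_of_nonneg hz])
    linarith [(abs_le.1 habs).2, neg_sq z]
  · nlinarith [Real.exp_le_one_iff.2 (neg_nonpos.2 hz)]

theorem mul_exp_add_mul_exp_le_one {q l : ℝ} (hq : 0 < q) (hl : 0 ≤ l) :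
    q * Real.exp (l * (1 - (1 / q + l / q))) + (1 - q) * Real.exp (l * (1 - l / q)) ≤ 1 := by
  set z := l * (1 - l / q) with hz
  have hsplit : Real.exp (l * (1 - (1 / q + l / q))) = Real.exp z * Real.exp (-(l / q)) := by
    rw [← Real.exp_add, hz]
    ring_nf
  have hmean : q * Real.exp (-(l / q)) + (1 - q) ≤ Real.exp (-z) :=
    calc q * Real.exp (-(l / q)) + (1 - q) ≤ q * (1 - l / q + (l / q) ^ 2) + (1 - q) := by
          gcongr
          exact exp_neg_le_one_sub_add_sq (by positivity)
      _ = -z + 1 := by rw [hz]; field_simp; ring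
      _ ≤ Real.exp (-z) := Real.add_one_le_exp _
  calc _ = Real.exp z * (q * Real.exp (-(l / q)) + (1 - q)) := by rw [hsplit]; ring
    _ ≤ Real.exp z * Real.exp (-z) := by gcongr
    _ = 1 := by rw [← Real.exp_add, add_neg_cancel, Real.exp_zero]

theorem mul_exp_sub_two_add_mul_exp_le_one {q l : ℝ} (hl : 0 < l) (hq : l ≤ q) :
    q * Real.exp (l * (1 / q - 2)) + (1 - q) * Real.exp (l * (0 - 2)) ≤ 1 := by
  have hq0 : 0 < q := hl.trans_le hq
  have hz1 : l / q ≤ 1 := (div_le_one hq0).2 hq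
  have hsplit : Real.exp (l * (1 / q - 2)) = Real.exp (-(2 * l)) * Real.exp (l / q) := by
    rw [← Real.exp_add]
    ring_nf
  have hexp : Real.exp (l / q) ≤ 1 + l / q + (l / q) ^ 2 := by
    have := Real.abs_exp_sub_one_sub_id_le (x := l / q) (by rwa [abs_of_nonneg (by positivity)])
    linarith [(abs_le.1 this).2]
  have hmean : q * Real.exp (l / q) + (1 - q) ≤ Real.exp (2 * l) :=
    calc q * Real.exp (l / q) + (1 - q) ≤ q * (1 + l / q + l / q) + (1 - q) := by
          gcongr
          nlinarith [div_nonneg hl.le hq0.le]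
      _ = 2 * l + 1 := by field_simp; ring
      _ ≤ Real.exp (2 * l) := Real.add_one_le_exp _
  calc _ = Real.exp (-(2 * l)) * (q * Real.exp (l / q) + (1 - q)) := by rw [hsplit]; ring_nf
    _ ≤ Real.exp (-(2 * l)) * Real.exp (2 * l) := by gcongr
    _ = 1 := by rw [← Real.exp_add, neg_add_cancel, Real.exp_zero]

theorem IsSampledFrom.measure_le_mul_sum_one_sub_le (h : IsSampledFrom P ℱ τ n i p)
    (hτ : Monotone τ) {j : ι} (hp : ∀ b ω, p b ω j ∈ Set.Ioc 0 1) {l : ℝ} (hl : 0 ≤ l) (a : ℝ) :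
    P {ω | a ≤ l * ∑ b ∈ Finset.range n, (1 - importanceEstimate l 1 (p b ω) (i b ω) j)} ≤
      ENNReal.ofReal (Real.exp (-a)) := by
  convert h.measure_le_sum_ite_le hτ (fun b ω => Set.Ioc_subset_Icc_self (hp b ω))
    (f₁ := fun q => l * (1 - (1 / q + l / q))) (f₀ := fun q => l * (1 - l / q)) (by fun_prop)
    (by fun_prop) (fun b ω => mul_exp_add_mul_exp_le_one (hp b ω).1 hl) a using 5 with ω
  rw [Finset.mul_sum]
  refine Finset.sum_congr rfl fun b _ => ?_
  simp only [importanceEstimate]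
  split_ifs <;> simp

theorem IsSampledFrom.measure_le_mul_sum_sub_two_le (h : IsSampledFrom P ℱ τ n i p)
    (hτ : Monotone τ) {j : ι} {l : ℝ} (hl : 0 < l) (hp : ∀ b ω, p b ω j ∈ Set.Icc l 1) (a : ℝ) :
    P {ω | a ≤ l * ∑ b ∈ Finset.range n, (importanceEstimate 0 1 (p b ω) (i b ω) j - 2)} ≤
      ENNReal.ofReal (Real.exp (-a)) := by
  convert h.measure_le_sum_ite_le hτ (fun b ω => Set.Icc_subset_Icc_left hl.le (hp b ω))
    (f₁ := fun q => l * (1 / q - 2)) (f₀ := fun _ => l * (0 - 2)) (by fun_prop)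
    (by fun_prop) (fun b ω => mul_exp_sub_two_add_mul_exp_le_one hl (hp b ω).1) a using 5 with ω
  rw [Finset.mul_sum]
  refine Finset.sum_congr rfl fun b _ => ?_
  simp only [importanceEstimate]
  split_ifs <;> simp

end Sampling

section Master

theorem gamma_le_one (N M : ℕ) : gamma N M ≤ 1 := (min_le_left _ _).trans (by norm_num)

theorem gamma_pos {N M : ℕ} (hN : 2 ≤ N) (hM : 0 < M) : 0 < gamma N M := by
  have hlog : 0 < Real.log N := Real.log_pos (by exact_mod_cast hN)
  unfold gamma
  positivity

variable {T H : ℕ} {δ : ℝ}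

theorem masterProb_mem_Icc (hN : 2 ≤ numBase T) (hM : 0 < numBatch T H)
    (i : ℕ → Fin (numBase T)) (y : ℕ → ℝ) (b : ℕ) (j : Fin (numBase T)) :
    masterProb T H δ i y b j ∈
      Set.Icc (gamma (numBase T) (numBatch T H) / numBase T) 1 :=
  ⟨div_le_exp3Prob (gamma_le_one _ _) (exp3Weight_pos _ _ _ _ _ _) j,
    exp3Prob_le_one (gamma_pos hN hM) (gamma_le_one _ _) (exp3Weight_pos _ _ _ _ _ _) j⟩

variable {X Ω : Type*} [MetricSpace X] [MeasurableSpace X] {mΩ : MeasurableSpace Ω}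
  {P : Measure Ω} {ℱ : Filtration ℕ mΩ} {η c : ℕ → Ω → ℝ} {i : ℕ → Ω → Fin (numBase T)}
  {x : ℕ → Ω → X} {μ : X → ℝ}

theorem IsRun.measurable_reward (hR : IsRun P ℱ T H δ i x (reward μ x η c))
    (hE : IsEnvironment P ℱ T η c) (hμ : Measurable μ) {t : ℕ} (ht : t < T) :
    Measurable[ℱ (2 * t + 2)] (reward μ x η c t) := by
  have hx : Measurable[ℱ (2 * t + 2)] (x t) :=
    (hR.measurable_arm t ht).mono (ℱ.mono (by omega)) le_rfl
  exact ((hμ.comp hx).add (hE.measurable_noise t ht)).add (hE.measurable_corruption t ht)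

theorem measurable_exp3Prob {m : MeasurableSpace Ω} {N : ℕ} {γ : ℝ} {w : Fin N → Ω → ℝ}
    (hw : ∀ j, Measurable[m] (w j)) (j : Fin N) :
    Measurable[m] fun ω => exp3Prob γ (fun k => w k ω) j :=
  (((hw j).div (Finset.measurable_sum _ fun k _ => hw k)).const_mul _).add_const _

theorem IsRun.measurable_exp3Weight (hR : IsRun P ℱ T H δ i x (reward μ x η c))
    (hE : IsEnvironment P ℱ T η c) (hμ : Measurable μ) (hH : 0 < H) (M : ℕ) (α γ : ℝ) {b : ℕ}
    (hb : b * H < T) (j : Fin (numBase T)) :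
    Measurable[ℱ (2 * (b * H))] fun ω =>
      exp3Weight M α γ (fun k => i k ω) (batchReward T H δ fun t => reward μ x η c t ω) b j := by
  induction b generalizing j with
  | zero => exact measurable_const
  | succ b ih =>
    have hle : 2 * (b * H) + 1 ≤ 2 * ((b + 1) * H) := by nlinarith
    have hb' : b * H < T := by omega
    have hw : ∀ j, Measurable[ℱ (2 * ((b + 1) * H))] fun ω =>
        exp3Weight M α γ (fun k => i k ω) (batchReward T H δ fun t => reward μ x η c t ω) b j :=
      fun j => (ih hb' j).mono (ℱ.mono (by omega)) le_rfl
    have hp := measurable_exp3Prob (γ := γ) hw j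
    have hg : Measurable[ℱ (2 * ((b + 1) * H))] fun ω =>
        batchReward T H δ (fun t => reward μ x η c t ω) b := by
      refine Measurable.div_const (Finset.measurable_sum _ fun t ht => ?_) _
      rw [Finset.mem_Ico] at ht
      exact (hR.measurable_reward hE hμ (by omega)).mono (ℱ.mono (by omega)) le_rfl
    have hi : MeasurableSet[ℱ (2 * ((b + 1) * H))] {ω | i b ω = j} :=
      ℱ.mono hle _ (hR.measurable_base b hb' (measurableSet_singleton j))
    exact (hw j).mul (((((hg.div hp).ite hi measurable_const).add
      (measurable_const.div (hp.mul_const _))).const_mul _).exp)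

theorem IsRun.isSampledFrom (hR : IsRun P ℱ T H δ i x (reward μ x η c))
    (hE : IsEnvironment P ℱ T η c) (hμ : Measurable μ) (hH : 0 < H) :
    IsSampledFrom P ℱ (fun b => 2 * (b * H)) (T / H) i
      fun b ω => masterProb T H δ (fun k => i k ω) (fun t => reward μ x η c t ω) b := by
  have hlt : ∀ b < T / H, b * H < T := fun b hb => by
    have := (Nat.le_div_iff_mul_le hH).1 (Nat.succ_le_of_lt hb)
    rw [Nat.succ_mul] at this
    omega
  refine ⟨fun b hb j => ?_, fun b hb j => ?_, fun b hb j => hR.law_base b (hlt b hb) j⟩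
  · exact ℱ.mono (by nlinarith) _
      (hR.measurable_base b (hlt b hb) (measurableSet_singleton j))
  · exact measurable_exp3Prob (hR.measurable_exp3Weight hE hμ hH _ _ _ (hlt b hb)) j

end Master

/-! ### The noise of batches and arms -/

section Noise

variable {X Ω : Type*} [MetricSpace X] [MeasurableSpace X] {mΩ : MeasurableSpace Ω}
  {P : Measure Ω} {ℱ : Filtration ℕ mΩ} {T H : ℕ} {δ : ℝ} {η c y : ℕ → Ω → ℝ}
  {i : ℕ → Ω → Fin (numBase T)} {x : ℕ → Ω → X}

theorem card_Ico_mul_add_one_mul (b H : ℕ) : (Finset.Ico (b * H) ((b + 1) * H)).card = H := by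
  rw [Nat.card_Ico, ← Nat.sub_mul, Nat.add_sub_cancel_left, one_mul]

theorem IsEnvironment.measure_batch_noise_le [IsProbabilityMeasure P]
    (hE : IsEnvironment P ℱ T η c) (hH : 0 < H) {b : ℕ} (hb : (b + 1) * H ≤ T) {a : ℝ}
    (ha : 0 ≤ a) :
    P {ω | √(2 * a * H) < |∑ t ∈ Finset.Ico (b * H) ((b + 1) * H), η t ω|} ≤
      ENNReal.ofReal (2 * Real.exp (-a)) := by
  classical
  have hbatch : (Finset.range T).filter (· ∈ Finset.Ico (b * H) ((b + 1) * H)) =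
      Finset.Ico (b * H) ((b + 1) * H) := by
    ext t
    simp only [Finset.mem_filter, Finset.mem_range, Finset.mem_Ico]
    omega
  refine le_trans (measure_mono fun ω hω => ?_) (hE.measure_sqrt_lt_abs_sum_noise_le
    (B := fun t => {_ω | t ∈ Finset.Ico (b * H) ((b + 1) * H)}) (fun t _ => .const _) hH ha)
  simp only [Set.mem_ofPred_eq, hbatch] at hω ⊢
  exact ⟨card_Ico_mul_add_one_mul b H, hω⟩

open Classical in
/-- The pulls of the arm of round `s` in the rounds `s, …, k - 1`. -/
noncomputable def pullsSince {X : Type*} (x : ℕ → X) (s k : ℕ) : Finset ℕ :=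
  (Finset.Ico s k).filter fun t => x t = x s

theorem card_pullsSince_le {X : Type*} (x : ℕ → X) (s k : ℕ) : (pullsSince x s k).card ≤ k := by
  classical
  exact (Finset.card_filter_le _ _).trans ((Nat.card_Ico s k).trans_le (Nat.sub_le k s))

theorem filter_card_pullsSince_lt {X : Type*} {x : ℕ → X} {s k : ℕ} (hk : k ≤ T)
    [DecidablePred fun t => s ≤ t ∧ x t = x s ∧
      (pullsSince x s t).card < (pullsSince x s k).card] :
    (Finset.range T).filter (fun t => s ≤ t ∧ x t = x s ∧
      (pullsSince x s t).card < (pullsSince x s k).card) = pullsSince x s k := by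
  classical
  have hmono : ∀ {t t'}, t ≤ t' → pullsSince x s t ⊆ pullsSince x s t' := fun h =>
    Finset.filter_subset_filter _ (Finset.Ico_subset_Ico_right h)
  ext t
  simp only [Finset.mem_filter, Finset.mem_range]
  constructor
  · rintro ⟨-, hst, hxt, hlt⟩
    have htk : t < k := by
      by_contra hkt
      exact absurd (Finset.card_le_card (hmono (not_lt.1 hkt))) (not_le.2 hlt)
    exact Finset.mem_filter.2 ⟨Finset.mem_Ico.2 ⟨hst, htk⟩, hxt⟩
  · intro ht
    obtain ⟨hIco, hxt⟩ := Finset.mem_filter.1 ht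
    rw [Finset.mem_Ico] at hIco
    refine ⟨by omega, hIco.1, hxt, Finset.card_lt_card ⟨hmono hIco.2.le, fun hsub => ?_⟩⟩
    have := (Finset.mem_filter.1 (hsub ht)).1
    simp at this

variable [SecondCountableTopology X] [OpensMeasurableSpace X]

theorem IsRun.measurableSet_pullsSince_card_lt (hR : IsRun P ℱ T H δ i x y) (s n : ℕ) {t : ℕ}
    (ht : t < T) :
    MeasurableSet[ℱ (2 * t + 1)]
      {ω | s ≤ t ∧ x t ω = x s ω ∧ (pullsSince (fun t => x t ω) s t).card < n} := by
  by_cases hst : s ≤ t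
  · have harm : ∀ u ≤ t, Measurable[ℱ (2 * t + 1)] (x u) := fun u hu =>
      (hR.measurable_arm u (by omega)).mono (ℱ.mono (by omega)) le_rfl
    have heq : ∀ u ≤ t, MeasurableSet[ℱ (2 * t + 1)] {ω | x u ω = x s ω} := fun u hu =>
      ((harm u hu).prodMk (harm s hst)) measurableSet_diagonal
    have hcard : Measurable[ℱ (2 * t + 1)] fun ω => (pullsSince (fun t => x t ω) s t).card := by
      simp only [pullsSince, Finset.card_filter]
      exact Finset.measurable_sum _ fun u hu =>
        measurable_const.ite (heq u (Finset.mem_Ico.1 hu).2.le) measurable_const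
    simp only [hst, true_and]
    exact (heq t le_rfl).inter (hcard (measurableSet_Iio (a := n)))
  · simp only [hst, false_and]
    exact .const _

theorem IsRun.measure_arm_noise_le [IsProbabilityMeasure P] (hR : IsRun P ℱ T H δ i x y)
    (hE : IsEnvironment P ℱ T η c) (s : ℕ) {n : ℕ} (hn : 0 < n) {a : ℝ} (ha : 0 ≤ a) :
    P {ω | ∃ k ≤ T, (pullsSince (fun t => x t ω) s k).card = n ∧
        √(2 * a * n) < |∑ t ∈ pullsSince (fun t => x t ω) s k, η t ω|} ≤
      ENNReal.ofReal (2 * Real.exp (-a)) := by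
  classical
  refine le_trans (measure_mono ?_) (hE.measure_sqrt_lt_abs_sum_noise_le
    (fun t ht => hR.measurableSet_pullsSince_card_lt s n ht) hn ha)
  rintro ω ⟨k, hk, rfl, hlt⟩
  simp only [Set.mem_ofPred_eq, filter_card_pullsSince_lt hk]
  exact ⟨trivial, hlt⟩

end Noise

/-! ### A batch of Robust Zooming -/

section Batch

variable {X : Type*} {T H : ℕ} {μ : X → ℝ} {xopt : X} {x : ℕ → X}

theorem pullSum_sub_pulls_mul (x : ℕ → X) (μ : X → ℝ) (z : ℕ → ℝ) (k : ℕ) (v : X) :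
    pullSum x (fun t => μ (x t) + z t) k v - pulls x k v * μ v = pullSum x z k v := by
  classical
  have hμ : ∑ t ∈ Finset.range k with x t = v, μ (x t) = pulls x k v * μ v := by
    rw [Finset.sum_congr rfl fun t ht => congrArg μ (Finset.mem_filter.1 ht).2, Finset.sum_const,
      nsmul_eq_mul, pulls]
  simp only [pullSum, Finset.sum_add_distrib]
  linarith [hμ]

theorem exists_pullSum_eq_sum_pullsSince {t₀ k : ℕ} {v : X}
    (hv : 0 < pulls (fun t => x (t₀ + t)) k v) :
    ∃ s < t₀ + k, pulls (fun t => x (t₀ + t)) k v = (pullsSince x s (t₀ + k)).card ∧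
      ∀ f : ℕ → ℝ, pullSum (fun t => x (t₀ + t)) (fun t => f (t₀ + t)) k v =
        ∑ t ∈ pullsSince x s (t₀ + k), f t := by
  classical
  obtain ⟨k₀, hk₀, hmin⟩ := Finset.exists_min_image _ id (Finset.card_pos.1 hv)
  simp only [Finset.mem_filter, Finset.mem_range, id] at hk₀ hmin
  have himage : pullsSince x (t₀ + k₀) (t₀ + k) =
      ((Finset.range k).filter fun t => x (t₀ + t) = v).map (addLeftEmbedding t₀) := by
    ext t
    simp only [pullsSince, Finset.mem_filter, Finset.mem_Ico, Finset.mem_map, Finset.mem_range,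
      addLeftEmbedding_apply, hk₀.2]
    constructor
    · rintro ⟨⟨h₀, hk⟩, hxt⟩
      exact ⟨t - t₀, ⟨by omega, by rwa [Nat.add_sub_cancel' (by omega)]⟩, by omega⟩
    · rintro ⟨u, ⟨huk, hu⟩, rfl⟩
      exact ⟨⟨Nat.add_le_add_left (hmin u ⟨huk, hu⟩) _, by omega⟩, hu⟩
  refine ⟨t₀ + k₀, by omega, ?_, fun f => ?_⟩
  · rw [himage, Finset.card_map, pulls]
  · rw [himage, Finset.sum_map, pullSum]
    simp only [addLeftEmbedding_apply]

theorem isAccurate_of_abs_sum_noise_le {η c : ℕ → ℝ} {a w : ℝ}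
    (hη : ∀ s < T, ∀ k ≤ T,
      |∑ t ∈ pullsSince x s k, η t| ≤ √(2 * a * (pullsSince x s k).card))
    (hc : ∑ t ∈ Finset.range T, |c t| ≤ w) {t₀ k : ℕ} (hk : t₀ + k ≤ T) :
    IsAccurate (confidenceRadius (2 * a) w) μ (fun t => x (t₀ + t))
      (fun t => μ (x (t₀ + t)) + η (t₀ + t) + c (t₀ + t)) k := by
  classical
  intro v hv
  obtain ⟨s, hs, hcard, hsum⟩ := exists_pullSum_eq_sum_pullsSince hv
  set n := pulls (fun t => x (t₀ + t)) k v
  have hn : (0 : ℝ) < n := by exact_mod_cast hv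
  have hnoise : |∑ t ∈ pullsSince x s (t₀ + k), η t| ≤ √(2 * a * n) := by
    simpa only [hcard] using hη s (by omega) (t₀ + k) hk
  have hcorruption : |∑ t ∈ pullsSince x s (t₀ + k), c t| ≤ w := by
    refine (Finset.abs_sum_le_sum_abs _ _).trans ((Finset.sum_le_sum_of_subset_of_nonneg
      (fun t ht => ?_) fun _ _ _ => abs_nonneg _).trans hc)
    have hlt := (Finset.mem_Ico.1 (Finset.mem_filter.1 ht).1).2
    exact Finset.mem_range.2 (by omega)
  have herror : pullSum (fun t => x (t₀ + t))
      (fun t => μ (x (t₀ + t)) + η (t₀ + t) + c (t₀ + t)) k v - n * μ v =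
      ∑ t ∈ pullsSince x s (t₀ + k), η t + ∑ t ∈ pullsSince x s (t₀ + k), c t := by
    simp only [add_assoc]
    rw [pullSum_sub_pulls_mul _ μ fun t => η (t₀ + t) + c (t₀ + t), hsum fun t => η t + c t,
      Finset.sum_add_distrib]
  refine le_of_mul_le_mul_left ?_ hn
  calc n * |pullSum (fun t => x (t₀ + t))
        (fun t => μ (x (t₀ + t)) + η (t₀ + t) + c (t₀ + t)) k v / n - μ v|
      = |∑ t ∈ pullsSince x s (t₀ + k), η t + ∑ t ∈ pullsSince x s (t₀ + k), c t| := by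
        rw [← herror, ← abs_of_pos hn, ← abs_mul, abs_of_pos hn, mul_sub,
          mul_div_cancel₀ _ hn.ne']
    _ ≤ √(2 * a * n) + w := (abs_add_le _ _).trans (add_le_add hnoise hcorruption)
    _ = n * confidenceRadius (2 * a) w n := (natCast_mul_confidenceRadius hv).symm

theorem sum_gap_batch_le [MetricSpace X] {d κ : ℝ} (hd : 0 ≤ d) (hX : HasCoveringBound X d κ)
    (hκ : 0 ≤ κ) (hμ : LipschitzWith 1 μ) (hμ01 : ∀ x, μ x ∈ Set.Icc (0 : ℝ) 1)
    (hopt : ∀ x, μ x ≤ μ xopt) {L w : ℝ} (hL : 0 ≤ L) (hw : 1 ≤ w) (hH : 0 < H) {b : ℕ}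
    {y : ℕ → ℝ} (hacc : ∀ k < H, IsAccurate (confidenceRadius L w) μ
      (fun t => x (b * H + t)) (fun t => y (b * H + t)) k) {s : ℕ → ZoomState X}
    (hs : ∀ t, b * H ≤ t → t < (b + 1) * H → ZoomState.Round (confidenceRadius L w)
      (if H ∣ t then ZoomState.init X else s t) (x t) (y t) (s (t + 1))) :
    ∑ t ∈ Finset.Ico (b * H) ((b + 1) * H), (μ xopt - μ (x t)) ≤
      6 * (1 + √(L * (κ * 2 ^ d)) + κ * 2 ^ d) *
        (H * max ((H : ℝ) ^ (-(1 / (d + 2)))) ((w / H) ^ (1 / (d + 1)))) := by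
  have hlen : (b + 1) * H = b * H + H := by ring
  have hdvd : ∀ k < H, H ∣ b * H + k ↔ k = 0 := fun k hk => by
    rw [Nat.dvd_add_right (Dvd.intro_left b rfl)]
    exact ⟨fun h => Nat.eq_zero_of_dvd_of_lt h hk, fun h => h ▸ dvd_zero _⟩
  have hinv := ZoomInvariant.of_round (isConfidenceRadius_confidenceRadius hL hw) hμ hμ01 hopt
    (σ := fun k => if k = 0 then ZoomState.init X else s (b * H + k)) rfl hacc fun k hk => by
      have hround := hs (b * H + k) (by omega) (by omega)
      simp only [hdvd k hk] at hround
      simpa only [Nat.succ_ne_zero, if_false, add_assoc] using hround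
  rw [Finset.sum_Ico_eq_sum_range, hlen, Nat.add_sub_cancel_left]
  exact hinv.sum_gap_le_max hd hX hκ hL (zero_le_one.trans hw) hμ01 hH

theorem abs_sum_le_card_mul_rpow {ι : Type*} {s u : Finset ι} (hsu : s ⊆ u) (hs : s.Nonempty)
    {c : ι → ℝ} (hc : ∀ k ∈ s, |c k| ≤ 1) {θ : ℝ} (hθ0 : 0 ≤ θ) (hθ1 : θ ≤ 1) :
    |∑ k ∈ s, c k| ≤ s.card * ((∑ k ∈ u, |c k|) / s.card) ^ θ := by
  have hcard : (0 : ℝ) < s.card := by exact_mod_cast hs.card_pos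
  have hmean0 : 0 ≤ (∑ k ∈ s, |c k|) / s.card := by positivity
  have hmean1 : (∑ k ∈ s, |c k|) / s.card ≤ 1 :=
    (div_le_one hcard).2 ((Finset.sum_le_card_nsmul s _ 1 hc).trans_eq (by simp))
  calc |∑ k ∈ s, c k| ≤ ∑ k ∈ s, |c k| := Finset.abs_sum_le_sum_abs _ _
    _ = s.card * ((∑ k ∈ s, |c k|) / s.card) ^ (1 : ℝ) := by rw [Real.rpow_one]; field_simp
    _ ≤ s.card * ((∑ k ∈ s, |c k|) / s.card) ^ θ := by
        gcongr ?_ * ?_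
        exact Real.rpow_le_rpow_of_exponent_ge' hmean0 hmean1 hθ0 hθ1
    _ ≤ s.card * ((∑ k ∈ u, |c k|) / s.card) ^ θ := by gcongr

end Batch

/-! ### The regret along a path -/

section Exp3Regret

variable {ι : Type*} [DecidableEq ι]

theorem mul_importanceEstimate_one_le {β g v : ℝ} {p : ι → ℝ} {i j : ι} (hβ : 0 ≤ β) (hv : v ≤ 1)
    (hp : 0 < p j) (hvg : i = j → v ≤ g) :
    v * importanceEstimate β 1 p i j ≤ importanceEstimate β g p i j := by
  have hbias : v * (β / p j) ≤ β / p j := mul_le_of_le_one_left (by positivity) hv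
  simp only [importanceEstimate, mul_add]
  refine add_le_add ?_ hbias
  split_ifs with hij
  · rw [mul_one_div]
    exact div_le_div_of_nonneg_right (hvg hij) hp.le
  · rw [mul_zero]

theorem mul_sum_one_div_le [Fintype ι] {p : ℕ → ι → ℝ} {i : ℕ → ι} {m : ℕ} {l a : ℝ}
    (h : ∀ j, l * ∑ b ∈ Finset.range m, (importanceEstimate 0 1 (p b) (i b) j - 2) ≤ a) :
    l * ∑ b ∈ Finset.range m, 1 / p b (i b) ≤ Fintype.card ι * (a + 2 * l * m) := by
  have hsum : ∑ b ∈ Finset.range m, 1 / p b (i b) =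
      ∑ j, ∑ b ∈ Finset.range m, importanceEstimate 0 1 (p b) (i b) j := by
    rw [Finset.sum_comm]
    simp [importanceEstimate]
  rw [hsum, Finset.mul_sum, ← nsmul_eq_mul]
  refine Finset.sum_le_card_nsmul _ _ _ fun j _ => ?_
  have hj := h j
  rw [Finset.sum_sub_distrib, Finset.sum_const, Finset.card_range, nsmul_eq_mul, mul_sub] at hj
  linarith

/-- The high-probability bound on the regret of EXP3.P over `m` steps with `N` actions, exploration
rate `γ` and bias `β`, when the sums of the importance estimates deviate by at most `a₁ / β` from
below and `N * a₂ / γ` from above. -/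
noncomputable def exp3Error (N : ℕ) (γ β : ℝ) (m : ℕ) (a₁ a₂ : ℝ) : ℝ :=
  γ * m + a₁ / β + 3 * N * Real.log N / γ + m * (N * β) + 5 / 3 * (2 * γ * m + N * a₂) +
    m * (2 / 3 * N * β ^ 2)

theorem exp3Error_nonneg {N m : ℕ} {γ β a₁ a₂ : ℝ} (hγ : 0 ≤ γ) (hβ : 0 ≤ β) (ha₁ : 0 ≤ a₁)
    (ha₂ : 0 ≤ a₂) : 0 ≤ exp3Error N γ β m a₁ a₂ := by
  have := Real.log_natCast_nonneg N
  unfold exp3Error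
  positivity

theorem exp3_regret_le {N : ℕ} (M : ℕ) (α : ℝ) (i : ℕ → Fin N) (g : ℕ → ℝ) {m : ℕ}
    {γ β v a₁ a₂ : ℝ} (hγ0 : 0 < γ) (hγ : γ ≤ 1) (hβ0 : 0 < β) (hβ : β ≤ 2)
    (hαβ : α / √((N : ℝ) * M) = β) (hg : ∀ b < m, |g b| ≤ 1) {j : Fin N} (hv0 : 0 ≤ v)
    (hv1 : v ≤ 1) (hvg : ∀ b < m, i b = j → v ≤ g b) (ha₁ : 0 ≤ a₁)
    (h₁ : β * ∑ b ∈ Finset.range m, (1 -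
      importanceEstimate β 1 (exp3Prob γ (exp3Weight M α γ i g b)) (i b) j) ≤ a₁)
    (h₂ : ∀ k, γ / N * ∑ b ∈ Finset.range m,
      (importanceEstimate 0 1 (exp3Prob γ (exp3Weight M α γ i g b)) (i b) k - 2) ≤ a₂) :
    v * m - exp3Error N γ β m a₁ a₂ ≤ ∑ b ∈ Finset.range m, g b := by
  have hN : (0 : ℝ) < N := by exact_mod_cast j.pos
  set p : ℕ → Fin N → ℝ := fun b => exp3Prob γ (exp3Weight M α γ i g b) with hp
  have hppos : ∀ b k, 0 < p b k := fun b k =>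
    exp3Prob_pos hγ0 hγ (exp3Weight_pos M α i g γ b) k
  set Y := ∑ b ∈ Finset.range m, importanceEstimate β 1 (p b) (i b) j with hY
  have hestimates : v * Y ≤ ∑ b ∈ Finset.range m, importanceEstimate β (g b) (p b) (i b) j := by
    rw [hY, Finset.mul_sum]
    exact Finset.sum_le_sum fun b hb => mul_importanceEstimate_one_le hβ0.le hv1 (hppos b j)
      (hvg b (Finset.mem_range.1 hb))
  have hlower : m - a₁ / β ≤ Y := by
    rw [Finset.sum_sub_distrib, Finset.sum_const, Finset.card_range, nsmul_one, mul_comm,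
      ← le_div_iff₀ hβ0] at h₁
    linarith
  have hupper : γ / N * ∑ b ∈ Finset.range m, 1 / p b (i b) ≤ 2 * γ * m + N * a₂ := by
    refine (mul_sum_one_div_le h₂).trans_eq ?_
    rw [Fintype.card_fin]
    field_simp
    ring
  have hpotential := exp3_sum_importanceEstimate_le M α i g hγ0 hγ hβ0.le hβ hαβ hg j
  have hlevel : v * m - γ * m - a₁ / β ≤ (1 - γ) * (v * Y) := by
    have hvm : γ * (v * m) ≤ γ * (1 * m) := by gcongr
    have hva : (1 - γ) * v * (a₁ / β) ≤ 1 * (a₁ / β) := by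
      gcongr
      exact mul_le_one₀ (by linarith) hv0 hv1
    have := mul_le_mul_of_nonneg_left (mul_le_mul_of_nonneg_left hlower hv0) (sub_nonneg.2 hγ)
    linarith
  have := mul_le_mul_of_nonneg_left hestimates (sub_nonneg.2 hγ)
  unfold exp3Error
  linarith

end Exp3Regret

section Path

theorem sum_range_mul_eq (f : ℕ → ℝ) (m H : ℕ) :
    ∑ t ∈ Finset.range (m * H), f t =
      ∑ b ∈ Finset.range m, ∑ t ∈ Finset.Ico (b * H) ((b + 1) * H), f t := by
  induction m with
  | zero => simp
  | succ m ih =>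
    rw [Finset.sum_range_succ, ← ih, Finset.range_eq_Ico, Finset.range_eq_Ico,
      Finset.sum_Ico_consecutive _ (Nat.zero_le _) (Nat.mul_le_mul_right H (Nat.le_succ m))]

theorem add_one_mul_le_of_lt_div {T H b : ℕ} (hb : b < T / H) : (b + 1) * H ≤ T :=
  (Nat.mul_le_mul_right H hb).trans (Nat.div_mul_le_self T H)

/-- The high-probability bound on the total reward of a batch by which the rewards of the master
algorithm are normalized. -/
noncomputable def batchScale (T H : ℕ) (δ : ℝ) : ℝ :=
  2 * H + √(2 * H * Real.log (12 * T / (H * δ)))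

variable {X : Type*} {T H : ℕ} {δ : ℝ} {μ : X → ℝ} {x : ℕ → X} {z : ℕ → ℝ}

theorem batchScale_pos (hH : 0 < H) : 0 < batchScale T H δ := by
  unfold batchScale
  positivity

theorem batchScale_mul_batchReward (hH : 0 < H) (y : ℕ → ℝ) (b : ℕ) :
    batchScale T H δ * batchReward T H δ y b = ∑ t ∈ Finset.Ico (b * H) ((b + 1) * H), y t :=
  mul_div_cancel₀ _ (batchScale_pos hH).ne'

theorem abs_batchReward_le_one (hμ01 : ∀ x, μ x ∈ Set.Icc (0 : ℝ) 1) (hH : 0 < H) {b : ℕ}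
    (hz : |∑ t ∈ Finset.Ico (b * H) ((b + 1) * H), z t| ≤ batchScale T H δ - H) :
    |batchReward T H δ (fun t => μ (x t) + z t) b| ≤ 1 := by
  have hμ0 : 0 ≤ ∑ t ∈ Finset.Ico (b * H) ((b + 1) * H), μ (x t) :=
    Finset.sum_nonneg fun t _ => (hμ01 _).1
  have hμ1 : ∑ t ∈ Finset.Ico (b * H) ((b + 1) * H), μ (x t) ≤ H := by
    refine (Finset.sum_le_card_nsmul _ _ 1 fun t _ => (hμ01 _).2).trans_eq ?_
    rw [card_Ico_mul_add_one_mul, nsmul_one]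
  refine le_of_mul_le_mul_left ?_ (batchScale_pos (T := T) (δ := δ) hH)
  nth_rw 1 [← abs_of_pos (batchScale_pos (T := T) (δ := δ) hH)]
  rw [← abs_mul, batchScale_mul_batchReward hH, Finset.sum_add_distrib, mul_one]
  refine (abs_add_le _ _).trans ?_
  rw [abs_of_nonneg hμ0]
  linarith

theorem regret_le_add_regret_complete_batches (hμ01 : ∀ x, μ x ∈ Set.Icc (0 : ℝ) 1) (xopt : X)
    (x : ℕ → X) (hH : 0 < H) :
    T * μ xopt - ∑ t ∈ Finset.range T, μ (x t) ≤
      H + ((T / H : ℕ) * (H * μ xopt) - ∑ t ∈ Finset.range (T / H * H), μ (x t)) := by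
  have hT : (T : ℝ) ≤ (T / H : ℕ) * H + H := by
    exact_mod_cast (Nat.lt_div_mul_add hH).le
  have hsum : ∑ t ∈ Finset.range (T / H * H), μ (x t) ≤ ∑ t ∈ Finset.range T, μ (x t) :=
    Finset.sum_le_sum_of_subset_of_nonneg
      (Finset.range_subset_range.2 (Nat.div_mul_le_self T H)) fun t _ _ => (hμ01 _).1
  have hTμ := mul_le_mul_of_nonneg_right hT (hμ01 xopt).1
  have hHμ := mul_le_mul_of_nonneg_left (hμ01 xopt).2 (Nat.cast_nonneg (α := ℝ) H)
  linarith

theorem batchScale_mul_sum_batchReward_le (hH : 0 < H) {m : ℕ} {D : ℝ}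
    (hz : ∀ b < m, |∑ t ∈ Finset.Ico (b * H) ((b + 1) * H), z t| ≤ D) :
    batchScale T H δ * ∑ b ∈ Finset.range m, batchReward T H δ (fun t => μ (x t) + z t) b ≤
      ∑ t ∈ Finset.range (m * H), μ (x t) + m * D := by
  have hD : ∑ b ∈ Finset.range m, ∑ t ∈ Finset.Ico (b * H) ((b + 1) * H), z t ≤ m * D := by
    refine (Finset.sum_le_card_nsmul _ _ D fun b hb =>
      (le_abs_self _).trans (hz b (Finset.mem_range.1 hb))).trans_eq ?_
    rw [Finset.card_range, nsmul_eq_mul]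
  simp only [Finset.mul_sum, batchScale_mul_batchReward hH, sum_range_mul_eq,
    Finset.sum_add_distrib]
  linarith

/- In the batches of the base algorithm `j`, the normalized reward is at least
`v = (H * μ xopt - (R + D)) / batchScale T H δ`; the master competes with this constant reward. -/
theorem regret_le_of_exp3_regret_le {i : ℕ → Fin (numBase T)}
    (hμ01 : ∀ x, μ x ∈ Set.Icc (0 : ℝ) 1) {xopt : X} (hH : 0 < H) {R D E : ℝ} (hR0 : 0 ≤ R)
    (hD0 : 0 ≤ D) (hE0 : 0 ≤ E) {j : Fin (numBase T)}
    (hR : ∀ b < T / H, i b = j →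
      ∑ t ∈ Finset.Ico (b * H) ((b + 1) * H), (μ xopt - μ (x t)) ≤ R)
    (hz : ∀ b < T / H, |∑ t ∈ Finset.Ico (b * H) ((b + 1) * H), z t| ≤ D)
    (hexp3 : ∀ v ∈ Set.Icc (0 : ℝ) 1,
      (∀ b < T / H, i b = j → v ≤ batchReward T H δ (fun t => μ (x t) + z t) b) →
      v * (T / H : ℕ) - E ≤
        ∑ b ∈ Finset.range (T / H), batchReward T H δ (fun t => μ (x t) + z t) b) :
    T * μ xopt - ∑ t ∈ Finset.range T, μ (x t) ≤
      H + (T / H : ℕ) * (R + 2 * D) + batchScale T H δ * E := by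
  have hQ := batchScale_pos (T := T) (δ := δ) hH
  have hm : (0 : ℝ) ≤ (T / H : ℕ) := Nat.cast_nonneg _
  refine (regret_le_add_regret_complete_batches hμ01 xopt x hH).trans ?_
  rcases lt_or_ge (H * μ xopt - (R + D)) 0 with hneg | hnonneg
  · have hsum : 0 ≤ ∑ t ∈ Finset.range (T / H * H), μ (x t) :=
      Finset.sum_nonneg fun t _ => (hμ01 _).1
    have hmD := mul_nonneg hm hD0
    have hQE := mul_nonneg hQ.le hE0
    linarith [mul_le_mul_of_nonneg_left hneg.le hm]
  · have hQv := mul_div_cancel₀ (H * μ xopt - (R + D)) hQ.ne'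
    have hv1 : (H * μ xopt - (R + D)) / batchScale T H δ ≤ 1 := by
      refine (div_le_one hQ).2 ?_
      have hHμ := mul_le_mul_of_nonneg_left (hμ01 xopt).2 (Nat.cast_nonneg (α := ℝ) H)
      have hHQ : (H : ℝ) * 1 ≤ batchScale T H δ := by
        linarith [Real.sqrt_nonneg (2 * H * Real.log (12 * T / (H * δ))),
          (Nat.cast_nonneg H : (0 : ℝ) ≤ H), batchScale.eq_1 T H δ]
      linarith
    have hregret := mul_le_mul_of_nonneg_left (hexp3 _ ⟨div_nonneg hnonneg hQ.le, hv1⟩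
      fun b hb hij => by
        refine le_of_mul_le_mul_left ?_ hQ
        have hgap := hR b hb hij
        rw [Finset.sum_sub_distrib, Finset.sum_const, card_Ico_mul_add_one_mul,
          nsmul_eq_mul] at hgap
        rw [hQv, batchScale_mul_batchReward hH, Finset.sum_add_distrib]
        linarith [(abs_le.1 (hz b hb)).1]) hQ.le
    rw [mul_sub, ← mul_assoc, hQv] at hregret
    linarith [batchScale_mul_sum_batchReward_le (T := T) (δ := δ) (μ := μ) (x := x) hH hz]

end Path

/-! ### Orders of magnitude -/

section Parameters

variable {N M T H : ℕ} {δ l : ℝ}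

theorem one_le_two_mul_log_div (hT : 2 ≤ T) (hδ0 : 0 < δ) (hδ1 : δ ≤ 1) :
    1 ≤ 2 * Real.log (T / δ) := by
  have hTδ : (2 : ℝ) ≤ T / δ := by
    rw [le_div_iff₀ hδ0]
    have : (2 : ℝ) ≤ T := by exact_mod_cast hT
    linarith
  have := Real.log_le_log two_pos hTδ
  linarith [Real.log_two_gt_d9]

theorem log_mul_div_le {a b : ℝ} (hT : 2 ≤ T) (hδ0 : 0 < δ) (hδ1 : δ ≤ 1) (ha : 1 ≤ a)
    (hb0 : 0 < b) (hb : b ≤ T ^ 2) : Real.log (a * b / δ) ≤ a * (2 * Real.log (T / δ)) := by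
  have hl := one_le_two_mul_log_div hT hδ0 hδ1
  have hlogb : Real.log b ≤ 2 * Real.log T := by
    simpa using Real.log_le_log hb0 hb
  have hloga := Real.log_le_sub_one_of_pos (zero_lt_one.trans_le ha)
  have hlogδ := Real.log_nonpos hδ0.le hδ1
  rw [Real.log_div (by positivity) hδ0.ne', Real.log_mul (by positivity) hb0.ne']
  rw [Real.log_div (by positivity) hδ0.ne'] at hl ⊢
  nlinarith

theorem numBase_le_self (T : ℕ) : numBase T ≤ T :=
  Nat.clog_le_of_le_pow Nat.lt_two_pow_self.le

theorem two_le_numBase (hT : 3 ≤ T) : 2 ≤ numBase T :=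
  (Nat.lt_clog_iff_pow_lt one_lt_two).2 hT

theorem numBase_le_one_add_two_mul_log (hT : 2 ≤ T) :
    (numBase T : ℝ) ≤ 1 + 2 * Real.log T := by
  have hpred : 2 ^ (numBase T - 1) < T := Nat.pow_pred_clog_lt_self one_lt_two hT
  have hlog : ((numBase T - 1 : ℕ) : ℝ) * Real.log 2 ≤ Real.log T := by
    rw [← Real.log_pow]
    exact Real.log_le_log (by positivity) (by exact_mod_cast hpred.le)
  have hN : (numBase T : ℝ) ≤ (numBase T - 1 : ℕ) + 1 := by
    exact_mod_cast le_tsub_add (a := 1) (b := numBase T)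
  nlinarith [Real.log_two_gt_d9, (Nat.cast_nonneg (numBase T - 1) : (0 : ℝ) ≤ _)]

theorem exists_level (hT : 2 ≤ T) {C : ℝ} (hC0 : 0 ≤ C) (hC : C ≤ T) :
    ∃ j : Fin (numBase T), C ≤ level j ∧ level j ≤ 2 + 2 * C := by
  have hle : C ≤ 2 ^ Nat.clog 2 ⌈C⌉₊ :=
    (Nat.le_ceil C).trans (by exact_mod_cast Nat.le_pow_clog one_lt_two ⌈C⌉₊)
  rcases le_or_gt ⌈C⌉₊ 1 with hceil | hceil
  · rw [Nat.clog_of_right_le_one hceil, pow_zero] at hle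
    refine ⟨⟨0, Nat.clog_pos one_lt_two hT⟩, ?_, ?_⟩ <;> norm_num [level] <;> linarith
  · have hpos : 0 < Nat.clog 2 ⌈C⌉₊ := Nat.clog_pos one_lt_two hceil
    have hclog : Nat.clog 2 ⌈C⌉₊ ≤ numBase T := Nat.clog_mono_right 2 (Nat.ceil_le.2 hC)
    have hlt : (2 : ℝ) ^ (Nat.clog 2 ⌈C⌉₊ - 1) < ⌈C⌉₊ := by
      exact_mod_cast Nat.pow_pred_clog_lt_self one_lt_two hceil
    refine ⟨⟨Nat.clog 2 ⌈C⌉₊ - 1, by omega⟩, ?_, ?_⟩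
    · rwa [level, Nat.sub_add_cancel hpos]
    · rw [level, pow_succ]
      linarith [Nat.ceil_lt_add_one hC0]

theorem numBatch_le_two_mul_div (hH : 0 < H) (hHT : H ≤ T) :
    (numBatch T H : ℝ) ≤ 2 * (T / H) := by
  have hTH : (1 : ℝ) ≤ T / H := (one_le_div (by positivity)).2 (by exact_mod_cast hHT)
  have := Nat.ceil_lt_add_one (a := (T : ℝ) / H) (by positivity)
  unfold numBatch
  linarith

theorem numBatch_le_self (hH : 0 < H) : numBatch T H ≤ T :=
  Nat.ceil_le.2 (div_le_self (by positivity) (by exact_mod_cast hH))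

theorem numBatch_pos (hH : 0 < H) (hT : 0 < T) : 0 < numBatch T H :=
  Nat.ceil_pos.2 (by positivity)

theorem le_numBatch_mul (hH : 0 < H) : (T : ℝ) ≤ numBatch T H * H :=
  (div_le_iff₀ (by positivity)).1 (Nat.le_ceil _)

theorem div_le_numBatch (T H : ℕ) : T / H ≤ numBatch T H := by
  exact_mod_cast (Nat.cast_div_le (α := ℝ)).trans (Nat.le_ceil _)

theorem log_three_mul_div_pos (hN : 0 < N) (hδ0 : 0 < δ) (hδ1 : δ ≤ 1) :
    0 < Real.log (3 * N / δ) := by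
  have : (1 : ℝ) ≤ N := by exact_mod_cast hN
  exact Real.log_pos ((one_lt_div hδ0).2 (by linarith))

theorem log_le_log_mul (hN : 0 < N) (hM : 0 < M) (hδ0 : 0 < δ) :
    Real.log (3 * N / δ) ≤ Real.log (3 * N * M / δ) := by
  have : (1 : ℝ) ≤ M := by exact_mod_cast hM
  exact Real.log_le_log (by positivity)
    (div_le_div_of_nonneg_right (le_mul_of_one_le_right (by positivity) this) hδ0.le)

theorem alpha_sq (hN : 0 < N) (hM : 0 < M) (hδ0 : 0 < δ) (hδ1 : δ ≤ 1) :
    alpha N M δ ^ 2 = 4 * Real.log (3 * N * M / δ) := by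
  rw [alpha, mul_pow, Real.sq_sqrt
    ((log_three_mul_div_pos hN hδ0 hδ1).le.trans (log_le_log_mul hN hM hδ0))]
  norm_num

theorem alpha_pos (hN : 0 < N) (hM : 0 < M) (hδ0 : 0 < δ) (hδ1 : δ ≤ 1) : 0 < alpha N M δ :=
  mul_pos two_pos (Real.sqrt_pos.2
    ((log_three_mul_div_pos hN hδ0 hδ1).trans_le (log_le_log_mul hN hM hδ0)))

theorem log_three_mul_div_le_alpha_sq (hN : 0 < N) (hM : 0 < M) (hδ0 : 0 < δ) (hδ1 : δ ≤ 1) :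
    Real.log (3 * N / δ) ≤ alpha N M δ ^ 2 := by
  rw [alpha_sq hN hM hδ0 hδ1]
  linarith [log_three_mul_div_pos hN hδ0 hδ1, log_le_log_mul hN hM hδ0]

theorem alpha_sq_le (hT : 2 ≤ T) (hN : 0 < N) (hNT : N ≤ T) (hM : 0 < M) (hMT : M ≤ T)
    (hδ0 : 0 < δ) (hδ1 : δ ≤ 1) : alpha N M δ ^ 2 ≤ 12 * (2 * Real.log (T / δ)) := by
  have hNM : (N : ℝ) * M ≤ T ^ 2 := by
    rw [sq]
    gcongr
  have := log_mul_div_le hT hδ0 hδ1 (a := 3) (by norm_num) (by positivity) hNM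
  rw [alpha_sq hN hM hδ0 hδ1, mul_assoc 3]
  linarith

theorem gamma_mul_le (hl : 0 ≤ l) (hN : N * Real.log N ≤ 2 * l ^ 2) :
    gamma N M * M ≤ 3 * l * √M := by
  have : 0 ≤ Real.log N := Real.log_natCast_nonneg N
  have hsqrt : √(3 * N * Real.log N / (5 * M)) * M ≤ 3 / 2 * l * √M := by
    calc √(3 * N * Real.log N / (5 * M)) * M
        = √(3 * N * Real.log N / (5 * M) * M ^ 2) := by
          rw [Real.sqrt_mul (by positivity), Real.sqrt_sq (by positivity)]
      _ = √(3 / 5 * (N * Real.log N) * M) := by congr 1; field_simp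
      _ ≤ √((3 / 2 * l) ^ 2 * M) := by
          gcongr
          nlinarith [sq_nonneg l]
      _ = 3 / 2 * l * √M := by rw [Real.sqrt_mul (by positivity), Real.sqrt_sq (by positivity)]
  calc gamma N M * M ≤ 2 * √(3 * N * Real.log N / (5 * M)) * M := by
        gcongr
        exact min_le_right _ _
    _ ≤ 3 * l * √M := by linarith

theorem div_gamma_le (hN2 : 2 ≤ N) (hM : 0 < M) (hl : 1 ≤ l)
    (hN : N * Real.log N ≤ 2 * l ^ 2) : 3 * N * Real.log N / gamma N M ≤ 14 * l ^ 2 * √M := by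
  have hlogN : 0 < Real.log N := Real.log_pos (by exact_mod_cast hN2)
  rw [div_le_iff₀ (gamma_pos hN2 hM), gamma]
  rcases min_choice (3 / 5 : ℝ) (2 * √(3 * N * Real.log N / (5 * M))) with h | h <;> rw [h]
  · have hsqrtM : 1 ≤ √(M : ℝ) := Real.one_le_sqrt.2 (by exact_mod_cast hM)
    have : 2 * l ^ 2 * 1 ≤ 2 * l ^ 2 * √M := by gcongr
    nlinarith [sq_nonneg l]
  · set q := 3 * N * Real.log N / (5 * M) with hq
    have : 0 < q := by positivity
    have hMq : M * q = 3 / 5 * (N * Real.log N) := by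
      rw [hq]
      field_simp
    have hsqrt : √(M * q) ≤ 2 * l ^ 2 := by
      refine Real.sqrt_le_iff.2 ⟨by positivity, ?_⟩
      have : l ^ 2 * 1 ≤ l ^ 2 * l ^ 2 := by
        gcongr
        exact one_le_pow₀ hl
      rw [hMq]
      nlinarith
    calc 3 * N * Real.log N = 5 * (√(M * q) * √(M * q)) := by
          rw [Real.mul_self_sqrt (by positivity), hMq]
          ring
      _ ≤ 5 * (2 * l ^ 2 * √(M * q)) := by gcongr
      _ ≤ 14 * l ^ 2 * (2 * √(M * q)) := by
          linarith [show 0 ≤ l ^ 2 * √(M * q) by positivity]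
      _ = 14 * l ^ 2 * √M * (2 * √q) := by
          rw [Real.sqrt_mul (by positivity)]
          ring

theorem mul_sqrt_mul_le {α : ℝ} (hl : 0 ≤ l) (hN : (N : ℝ) ≤ 2 * l) (hα0 : 0 ≤ α)
    (hα : α ^ 2 ≤ 12 * l) : α * √((N : ℝ) * M) ≤ 5 * l * √M := by
  calc α * √((N : ℝ) * M) = √(α ^ 2 * (N * M)) := by
        rw [Real.sqrt_mul (sq_nonneg α), Real.sqrt_sq hα0]
    _ ≤ √(12 * l * (2 * l * M)) := by gcongr
    _ ≤ √((5 * l) ^ 2 * M) := by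
        refine Real.sqrt_le_sqrt ?_
        linarith [show 0 ≤ l ^ 2 * M by positivity]
    _ = 5 * l * √M := by rw [Real.sqrt_mul (by positivity), Real.sqrt_sq (by positivity)]

theorem mul_mul_div_sqrt_le {m : ℕ} {α : ℝ} (hmM : m ≤ M) (hα0 : 0 ≤ α) :
    m * (N * (α / √((N : ℝ) * M))) ≤ α * √((N : ℝ) * M) := by
  calc m * (N * (α / √((N : ℝ) * M))) ≤ M * (N * (α / √((N : ℝ) * M))) := by gcongr
    _ = α * (N * M / √((N : ℝ) * M)) := by ring
    _ = α * √((N : ℝ) * M) := by rw [Real.div_sqrt]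

theorem mul_mul_div_sqrt_sq_le {m : ℕ} (hmM : m ≤ M) (α : ℝ) :
    m * (N * (α / √((N : ℝ) * M)) ^ 2) ≤ α ^ 2 := by
  calc m * (N * (α / √((N : ℝ) * M)) ^ 2) ≤ M * (N * (α / √((N : ℝ) * M)) ^ 2) := by gcongr
    _ = α ^ 2 * (N * M / (N * M)) := by
        rw [div_pow, Real.sq_sqrt (by positivity)]
        ring
    _ ≤ α ^ 2 := mul_le_of_le_one_right (sq_nonneg α) (div_self_le_one _)

theorem exp3Error_le {m : ℕ} {α a₁ a₂ : ℝ} (hN2 : 2 ≤ N) (hM : 0 < M) (hmM : m ≤ M)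
    (hl : 1 ≤ l) (hN : (N : ℝ) ≤ 2 * l) (hlogN : Real.log N ≤ l) (hα0 : 0 < α)
    (hα : α ^ 2 ≤ 12 * l) (ha₁ : a₁ ≤ α ^ 2) (ha₂ : a₂ ≤ 6 * l) :
    exp3Error N (gamma N M) (α / √((N : ℝ) * M)) m a₁ a₂ ≤ 65 * l ^ 2 * √M := by
  have hm : (m : ℝ) ≤ M := by exact_mod_cast hmM
  have hNlogN : N * Real.log N ≤ 2 * l ^ 2 := by
    calc N * Real.log N ≤ 2 * l * l := by
          gcongr
      _ = 2 * l ^ 2 := by ring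
  have hl2M : l ^ 2 * 1 ≤ l ^ 2 * √M := by
    gcongr
    exact Real.one_le_sqrt.2 (by exact_mod_cast hM)
  have hlM : l * √M ≤ l ^ 2 * √M := by
    gcongr
    exact le_self_pow₀ hl two_ne_zero
  have hγ : gamma N M * m ≤ gamma N M * M := by
    gcongr
    exact (gamma_pos hN2 hM).le
  have hγM := gamma_mul_le (N := N) (M := M) (by linarith) hNlogN
  have hγN := div_gamma_le hN2 hM hl hNlogN
  have hαNM := mul_sqrt_mul_le (M := M) (by linarith) hN hα0.le hα
  have hbias := mul_mul_div_sqrt_le (N := N) hmM hα0.le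
  have hbias2 := mul_mul_div_sqrt_sq_le (N := N) hmM α
  set q := √((N : ℝ) * M)
  have hq0 : 0 < q := Real.sqrt_pos.2 (by positivity)
  have hdeviation : a₁ / (α / q) ≤ α * q := by
    rw [div_div_eq_mul_div, div_le_iff₀ hα0]
    nlinarith
  have hcount : N * a₂ ≤ 2 * l * (6 * l) :=
    (mul_le_mul_of_nonneg_left ha₂ (Nat.cast_nonneg N)).trans (by gcongr)
  unfold exp3Error
  linarith [le_self_pow₀ hl two_ne_zero]

end Parameters

section BatchLength

variable {d κ l C w : ℝ} {T : ℕ}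

theorem le_batchLength (d : ℝ) (T : ℕ) : (T : ℝ) ^ ((d + 2) / (d + 4)) ≤ batchLength d T :=
  Nat.le_ceil _

theorem batchLength_pos (hT : 0 < T) : 0 < batchLength d T :=
  Nat.ceil_pos.2 (by positivity)

theorem batchLength_le_self (hd : 0 ≤ d) (hT : 0 < T) : batchLength d T ≤ T := by
  refine Nat.ceil_le.2 ((Real.rpow_le_rpow_of_exponent_le (by exact_mod_cast hT) ?_).trans_eq
    (Real.rpow_one _))
  exact (div_le_one (by positivity)).2 (by linarith)

theorem batchLength_le_two_mul_rpow (hd : 0 ≤ d) (hT : 0 < T) {e : ℝ}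
    (he : (d + 2) / (d + 4) ≤ e) : (batchLength d T : ℝ) ≤ 2 * (T : ℝ) ^ e := by
  have hT1 : (1 : ℝ) ≤ T := by exact_mod_cast hT
  have hone : 1 ≤ (T : ℝ) ^ ((d + 2) / (d + 4)) := Real.one_le_rpow hT1 (by positivity)
  have hceil := Nat.ceil_lt_add_one (a := (T : ℝ) ^ ((d + 2) / (d + 4))) (by positivity)
  have hmono := Real.rpow_le_rpow_of_exponent_le hT1 he
  unfold batchLength
  linarith

theorem mul_batchLength_rpow_neg_le (hT : 0 < T) {a e : ℝ} (ha : 0 ≤ a)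
    (he : 1 - (d + 2) / (d + 4) * a ≤ e) : T * (batchLength d T : ℝ) ^ (-a) ≤ (T : ℝ) ^ e := by
  have hT0 : (0 : ℝ) < T := by exact_mod_cast hT
  calc T * (batchLength d T : ℝ) ^ (-a)
      ≤ T * ((T : ℝ) ^ ((d + 2) / (d + 4))) ^ (-a) := by
        refine mul_le_mul_of_nonneg_left ?_ hT0.le
        exact Real.rpow_le_rpow_of_nonpos (by positivity) (le_batchLength d T) (by linarith)
    _ = (T : ℝ) ^ (1 - (d + 2) / (d + 4) * a) := by
        rw [← Real.rpow_mul hT0.le, sub_eq_add_neg, Real.rpow_add hT0, Real.rpow_one, mul_neg]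
    _ ≤ (T : ℝ) ^ e := Real.rpow_le_rpow_of_exponent_le (by exact_mod_cast hT) he

/-- The order of the regret over `T` rounds with total corruption `C`, up to logarithms. -/
noncomputable def regretRate (d : ℝ) (T : ℕ) (C : ℝ) : ℝ :=
  (T : ℝ) ^ ((d + 3) / (d + 4)) + C ^ (1 / (d + 1)) * (T : ℝ) ^ ((d + 2) / (d + 3))

theorem rpow_le_regretRate (hC : 0 ≤ C) : (T : ℝ) ^ ((d + 3) / (d + 4)) ≤ regretRate d T C :=
  le_add_of_nonneg_right (by positivity)

theorem regretRate_nonneg (hC : 0 ≤ C) : 0 ≤ regretRate d T C := by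
  unfold regretRate
  positivity

theorem batchLength_le_two_mul_regretRate (hd : 0 ≤ d) (hT : 0 < T) (hC : 0 ≤ C) :
    (batchLength d T : ℝ) ≤ 2 * regretRate d T C :=
  (batchLength_le_two_mul_rpow hd hT (by gcongr; norm_num)).trans
    (mul_le_mul_of_nonneg_left (rpow_le_regretRate hC) zero_le_two)

theorem div_mul_sqrt_batchLength_le_regretRate (hd : 0 ≤ d) (hT : 0 < T) (hC : 0 ≤ C) :
    T / batchLength d T * √(batchLength d T) ≤ regretRate d T C := by
  have hH : (0 : ℝ) < batchLength d T := by exact_mod_cast batchLength_pos hT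
  have hsqrt : T / batchLength d T * √(batchLength d T) =
      T * (batchLength d T : ℝ) ^ (-(1 / 2) : ℝ) := by
    rw [div_mul_eq_mul_div, mul_div_assoc, Real.sqrt_div_self', Real.sqrt_eq_rpow,
      Real.rpow_neg hH.le, one_div]
  refine hsqrt.trans_le ((mul_batchLength_rpow_neg_le hT (by norm_num) ?_).trans
    (rpow_le_regretRate hC))
  rw [← sub_nonneg]
  have hgap : (d + 3) / (d + 4) - (1 - (d + 2) / (d + 4) * (1 / 2)) = d / (2 * (d + 4)) := by
    field_simp
    ring
  rw [hgap]
  positivity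

theorem batchLength_mul_sqrt_numBatch_le_two_mul_regretRate (hd : 0 ≤ d) (hT : 0 < T)
    (hC : 0 ≤ C) :
    batchLength d T * √(numBatch T (batchLength d T)) ≤ 2 * regretRate d T C := by
  have hT0 : (0 : ℝ) < T := by exact_mod_cast hT
  have hH : (0 : ℝ) < batchLength d T := by exact_mod_cast batchLength_pos hT
  have hexp : (T : ℝ) ^ (1 + (d + 2) / (d + 4)) = ((T : ℝ) ^ ((d + 3) / (d + 4))) ^ 2 := by
    rw [← Real.rpow_natCast, ← Real.rpow_mul hT0.le]
    congr 1
    push_cast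
    field_simp
    ring
  refine le_trans ?_ (mul_le_mul_of_nonneg_left (rpow_le_regretRate hC) zero_le_two)
  refine le_of_sq_le_sq ?_ (by positivity)
  calc (batchLength d T * √(numBatch T (batchLength d T))) ^ 2
      = (batchLength d T : ℝ) ^ 2 * numBatch T (batchLength d T) := by
        rw [mul_pow, Real.sq_sqrt (Nat.cast_nonneg _)]
    _ ≤ (batchLength d T : ℝ) ^ 2 * (2 * (T / batchLength d T)) := by
        gcongr
        exact numBatch_le_two_mul_div (batchLength_pos hT) (batchLength_le_self hd hT)
    _ = 2 * (T : ℝ) * batchLength d T := by field_simp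
    _ ≤ 2 * (T : ℝ) * (2 * (T : ℝ) ^ ((d + 2) / (d + 4))) := by
        gcongr
        exact batchLength_le_two_mul_rpow hd hT le_rfl
    _ = 4 * (T : ℝ) ^ (1 + (d + 2) / (d + 4)) := by
        rw [Real.rpow_add hT0, Real.rpow_one]
        ring
    _ = (2 * (T : ℝ) ^ ((d + 3) / (d + 4))) ^ 2 := by rw [hexp]; ring

theorem mul_div_batchLength_rpow_le_regretRate (hd : 0 ≤ d) (hT : 0 < T) (hC : 0 ≤ C) :
    T * (C / batchLength d T) ^ (1 / (d + 1)) ≤ regretRate d T C := by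
  have hexponent : 1 - (d + 2) / (d + 4) * (1 / (d + 1)) ≤ (d + 2) / (d + 3) := by
    rw [← sub_nonneg]
    have hgap : (d + 2) / (d + 3) - (1 - (d + 2) / (d + 4) * (1 / (d + 1))) =
        2 / ((d + 1) * (d + 3) * (d + 4)) := by
      field_simp
      ring
    rw [hgap]
    positivity
  calc T * (C / batchLength d T) ^ (1 / (d + 1))
      = C ^ (1 / (d + 1)) * (T * (batchLength d T : ℝ) ^ (-(1 / (d + 1)))) := by
        rw [Real.div_rpow hC (Nat.cast_nonneg _), Real.rpow_neg (Nat.cast_nonneg _)]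
        ring
    _ ≤ C ^ (1 / (d + 1)) * (T : ℝ) ^ ((d + 2) / (d + 3)) := by
        gcongr
        exact mul_batchLength_rpow_neg_le hT (by positivity) hexponent
    _ ≤ regretRate d T C := le_add_of_nonneg_left (by positivity)

theorem max_rpow_le {H : ℝ} (hd : 0 ≤ d) (hH : 1 ≤ H) (hw0 : 0 ≤ w) (hC : 0 ≤ C)
    (hw : w ≤ 2 + 2 * C) :
    max (H ^ (-(1 / (d + 2)))) ((w / H) ^ (1 / (d + 1))) ≤
      2 * H ^ (-(1 / (d + 2))) + 2 * (C / H) ^ (1 / (d + 1)) := by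
  have hH0 : 0 < H := by linarith
  refine max_le ?_ ?_
  · linarith [show 0 ≤ H ^ (-(1 / (d + 2))) by positivity,
      show 0 ≤ (C / H) ^ (1 / (d + 1)) by positivity]
  have hexponent : 1 / (d + 1) ≤ 1 := (div_le_one (by positivity)).2 (by linarith)
  have htwo : (2 : ℝ) ^ (1 / (d + 1)) ≤ 2 :=
    (Real.rpow_le_rpow_of_exponent_le one_le_two hexponent).trans_eq (Real.rpow_one 2)
  have hinv : (1 / H) ^ (1 / (d + 1)) ≤ H ^ (-(1 / (d + 2))) := by
    rw [one_div, Real.inv_rpow hH0.le, ← Real.rpow_neg hH0.le]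
    refine Real.rpow_le_rpow_of_exponent_le hH (neg_le_neg ?_)
    exact one_div_le_one_div_of_le (by positivity) (by linarith)
  calc (w / H) ^ (1 / (d + 1)) ≤ (2 * (1 / H) + 2 * (C / H)) ^ (1 / (d + 1)) := by
        gcongr
        rw [← mul_add, ← add_div, mul_div_assoc', mul_add, mul_one]
        gcongr
    _ ≤ (2 * (1 / H)) ^ (1 / (d + 1)) + (2 * (C / H)) ^ (1 / (d + 1)) :=
        Real.rpow_add_le_add_rpow (by positivity) (by positivity) (by positivity) hexponent
    _ = 2 ^ (1 / (d + 1)) * (1 / H) ^ (1 / (d + 1)) +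
          2 ^ (1 / (d + 1)) * (C / H) ^ (1 / (d + 1)) := by
        rw [Real.mul_rpow zero_le_two (by positivity), Real.mul_rpow zero_le_two (by positivity)]
    _ ≤ 2 * H ^ (-(1 / (d + 2))) + 2 * (C / H) ^ (1 / (d + 1)) := by gcongr

theorem mul_max_rpow_le_regretRate (hd : 0 ≤ d) (hT : 0 < T) (hw0 : 0 ≤ w) (hC : 0 ≤ C)
    (hw : w ≤ 2 + 2 * C) :
    T * max ((batchLength d T : ℝ) ^ (-(1 / (d + 2)))) ((w / batchLength d T) ^ (1 / (d + 1))) ≤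
      4 * regretRate d T C := by
  have hH : (1 : ℝ) ≤ batchLength d T := by exact_mod_cast batchLength_pos hT
  have hmax := max_rpow_le hd hH hw0 hC hw
  have hstochastic : T * (batchLength d T : ℝ) ^ (-(1 / (d + 2))) ≤ regretRate d T C := by
    refine (mul_batchLength_rpow_neg_le hT (by positivity) (le_of_eq ?_)).trans
      (rpow_le_regretRate hC)
    field_simp
    ring
  have hcorruption := mul_div_batchLength_rpow_le_regretRate hd hT hC
  have := mul_le_mul_of_nonneg_left hmax (Nat.cast_nonneg (α := ℝ) T)
  linarith

end BatchLength

/-! ### Good paths -/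

section GoodPath

/-- The bias `β` of the importance estimates of the master algorithm. -/
noncomputable def masterBias (T H : ℕ) (δ : ℝ) : ℝ :=
  alpha (numBase T) (numBatch T H) δ / √((numBase T : ℝ) * numBatch T H)

/-- The deviation inequalities that hold simultaneously with probability at least `1 - δ`: the
first two concern the draws of the master algorithm, the others the noise of the batches and
of the arms. -/
structure IsGoodPath {X : Type*} (T H : ℕ) (δ : ℝ) (i : ℕ → Fin (numBase T)) (x : ℕ → X)
    (η y : ℕ → ℝ) : Prop where
  mul_sum_one_sub_le : ∀ j, masterBias T H δ * ∑ b ∈ Finset.range (T / H),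
    (1 - importanceEstimate (masterBias T H δ) 1 (masterProb T H δ i y b) (i b) j) ≤
      Real.log (3 * numBase T / δ)
  mul_sum_sub_two_le : ∀ j, gamma (numBase T) (numBatch T H) / numBase T *
    ∑ b ∈ Finset.range (T / H), (importanceEstimate 0 1 (masterProb T H δ i y b) (i b) j - 2) ≤
      Real.log (6 * numBase T / δ)
  abs_sum_batch_noise_le : ∀ b < T / H, |∑ t ∈ Finset.Ico (b * H) ((b + 1) * H), η t| ≤
    √(2 * Real.log (12 * T / (H * δ)) * H)
  abs_sum_arm_noise_le : ∀ s < T, ∀ k ≤ T, |∑ t ∈ pullsSince x s k, η t| ≤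
    √(2 * Real.log (6 * T ^ 2 / δ) * (pullsSince x s k).card)

variable {X : Type*} {T H : ℕ} {δ : ℝ} {μ : X → ℝ} {xopt : X} {i : ℕ → Fin (numBase T)}
  {x : ℕ → X} {η c y : ℕ → ℝ}

theorem IsGoodPath.abs_sum_noise_add_corruption_le
    (h : IsGoodPath T H δ i x η y) (hc : ∀ t < T, |c t| ≤ 1) {θ : ℝ} (hθ0 : 0 ≤ θ) (hθ1 : θ ≤ 1)
    (hH : 0 < H) {b : ℕ} (hb : b < T / H) :
    |∑ t ∈ Finset.Ico (b * H) ((b + 1) * H), (η t + c t)| ≤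
      √(2 * H * Real.log (12 * T / (H * δ))) +
        H * ((∑ t ∈ Finset.range T, |c t|) / H) ^ θ := by
  have hnoise := h.abs_sum_batch_noise_le b hb
  have hsub : Finset.Ico (b * H) ((b + 1) * H) ⊆ Finset.range T := fun t ht =>
    Finset.mem_range.2 ((Finset.mem_Ico.1 ht).2.trans_le (add_one_mul_le_of_lt_div hb))
  have hcorruption := abs_sum_le_card_mul_rpow hsub
    (Finset.card_pos.1 ((card_Ico_mul_add_one_mul b H).symm ▸ hH))
    (fun t ht => hc t (Finset.mem_range.1 (hsub ht))) hθ0 hθ1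
  rw [card_Ico_mul_add_one_mul] at hcorruption
  rw [mul_right_comm] at hnoise
  rw [Finset.sum_add_distrib]
  exact (abs_add_le _ _).trans (add_le_add hnoise hcorruption)

theorem radius_eq_confidenceRadius (hT : 0 < T) (hδ0 : 0 < δ) (w : ℝ) :
    radius T (δ / 3) w = confidenceRadius (2 * Real.log (6 * T ^ 2 / δ)) w := by
  have hlog : 4 * Real.log T + 2 * Real.log (2 / (δ / 3)) = 2 * Real.log (6 * T ^ 2 / δ) := by
    have hsplit : 6 * (T : ℝ) ^ 2 / δ = T ^ 2 * (2 / (δ / 3)) := by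
      field_simp
      norm_num
    rw [hsplit, Real.log_mul (by positivity) (by positivity), Real.log_pow]
    push_cast
    ring
  rw [← hlog]
  rfl

theorem IsGoodPath.sum_gap_le [MetricSpace X] {d κ : ℝ} (hd : 0 ≤ d) (hX : HasCoveringBound X d κ)
    (hκ : 0 ≤ κ) (hμ : LipschitzWith 1 μ) (hμ01 : ∀ x, μ x ∈ Set.Icc (0 : ℝ) 1)
    (hopt : ∀ x, μ x ≤ μ xopt) (hδ0 : 0 < δ) (hδ1 : δ ≤ 1) (hH : 0 < H)
    (h : IsGoodPath T H δ i x η y) (hy : ∀ t, y t = μ (x t) + η t + c t)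
    {j : Fin (numBase T)} (hj : ∑ t ∈ Finset.range T, |c t| ≤ level j)
    {s : ℕ → ZoomState X} (hs : ∀ t < T, ZoomState.Round (radius T (δ / 3) (level (i (t / H))))
      (if H ∣ t then ZoomState.init X else s t) (x t) (y t) (s (t + 1)))
    {b : ℕ} (hb : b < T / H) (hij : i b = j) :
    ∑ t ∈ Finset.Ico (b * H) ((b + 1) * H), (μ xopt - μ (x t)) ≤
      6 * (1 + √(2 * Real.log (6 * T ^ 2 / δ) * (κ * 2 ^ d)) + κ * 2 ^ d) *
        (H * max ((H : ℝ) ^ (-(1 / (d + 2)))) ((level j / H) ^ (1 / (d + 1)))) := by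
  have hbT := add_one_mul_le_of_lt_div hb
  have hT : 0 < T := by
    rcases Nat.eq_zero_or_pos T with rfl | hT
    · simp at hb
    · exact hT
  have hlog : 0 ≤ Real.log (6 * T ^ 2 / δ) := by
    have hT1 : (1 : ℝ) ≤ T ^ 2 := one_le_pow₀ (by exact_mod_cast hT)
    exact Real.log_nonneg ((one_le_div hδ0).2 (by linarith))
  have hlevel : 1 ≤ level j := one_le_pow₀ one_le_two
  refine sum_gap_batch_le hd hX hκ hμ hμ01 hopt (mul_nonneg zero_le_two hlog) hlevel hH
    (y := y) (s := s) (fun k hk => ?_) fun t htb htb' => ?_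
  · simp only [hy]
    refine isAccurate_of_abs_sum_noise_le h.abs_sum_arm_noise_le hj ?_
    linarith [add_one_mul b H]
  · have hround := hs t (htb'.trans_le hbT)
    rwa [Nat.div_eq_of_lt_le htb htb', hij, radius_eq_confidenceRadius hT hδ0] at hround

theorem masterBias_pos (hT : 2 ≤ T) (hH : 0 < H) (hδ0 : 0 < δ) (hδ1 : δ ≤ 1) :
    0 < masterBias T H δ := by
  have hN : 0 < numBase T := Nat.clog_pos one_lt_two hT
  have hM : 0 < numBatch T H := numBatch_pos hH (by omega)
  exact div_pos (alpha_pos hN hM hδ0 hδ1) (Real.sqrt_pos.2 (by positivity))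

/-- The bound `exp3Error` for the master algorithm along a good path. -/
noncomputable def masterError (T H : ℕ) (δ : ℝ) : ℝ :=
  exp3Error (numBase T) (gamma (numBase T) (numBatch T H)) (masterBias T H δ) (T / H)
    (Real.log (3 * numBase T / δ)) (Real.log (6 * numBase T / δ))

theorem log_six_mul_div_nonneg {N : ℕ} (hN : 0 < N) (hδ0 : 0 < δ) (hδ1 : δ ≤ 1) :
    0 ≤ Real.log (6 * N / δ) := by
  have : (1 : ℝ) ≤ N := by exact_mod_cast hN
  exact Real.log_nonneg ((one_le_div hδ0).2 (by linarith))

theorem masterError_nonneg (hT : 3 ≤ T) (hH : 0 < H) (hδ0 : 0 < δ) (hδ1 : δ ≤ 1) :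
    0 ≤ masterError T H δ := by
  have hN := two_le_numBase hT
  exact exp3Error_nonneg (gamma_pos hN (numBatch_pos hH (by omega))).le
    (masterBias_pos (by omega) hH hδ0 hδ1).le (log_three_mul_div_pos (by omega) hδ0 hδ1).le
    (log_six_mul_div_nonneg (by omega) hδ0 hδ1)

theorem IsGoodPath.mul_sub_masterError_le (hT : 3 ≤ T) (hH : 0 < H) (hδ0 : 0 < δ) (hδ1 : δ ≤ 1)
    (hβ : masterBias T H δ ≤ 2) (h : IsGoodPath T H δ i x η y)
    (hy : ∀ b < T / H, |batchReward T H δ y b| ≤ 1) {j : Fin (numBase T)} {v : ℝ}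
    (hv : v ∈ Set.Icc (0 : ℝ) 1) (hvy : ∀ b < T / H, i b = j → v ≤ batchReward T H δ y b) :
    v * (T / H : ℕ) - masterError T H δ ≤
      ∑ b ∈ Finset.range (T / H), batchReward T H δ y b :=
  exp3_regret_le _ _ i _ (gamma_pos (two_le_numBase hT) (numBatch_pos hH (by omega)))
    (gamma_le_one _ _) (masterBias_pos (by omega) hH hδ0 hδ1) hβ rfl hy hv.1 hv.2 hvy
    (log_three_mul_div_pos j.pos hδ0 hδ1).le (h.mul_sum_one_sub_le j) h.mul_sum_sub_two_le

theorem IsGoodPath.regret_le [MetricSpace X] {d κ : ℝ} (hd : 0 ≤ d) (hX : HasCoveringBound X d κ)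
    (hκ : 0 ≤ κ) (hμ : LipschitzWith 1 μ) (hμ01 : ∀ x, μ x ∈ Set.Icc (0 : ℝ) 1)
    (hopt : ∀ x, μ x ≤ μ xopt) (hT : 3 ≤ T) (hH : 0 < H) (hδ0 : 0 < δ) (hδ1 : δ ≤ 1)
    (hβ : masterBias T H δ ≤ 2) (h : IsGoodPath T H δ i x η y)
    (hy : ∀ t, y t = μ (x t) + η t + c t) (hc : ∀ t < T, |c t| ≤ 1) {j : Fin (numBase T)}
    (hj : ∑ t ∈ Finset.range T, |c t| ≤ level j) {s : ℕ → ZoomState X}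
    (hs : ∀ t < T, ZoomState.Round (radius T (δ / 3) (level (i (t / H))))
      (if H ∣ t then ZoomState.init X else s t) (x t) (y t) (s (t + 1))) :
    T * μ xopt - ∑ t ∈ Finset.range T, μ (x t) ≤
      H + (T / H : ℕ) * (6 * (1 + √(2 * Real.log (6 * T ^ 2 / δ) * (κ * 2 ^ d)) + κ * 2 ^ d) *
          (H * max ((H : ℝ) ^ (-(1 / (d + 2)))) ((level j / H) ^ (1 / (d + 1)))) +
        2 * (√(2 * H * Real.log (12 * T / (H * δ))) +
          H * ((∑ t ∈ Finset.range T, |c t|) / H) ^ (1 / (d + 1)))) +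
      batchScale T H δ * masterError T H δ := by
  have hcorruption : 0 ≤ ∑ t ∈ Finset.range T, |c t| := Finset.sum_nonneg fun _ _ => abs_nonneg _
  have : 0 ≤ level j := hcorruption.trans hj
  have hθ : 1 / (d + 1) ≤ 1 := (div_le_one (by positivity)).2 (by linarith)
  have hyeq : y = fun t => μ (x t) + (η t + c t) := funext fun t => by rw [hy, add_assoc]
  have hreward : ∀ b < T / H, |batchReward T H δ y b| ≤ 1 := fun b hb => by
    have := h.abs_sum_noise_add_corruption_le hc le_rfl zero_le_one hH hb
    rw [Real.rpow_zero] at this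
    rw [hyeq]
    refine abs_batchReward_le_one hμ01 hH ?_
    unfold batchScale
    linarith
  refine regret_le_of_exp3_regret_le (i := i) (z := fun t => η t + c t) (j := j) hμ01 hH ?_ ?_
    (masterError_nonneg hT hH hδ0 hδ1) ?_
    (fun b hb => h.abs_sum_noise_add_corruption_le hc (by positivity) hθ hH hb) ?_
  · have : 0 ≤ (H : ℝ) ^ (-(1 / (d + 2))) := by positivity
    positivity
  · positivity
  · exact fun b hb => h.sum_gap_le hd hX hκ hμ hμ01 hopt hδ0 hδ1 hH hy hj hs hb
  · rw [← hyeq]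
    exact fun v hv => h.mul_sub_masterError_le hT hH hδ0 hδ1 hβ hreward hv

end GoodPath

/-! ### The probability of a good path -/

section Probability

theorem measure_exists_mem_le_ofReal {Ω ι : Type*} [MeasurableSpace Ω] (P : Measure Ω)
    (s : Finset ι) {p : ι → Ω → Prop} {ε : ℝ}
    (h : ∀ k ∈ s, P {ω | p k ω} ≤ ENNReal.ofReal ε) :
    P {ω | ∃ k ∈ s, p k ω} ≤ ENNReal.ofReal (s.card * ε) := by
  have hunion : {ω | ∃ k ∈ s, p k ω} = ⋃ k ∈ s, {ω | p k ω} := by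
    ext ω
    simp only [Set.mem_ofPred_eq, Set.mem_iUnion, exists_prop]
  rw [hunion]
  refine (measure_biUnion_finset_le s _).trans ((Finset.sum_le_sum h).trans_eq ?_)
  rw [Finset.sum_const, nsmul_eq_mul, ENNReal.ofReal_mul (Nat.cast_nonneg _),
    ENNReal.ofReal_natCast]

theorem ofReal_one_sub_le_measure {Ω : Type*} [MeasurableSpace Ω] {P : Measure Ω}
    [IsProbabilityMeasure P] {p q : Ω → Prop} {δ : ℝ} (hδ : 0 ≤ δ)
    (h : P {ω | ¬p ω} ≤ ENNReal.ofReal δ) (hpq : ∀ ω, p ω → q ω) :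
    ENNReal.ofReal (1 - δ) ≤ P {ω | q ω} := by
  have hcover : 1 ≤ P {ω | q ω} + P {ω | ¬p ω} := by
    rw [← measure_univ (μ := P)]
    refine (measure_mono fun ω _ => ?_).trans (measure_union_le _ _)
    exact (em (p ω)).imp_left (hpq ω)
  rw [ENNReal.ofReal_sub _ hδ, ENNReal.ofReal_one]
  exact tsub_le_iff_right.2 (hcover.trans (add_le_add_right h _))

variable {X Ω : Type*} {mΩ : MeasurableSpace Ω} {P : Measure Ω} [IsProbabilityMeasure P]
  {ℱ : Filtration ℕ mΩ} {T H : ℕ} {δ : ℝ} {η c : ℕ → Ω → ℝ}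
  {i : ℕ → Ω → Fin (numBase T)} {x : ℕ → Ω → X} {y : ℕ → Ω → ℝ} {μ : X → ℝ}

theorem IsEnvironment.measure_exists_batch_noise_le (hE : IsEnvironment P ℱ T η c) (hH : 0 < H)
    (hHT : H ≤ T) (hδ0 : 0 < δ) (hδ1 : δ ≤ 1) :
    P {ω | ∃ b ∈ Finset.range (T / H), √(2 * Real.log (12 * T / (H * δ)) * H) <
        |∑ t ∈ Finset.Ico (b * H) ((b + 1) * H), η t ω|} ≤ ENNReal.ofReal (δ / 6) := by
  have hH0 : (0 : ℝ) < H := by exact_mod_cast hH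
  have hHT' : (H : ℝ) ≤ T := by exact_mod_cast hHT
  have hT0 : (0 : ℝ) < T := hH0.trans_le hHT'
  have hlog : 0 ≤ Real.log (12 * T / (H * δ)) := by
    have : H * δ ≤ T * 1 := by gcongr
    exact Real.log_nonneg ((one_le_div (by positivity)).2 (by linarith))
  refine (measure_exists_mem_le_ofReal P _ fun b hb => hE.measure_batch_noise_le hH
    (add_one_mul_le_of_lt_div (Finset.mem_range.1 hb)) hlog).trans (ENNReal.ofReal_le_ofReal ?_)
  rw [Finset.card_range, Real.exp_neg, Real.exp_log (by positivity)]
  calc ((T / H : ℕ) : ℝ) * (2 * (12 * T / (H * δ))⁻¹)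
      ≤ T / H * (2 * (12 * T / (H * δ))⁻¹) := by gcongr; exact Nat.cast_div_le
    _ = δ / 6 := by field_simp; norm_num

variable [MetricSpace X] [MeasurableSpace X]

theorem IsRun.measure_exists_arm_noise_le [SecondCountableTopology X] [OpensMeasurableSpace X]
    (hR : IsRun P ℱ T H δ i x y) (hE : IsEnvironment P ℱ T η c) (hδ0 : 0 < δ) (hδ1 : δ ≤ 1)
    (hT : 0 < T) :
    P {ω | ∃ q ∈ Finset.range T ×ˢ Finset.Icc 1 T, ∃ k ≤ T,
        (pullsSince (fun t => x t ω) q.1 k).card = q.2 ∧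
        √(2 * Real.log (6 * T ^ 2 / δ) * q.2) <
          |∑ t ∈ pullsSince (fun t => x t ω) q.1 k, η t ω|} ≤ ENNReal.ofReal (δ / 3) := by
  have hlog : 0 ≤ Real.log (6 * T ^ 2 / δ) := by
    have : (1 : ℝ) ≤ T ^ 2 := one_le_pow₀ (by exact_mod_cast hT)
    exact Real.log_nonneg ((one_le_div hδ0).2 (by linarith))
  refine (measure_exists_mem_le_ofReal P _ fun q hq => hR.measure_arm_noise_le hE q.1
    (Finset.mem_Icc.1 (Finset.mem_product.1 hq).2).1 hlog).trans_eq ?_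
  rw [Finset.card_product, Finset.card_range, Nat.card_Icc, Nat.add_sub_cancel, Real.exp_neg,
    Real.exp_log (by positivity)]
  congr 1
  push_cast
  field_simp
  norm_num

theorem gamma_div_numBase_pos (hT : 3 ≤ T) (hH : 0 < H) :
    0 < gamma (numBase T) (numBatch T H) / numBase T :=
  have hN := two_le_numBase hT
  div_pos (gamma_pos hN (numBatch_pos hH (by omega))) (by positivity)

theorem IsRun.measure_exists_mul_sum_one_sub_le
    (hR : IsRun P ℱ T H δ i x (reward μ x η c)) (hE : IsEnvironment P ℱ T η c)
    (hμ : Measurable μ) (hT : 3 ≤ T) (hH : 0 < H) (hδ0 : 0 < δ) (hδ1 : δ ≤ 1) :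
    P {ω | ∃ j ∈ Finset.univ, Real.log (3 * numBase T / δ) ≤
        masterBias T H δ * ∑ b ∈ Finset.range (T / H), (1 - importanceEstimate (masterBias T H δ) 1
          (masterProb T H δ (fun k => i k ω) (fun t => reward μ x η c t ω) b) (i b ω) j)} ≤
      ENNReal.ofReal (δ / 3) := by
  have hN := two_le_numBase hT
  have hprob := masterProb_mem_Icc (δ := δ) hN (numBatch_pos hH (by omega))
  refine (measure_exists_mem_le_ofReal P _ fun j _ =>
    (hR.isSampledFrom hE hμ hH).measure_le_mul_sum_one_sub_le
      (fun b b' hb => by dsimp only; gcongr)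
      (fun b ω => ⟨(gamma_div_numBase_pos hT hH).trans_le (hprob _ _ b j).1, (hprob _ _ b j).2⟩)
      (masterBias_pos (by omega) hH hδ0 hδ1).le _).trans_eq ?_
  rw [Finset.card_univ, Fintype.card_fin, Real.exp_neg, Real.exp_log (by positivity)]
  congr 1
  field_simp

theorem IsRun.measure_exists_mul_sum_sub_two_le
    (hR : IsRun P ℱ T H δ i x (reward μ x η c)) (hE : IsEnvironment P ℱ T η c)
    (hμ : Measurable μ) (hT : 3 ≤ T) (hH : 0 < H) (hδ0 : 0 < δ) :
    P {ω | ∃ j ∈ Finset.univ, Real.log (6 * numBase T / δ) ≤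
        gamma (numBase T) (numBatch T H) / numBase T *
          ∑ b ∈ Finset.range (T / H), (importanceEstimate 0 1
            (masterProb T H δ (fun k => i k ω) (fun t => reward μ x η c t ω) b) (i b ω) j - 2)} ≤
      ENNReal.ofReal (δ / 6) := by
  have hN := two_le_numBase hT
  refine (measure_exists_mem_le_ofReal P _ fun j _ =>
    (hR.isSampledFrom hE hμ hH).measure_le_mul_sum_sub_two_le
      (fun b b' hb => by dsimp only; gcongr) (gamma_div_numBase_pos hT hH)
      (fun b ω => masterProb_mem_Icc hN (numBatch_pos hH (by omega)) _ _ b j) _).trans_eq ?_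
  rw [Finset.card_univ, Fintype.card_fin, Real.exp_neg, Real.exp_log (by positivity)]
  congr 1
  field_simp

theorem IsRun.measure_not_isGoodPath_le [SecondCountableTopology X] [OpensMeasurableSpace X]
    (hR : IsRun P ℱ T H δ i x (reward μ x η c)) (hE : IsEnvironment P ℱ T η c)
    (hμ : Measurable μ) (hT : 3 ≤ T) (hH : 0 < H) (hHT : H ≤ T) (hδ0 : 0 < δ) (hδ1 : δ ≤ 1) :
    P {ω | ¬IsGoodPath T H δ (fun k => i k ω) (fun t => x t ω) (fun t => η t ω)
        (fun t => reward μ x η c t ω)} ≤ ENNReal.ofReal δ := by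
  refine (measure_mono fun ω hω => ?_).trans ((measure_union_le _ _).trans ((add_le_add
    ((measure_union_le _ _).trans (add_le_add
      (hR.measure_exists_mul_sum_one_sub_le hE hμ hT hH hδ0 hδ1)
      (hR.measure_exists_mul_sum_sub_two_le hE hμ hT hH hδ0)))
    ((measure_union_le _ _).trans (add_le_add
      (hE.measure_exists_batch_noise_le hH hHT hδ0 hδ1)
      (hR.measure_exists_arm_noise_le hE hδ0 hδ1 (by omega))))).trans_eq ?_))
  · by_contra hnot
    simp only [Set.mem_union, Set.mem_ofPred_eq, not_or, not_exists, not_and, not_lt, not_le,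
      Finset.mem_univ, true_imp_iff, Finset.mem_range, Finset.mem_product, Finset.mem_Icc]
      at hnot
    obtain ⟨⟨hbias, hgamma⟩, hbatch, harm⟩ := hnot
    refine hω ⟨fun j => (hbias j).le, fun j => (hgamma j).le, hbatch, fun s hs k hk => ?_⟩
    rcases Finset.eq_empty_or_nonempty (pullsSince (fun t => x t ω) s k) with hempty | hne
    · simp [hempty]
    · exact harm (s, _) ⟨hs, hne.card_pos, (card_pullsSince_le _ s k).trans hk⟩ k hk rfl
  rw [← ENNReal.ofReal_add (by positivity) (by positivity),
    ← ENNReal.ofReal_add (by positivity) (by positivity),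
    ← ENNReal.ofReal_add (by positivity) (by positivity)]
  congr 1
  ring

end Probability

/-! ### The total regret -/

section Total

variable {T H : ℕ} {d δ κ l k L C w : ℝ}

theorem one_add_sqrt_mul_add_le (hl : 1 ≤ l) (hk : 0 ≤ k) (hL : L ≤ 12 * l) :
    1 + √(L * k) + k ≤ (1 + 4 * √k + k) * l := by
  have hsqrt : √(L * k) ≤ 4 * l * √k := by
    calc √(L * k) ≤ √((4 * l) ^ 2 * k) := by
          refine Real.sqrt_le_sqrt (mul_le_mul_of_nonneg_right ?_ hk)
          nlinarith
      _ = 4 * l * √k := by rw [Real.sqrt_mul (by positivity), Real.sqrt_sq (by positivity)]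
  have := mul_le_mul_of_nonneg_left hl hk
  linarith

theorem sqrt_batch_noise_le (hT : 2 ≤ T) (hH : 0 < H) (hδ0 : 0 < δ) (hδ1 : δ ≤ 1) :
    √(2 * H * Real.log (12 * T / (H * δ))) ≤ 5 * (2 * Real.log (T / δ)) * √H := by
  have hl := one_le_two_mul_log_div hT hδ0 hδ1
  have hlog : Real.log (12 * T / (H * δ)) ≤ 12 * (2 * Real.log (T / δ)) := by
    rw [← div_div, mul_div_assoc]
    refine log_mul_div_le hT hδ0 hδ1 (by norm_num) (by positivity) ?_
    refine (div_le_self (Nat.cast_nonneg T) (by exact_mod_cast hH)).trans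
      (le_self_pow₀ ?_ two_ne_zero)
    exact_mod_cast (by omega : 1 ≤ T)
  set l := 2 * Real.log (T / δ)
  calc √(2 * H * Real.log (12 * T / (H * δ))) ≤ √((5 * l) ^ 2 * H) := by
        refine Real.sqrt_le_sqrt ?_
        rw [mul_right_comm]
        gcongr
        nlinarith
    _ = 5 * l * √H := by rw [Real.sqrt_mul (by positivity), Real.sqrt_sq (by positivity)]

theorem batchScale_le (hT : 2 ≤ T) (hH : 0 < H) (hδ0 : 0 < δ) (hδ1 : δ ≤ 1) :
    batchScale T H δ ≤ 7 * (2 * Real.log (T / δ)) * H := by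
  have hl := one_le_two_mul_log_div hT hδ0 hδ1
  have hH1 : (1 : ℝ) ≤ H := by exact_mod_cast hH
  have hsqrt : √(H : ℝ) ≤ H := Real.sqrt_le_iff.2 ⟨by positivity, le_self_pow₀ hH1 two_ne_zero⟩
  have hnoise := sqrt_batch_noise_le hT hH hδ0 hδ1
  unfold batchScale
  nlinarith

theorem masterError_le (hT : 3 ≤ T) (hH : 0 < H) (hδ0 : 0 < δ) (hδ1 : δ ≤ 1) :
    masterError T H δ ≤ 65 * (2 * Real.log (T / δ)) ^ 2 * √(numBatch T H) := by
  have hT2 : 2 ≤ T := by omega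
  have hl := one_le_two_mul_log_div hT2 hδ0 hδ1
  have hN := two_le_numBase hT
  have hM : 0 < numBatch T H := numBatch_pos hH (by omega)
  have hNT : (numBase T : ℝ) ≤ T := by exact_mod_cast numBase_le_self T
  have hT1 : (1 : ℝ) ≤ T := by exact_mod_cast (by omega : 1 ≤ T)
  have hlogT : Real.log T ≤ Real.log (T / δ) :=
    Real.log_le_log (by positivity) (le_div_self (by positivity) hδ0 hδ1)
  refine exp3Error_le hN hM (div_le_numBatch T H) hl ?_ ?_ (alpha_pos (by omega) hM hδ0 hδ1)
    (alpha_sq_le hT2 (by omega) (numBase_le_self T) hM (numBatch_le_self hH) hδ0 hδ1)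
    (log_three_mul_div_le_alpha_sq (by omega) hM hδ0 hδ1)
    (log_mul_div_le hT2 hδ0 hδ1 (by norm_num) (by positivity)
      (hNT.trans (le_self_pow₀ hT1 two_ne_zero)))
  · linarith [numBase_le_one_add_two_mul_log hT2]
  · linarith [Real.log_le_log (by positivity) hNT]

theorem batchScale_mul_masterError_le (hd : 0 ≤ d) (hT : 3 ≤ T) (hδ0 : 0 < δ) (hδ1 : δ ≤ 1)
    (hC : 0 ≤ C) :
    batchScale T (batchLength d T) δ * masterError T (batchLength d T) δ ≤
      910 * (2 * Real.log (T / δ)) ^ 3 * regretRate d T C := by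
  have hT2 : 2 ≤ T := by omega
  have hH : 0 < batchLength d T := batchLength_pos (by omega)
  have hl := one_le_two_mul_log_div hT2 hδ0 hδ1
  have hrate := batchLength_mul_sqrt_numBatch_le_two_mul_regretRate hd (by omega : 0 < T) hC
  have hscale := batchScale_le hT2 hH hδ0 hδ1
  have herror := masterError_le hT hH hδ0 hδ1
  set l := 2 * Real.log (T / δ)
  calc batchScale T (batchLength d T) δ * masterError T (batchLength d T) δ
      ≤ 7 * l * batchLength d T * (65 * l ^ 2 * √(numBatch T (batchLength d T))) :=
        mul_le_mul hscale herror (masterError_nonneg hT hH hδ0 hδ1) (by positivity)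
    _ = 455 * l ^ 3 * (batchLength d T * √(numBatch T (batchLength d T))) := by ring
    _ ≤ 455 * l ^ 3 * (2 * regretRate d T C) := by gcongr
    _ = 910 * l ^ 3 * regretRate d T C := by ring

theorem div_mul_zooming_le (hd : 0 ≤ d) (hT : 2 ≤ T) (hδ0 : 0 < δ) (hδ1 : δ ≤ 1) (hk : 0 ≤ k)
    (hC : 0 ≤ C) (hw0 : 0 ≤ w) (hw : w ≤ 2 + 2 * C) :
    T / batchLength d T * (6 * (1 + √(2 * Real.log (6 * T ^ 2 / δ) * k) + k) *
        (batchLength d T * max ((batchLength d T : ℝ) ^ (-(1 / (d + 2))))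
          ((w / batchLength d T) ^ (1 / (d + 1))))) ≤
      24 * (1 + 4 * √k + k) * (2 * Real.log (T / δ)) * regretRate d T C := by
  have hH : (0 : ℝ) < batchLength d T := by exact_mod_cast batchLength_pos (by omega : 0 < T)
  have hl := one_le_two_mul_log_div hT hδ0 hδ1
  have hlog := log_mul_div_le hT hδ0 hδ1 (a := 6) (by norm_num) (by positivity) le_rfl
  have hcoeff := one_add_sqrt_mul_add_le hl hk
    (L := 2 * Real.log (6 * T ^ 2 / δ)) (by linarith)
  have hrate := mul_max_rpow_le_regretRate hd (by omega : 0 < T) hw0 hC hw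
  have : 0 ≤ regretRate d T C := regretRate_nonneg hC
  set l := 2 * Real.log (T / δ)
  set m := max ((batchLength d T : ℝ) ^ (-(1 / (d + 2)))) ((w / batchLength d T) ^ (1 / (d + 1)))
  calc T / batchLength d T * (6 * (1 + √(2 * Real.log (6 * T ^ 2 / δ) * k) + k) *
        (batchLength d T * m))
      = 6 * (1 + √(2 * Real.log (6 * T ^ 2 / δ) * k) + k) * (T * m) := by field_simp
    _ ≤ 6 * ((1 + 4 * √k + k) * l) * (4 * regretRate d T C) := by gcongr
    _ = 24 * (1 + 4 * √k + k) * l * regretRate d T C := by ring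

theorem div_mul_sqrt_batch_noise_le (hd : 0 ≤ d) (hT : 2 ≤ T) (hδ0 : 0 < δ) (hδ1 : δ ≤ 1)
    (hC : 0 ≤ C) :
    T / batchLength d T *
        √(2 * batchLength d T * Real.log (12 * T / (batchLength d T * δ))) ≤
      5 * (2 * Real.log (T / δ)) * regretRate d T C := by
  have hl := one_le_two_mul_log_div hT hδ0 hδ1
  have hrate := div_mul_sqrt_batchLength_le_regretRate hd (by omega : 0 < T) hC
  have hnoise := sqrt_batch_noise_le hT (batchLength_pos (d := d) (T := T) (by omega)) hδ0 hδ1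
  calc T / batchLength d T * √(2 * batchLength d T * Real.log (12 * T / (batchLength d T * δ)))
      ≤ T / batchLength d T * (5 * (2 * Real.log (T / δ)) * √(batchLength d T)) := by gcongr
    _ = 5 * (2 * Real.log (T / δ)) * (T / batchLength d T * √(batchLength d T)) := by ring
    _ ≤ 5 * (2 * Real.log (T / δ)) * regretRate d T C := by gcongr

theorem cast_div_mul_add_le (hH : 0 < H) {z n q : ℝ} (hz : 0 ≤ z) (hn : 0 ≤ n) (hq : 0 ≤ q) :
    (T / H : ℕ) * (z + 2 * (n + H * q)) ≤ T / H * z + 2 * (T / H * n) + 2 * (T * q) := by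
  calc (T / H : ℕ) * (z + 2 * (n + H * q)) ≤ T / H * (z + 2 * (n + H * q)) := by
        gcongr
        exact Nat.cast_div_le
    _ = T / H * z + 2 * (T / H * n) + 2 * (T * q) := by field_simp; ring

/-- The constant of the regret bound, as a multiple of `(2 * log (T / δ)) ^ 3`. -/
noncomputable def regretConst (d κ : ℝ) : ℝ :=
  24 * (1 + 4 * √(κ * 2 ^ d) + κ * 2 ^ d) + 1000

theorem le_regretConst (hκ : 0 ≤ κ) : 1000 ≤ regretConst d κ :=
  le_add_of_nonneg_left (by positivity)

theorem add_mul_add_mul_pow_le_regretConst_mul (hκ : 0 ≤ κ) (hl : 1 ≤ l) :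
    4 + (24 * (1 + 4 * √(κ * 2 ^ d) + κ * 2 ^ d) + 10) * l + 910 * l ^ 3 ≤
      regretConst d κ * l ^ 3 := by
  have hcoeff : 0 ≤ 24 * (1 + 4 * √(κ * 2 ^ d) + κ * 2 ^ d) := by positivity
  have hpow := le_self_pow₀ hl three_ne_zero
  have := mul_le_mul_of_nonneg_left hpow hcoeff
  unfold regretConst
  linarith

theorem IsGoodPath.regret_le_regretConst_mul {X : Type*} [MetricSpace X] {μ : X → ℝ} {xopt : X}
    {i : ℕ → Fin (numBase T)} {x : ℕ → X} {η c y : ℕ → ℝ} (hd : 0 ≤ d)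
    (hX : HasCoveringBound X d κ) (hκ : 0 ≤ κ) (hμ : LipschitzWith 1 μ)
    (hμ01 : ∀ x, μ x ∈ Set.Icc (0 : ℝ) 1) (hopt : ∀ x, μ x ≤ μ xopt) (hT : 3 ≤ T) (hδ0 : 0 < δ)
    (hδ1 : δ ≤ 1) (hβ : masterBias T (batchLength d T) δ ≤ 2)
    (h : IsGoodPath T (batchLength d T) δ i x η y)
    (hy : ∀ t, y t = μ (x t) + η t + c t) (hc : ∀ t < T, |c t| ≤ 1) {s : ℕ → ZoomState X}
    (hs : ∀ t < T, ZoomState.Round (radius T (δ / 3) (level (i (t / batchLength d T))))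
      (if batchLength d T ∣ t then ZoomState.init X else s t) (x t) (y t) (s (t + 1))) :
    T * μ xopt - ∑ t ∈ Finset.range T, μ (x t) ≤
      regretConst d κ * (2 * Real.log (T / δ)) ^ 3 *
        regretRate d T (∑ t ∈ Finset.range T, |c t|) := by
  have hT2 : 2 ≤ T := by omega
  have hT0 : 0 < T := by omega
  have hH : 0 < batchLength d T := batchLength_pos hT0
  have hC0 : 0 ≤ ∑ t ∈ Finset.range T, |c t| := Finset.sum_nonneg fun _ _ => abs_nonneg _
  have hCT : ∑ t ∈ Finset.range T, |c t| ≤ T := by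
    simpa using Finset.sum_le_sum fun t ht => hc t (Finset.mem_range.1 ht)
  obtain ⟨j, hCj, hj⟩ := exists_level hT2 hC0 hCT
  have hregret := h.regret_le hd hX hκ hμ hμ01 hopt hT hH hδ0 hδ1 hβ hy hc hCj hs
  have hpartial := batchLength_le_two_mul_regretRate hd hT0 hC0
  have hzooming := div_mul_zooming_le hd hT2 hδ0 hδ1 (k := κ * 2 ^ d) (by positivity) hC0
    (hC0.trans hCj) hj
  have hnoise := div_mul_sqrt_batch_noise_le hd hT2 hδ0 hδ1 hC0
  have hcorruption := mul_div_batchLength_rpow_le_regretRate hd hT0 hC0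
  have hmaster := batchScale_mul_masterError_le hd hT hδ0 hδ1 hC0
  have hl := one_le_two_mul_log_div hT2 hδ0 hδ1
  have hrate := regretRate_nonneg (d := d) (T := T) hC0
  set H := batchLength d T
  set l := 2 * Real.log (T / δ)
  set C := ∑ t ∈ Finset.range T, |c t|
  set zooming := 6 * (1 + √(2 * Real.log (6 * T ^ 2 / δ) * (κ * 2 ^ d)) + κ * 2 ^ d) *
    (H * max ((H : ℝ) ^ (-(1 / (d + 2)))) ((level j / H) ^ (1 / (d + 1))))
  set noise := √(2 * H * Real.log (12 * T / (H * δ)))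
  set corruption := (C / H) ^ (1 / (d + 1))
  have hzooming0 : 0 ≤ zooming := by
    have : 0 ≤ max ((H : ℝ) ^ (-(1 / (d + 2)))) ((level j / H) ^ (1 / (d + 1))) :=
      le_max_of_le_left (by positivity)
    positivity
  have hbatches := cast_div_mul_add_le (T := T) hH hzooming0 (Real.sqrt_nonneg _ : 0 ≤ noise)
    (by positivity : 0 ≤ corruption)
  calc T * μ xopt - ∑ t ∈ Finset.range T, μ (x t)
      ≤ (4 + (24 * (1 + 4 * √(κ * 2 ^ d) + κ * 2 ^ d) + 10) * l + 910 * l ^ 3) *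
          regretRate d T C := by linarith
    _ ≤ regretConst d κ * l ^ 3 * regretRate d T C := by
        gcongr
        exact add_mul_add_mul_pow_le_regretConst_mul hκ hl

theorem le_mul_rpow_of_two_lt_masterBias (hd : 0 ≤ d) (hT : 3 ≤ T) (hδ0 : 0 < δ) (hδ1 : δ ≤ 1)
    (hβ : 2 < masterBias T (batchLength d T) δ) :
    (T : ℝ) ≤ 6 * (2 * Real.log (T / δ)) * (T : ℝ) ^ ((d + 3) / (d + 4)) := by
  have hT0 : 0 < T := by omega
  have hH : 0 < batchLength d T := batchLength_pos hT0
  have hN2 : 2 ≤ numBase T := two_le_numBase hT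
  have hM : 0 < numBatch T (batchLength d T) := numBatch_pos hH hT0
  have hα := alpha_sq_le (by omega) (by omega) (numBase_le_self T) hM (numBatch_le_self hH) hδ0 hδ1
  have hnumBatch : (numBatch T (batchLength d T) : ℝ) ≤ 3 * (2 * Real.log (T / δ)) := by
    have hN0 : (2 : ℝ) ≤ numBase T := by exact_mod_cast hN2
    rw [masterBias, lt_div_iff₀ (by positivity)] at hβ
    have hsq := pow_le_pow_left₀ (by positivity) hβ.le 2
    rw [mul_pow, Real.sq_sqrt (by positivity)] at hsq
    nlinarith
  calc (T : ℝ) ≤ numBatch T (batchLength d T) * batchLength d T := le_numBatch_mul hH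
    _ ≤ 3 * (2 * Real.log (T / δ)) * (2 * (T : ℝ) ^ ((d + 3) / (d + 4))) :=
        mul_le_mul hnumBatch (batchLength_le_two_mul_rpow hd hT0 (by gcongr; norm_num))
          (by positivity) (by linarith [one_le_two_mul_log_div (by omega) hδ0 hδ1])
    _ = 6 * (2 * Real.log (T / δ)) * (T : ℝ) ^ ((d + 3) / (d + 4)) := by ring

theorem le_mul_rpow_of_le_two (hd : 0 ≤ d) (hT : 2 ≤ T) (hT2 : T ≤ 2) (hδ0 : 0 < δ)
    (hδ1 : δ ≤ 1) : (T : ℝ) ≤ 6 * (2 * Real.log (T / δ)) * (T : ℝ) ^ ((d + 3) / (d + 4)) := by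
  have hT1 : (1 : ℝ) ≤ T := by exact_mod_cast (by omega : 1 ≤ T)
  have hT2' : (T : ℝ) ≤ 2 := by exact_mod_cast hT2
  have hl := one_le_two_mul_log_div hT hδ0 hδ1
  have hpow : 1 ≤ (T : ℝ) ^ ((d + 3) / (d + 4)) := Real.one_le_rpow hT1 (by positivity)
  nlinarith

theorem le_regretConst_mul (hκ : 0 ≤ κ) (hC : 0 ≤ C) (hl : 1 ≤ l)
    (h : (T : ℝ) ≤ 6 * l * (T : ℝ) ^ ((d + 3) / (d + 4))) :
    (T : ℝ) ≤ regretConst d κ * l ^ 3 * regretRate d T C := by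
  have hconst := le_regretConst (d := d) hκ
  calc (T : ℝ) ≤ 6 * l * (T : ℝ) ^ ((d + 3) / (d + 4)) := h
    _ ≤ regretConst d κ * l ^ 3 * regretRate d T C := by
        gcongr
        · linarith
        · exact le_self_pow₀ hl three_ne_zero
        · exact rpow_le_regretRate hC

end Total

section Regret

variable {X Ω : Type*} {T : ℕ} {d κ δ : ℝ} {μ : X → ℝ} {xopt : X}

theorem regret_le (hμ01 : ∀ x, μ x ∈ Set.Icc (0 : ℝ) 1) (xopt : X) (T : ℕ) (x : ℕ → Ω → X)
    (ω : Ω) : regret μ xopt T x ω ≤ T := by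
  have hsum : 0 ≤ ∑ t ∈ Finset.range T, μ (x t ω) := Finset.sum_nonneg fun t _ => (hμ01 _).1
  have hmax := mul_le_mul_of_nonneg_left (hμ01 xopt).2 (Nat.cast_nonneg (α := ℝ) T)
  unfold regret
  linarith

variable [MetricSpace X] [MeasurableSpace X] {mΩ : MeasurableSpace Ω} {P : Measure Ω}
  {ℱ : Filtration ℕ mΩ} {η c : ℕ → Ω → ℝ} {i : ℕ → Ω → Fin (numBase T)} {x : ℕ → Ω → X}

theorem IsRun.regret_le_of_isGoodPath (hR : IsRun P ℱ T (batchLength d T) δ i x (reward μ x η c))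
    (hE : IsEnvironment P ℱ T η c) (hd : 0 ≤ d) (hκ : 0 ≤ κ) (hX : HasCoveringBound X d κ)
    (hμ : LipschitzWith 1 μ) (hμ01 : ∀ x, μ x ∈ Set.Icc (0 : ℝ) 1) (hopt : ∀ x, μ x ≤ μ xopt)
    (hT : 3 ≤ T) (hδ0 : 0 < δ) (hδ1 : δ ≤ 1) {ω : Ω}
    (h : IsGoodPath T (batchLength d T) δ (fun k => i k ω) (fun t => x t ω) (fun t => η t ω)
      (fun t => reward μ x η c t ω)) :
    regret μ xopt T x ω ≤ regretConst d κ * (2 * Real.log (T / δ)) ^ 3 *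
      regretRate d T (totalCorruption T c ω) := by
  obtain ⟨s, hs⟩ := hR.zooming ω
  rcases le_or_gt (masterBias T (batchLength d T) δ) 2 with hβ | hβ
  · exact h.regret_le_regretConst_mul hd hX hκ hμ hμ01 hopt hT hδ0 hδ1 hβ (fun _ => rfl)
      (fun t ht => hE.corruption_le_one t ht ω) hs
  · exact (regret_le hμ01 xopt T x ω).trans (le_regretConst_mul hκ
      (Finset.sum_nonneg fun _ _ => abs_nonneg _) (one_le_two_mul_log_div (by omega) hδ0 hδ1)
      (le_mul_rpow_of_two_lt_masterBias hd hT hδ0 hδ1 hβ))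

theorem IsRun.ofReal_one_sub_le_measure_regret_le [OpensMeasurableSpace X] [IsProbabilityMeasure P]
    (hR : IsRun P ℱ T (batchLength d T) δ i x (reward μ x η c)) (hE : IsEnvironment P ℱ T η c)
    (hd : 0 ≤ d) (hκ : 0 ≤ κ) (hX : HasCoveringBound X d κ) (hμ : LipschitzWith 1 μ)
    (hμ01 : ∀ x, μ x ∈ Set.Icc (0 : ℝ) 1) (hopt : ∀ x, μ x ≤ μ xopt) (hT : 2 ≤ T) (hδ0 : 0 < δ)
    (hδ1 : δ ≤ 1) :
    ENNReal.ofReal (1 - δ) ≤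
      P {ω | regret μ xopt T x ω ≤ regretConst d κ * (2 * Real.log (T / δ)) ^ 3 *
        regretRate d T (totalCorruption T c ω)} := by
  have := hX.secondCountableTopology
  rcases le_or_gt T 2 with hT2 | hT3
  · refine ofReal_one_sub_le_measure (p := fun _ => True) hδ0.le (by simp) fun ω _ => ?_
    exact (regret_le hμ01 xopt T x ω).trans (le_regretConst_mul hκ
      (Finset.sum_nonneg fun _ _ => abs_nonneg _) (one_le_two_mul_log_div hT hδ0 hδ1)
      (le_mul_rpow_of_le_two hd hT hT2 hδ0 hδ1))
  · exact ofReal_one_sub_le_measure hδ0.le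
      (hR.measure_not_isGoodPath_le hE hμ.continuous.measurable hT3 (batchLength_pos (by omega))
        (batchLength_le_self hd (by omega)) hδ0 hδ1)
      fun ω hω => hR.regret_le_of_isGoodPath hE hd hκ hX hμ hμ01 hopt hT3 hδ0 hδ1 hω

end Regret

end BoB

theorem theorem6_general (d κ : ℝ) (hd : 0 ≤ d) (hκ : 0 < κ) :
    ∃ (A : ℝ) (p : ℕ),
      ∀ (X : Type*) [MetricSpace X] [MeasurableSpace X] [OpensMeasurableSpace X],
        BoB.HasCoveringBound X d κ →
      ∀ (μ : X → ℝ) (xopt : X),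
        LipschitzWith 1 μ → (∀ x, μ x ∈ Set.Icc (0 : ℝ) 1) → (∀ x, μ x ≤ μ xopt) →
      ∀ (T : ℕ) (δ : ℝ), 2 ≤ T → 0 < δ → δ < 1 →
      ∀ (Ω : Type*) [mΩ : MeasurableSpace Ω] (P : Measure Ω) [IsProbabilityMeasure P]
        (ℱ : Filtration ℕ mΩ) (η c : ℕ → Ω → ℝ)
        (i : ℕ → Ω → Fin (BoB.numBase T)) (x : ℕ → Ω → X),
        BoB.IsEnvironment P ℱ T η c →
        BoB.IsRun P ℱ T (BoB.batchLength d T) δ i x (BoB.reward μ x η c) →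
        ENNReal.ofReal (1 - δ) ≤
          P {ω | BoB.regret μ xopt T x ω ≤
            A * Real.log (T / δ) ^ p *
              ((T : ℝ) ^ ((d + 3) / (d + 4)) +
                BoB.totalCorruption T c ω ^ (1 / (d + 1)) *
                  (T : ℝ) ^ ((d + 2) / (d + 3)))} := by
  refine ⟨8 * BoB.regretConst d κ, 3, ?_⟩
  intro X _ _ _ hX μ xopt hμ hμ01 hopt T δ hT hδ0 hδ1 Ω _ P _ ℱ η c i x hE hR
  have hconst : 8 * BoB.regretConst d κ * Real.log (T / δ) ^ 3 =
      BoB.regretConst d κ * (2 * Real.log (T / δ)) ^ 3 := by ring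
  rw [hconst]
  exact hR.ofReal_one_sub_le_measure_regret_le hE hd hκ.le hX hμ hμ01 hopt hT hδ0 hδ1.le

theorem theorem6 (d κ : ℝ) (hd : 0 ≤ d) (hκ : 0 < κ) :
    ∃ (A : ℝ) (p : ℕ),
      ∀ (X : Type*) [MetricSpace X] [CompactSpace X] [MeasurableSpace X] [BorelSpace X],
        Metric.diam (Set.univ : Set X) ≤ 1 → BoB.HasCoveringBound X d κ →
      ∀ (μ : X → ℝ) (xopt : X),
        LipschitzWith 1 μ → (∀ x, μ x ∈ Set.Icc (0 : ℝ) 1) → (∀ x, μ x ≤ μ xopt) →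
      ∀ (T : ℕ) (δ : ℝ), 2 ≤ T → 0 < δ → δ < 1 →
      ∀ (Ω : Type*) [mΩ : MeasurableSpace Ω] (P : Measure Ω) [IsProbabilityMeasure P]
        (ℱ : Filtration ℕ mΩ) (η c : ℕ → Ω → ℝ)
        (i : ℕ → Ω → Fin (BoB.numBase T)) (x : ℕ → Ω → X),
        BoB.IsEnvironment P ℱ T η c →
        BoB.IsRun P ℱ T (BoB.batchLength d T) δ i x (BoB.reward μ x η c) →
        ENNReal.ofReal (1 - δ) ≤
          P {ω | BoB.regret μ xopt T x ω ≤
            A * Real.log (T / δ) ^ p *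
              ((T : ℝ) ^ ((d + 3) / (d + 4)) +
                BoB.totalCorruption T c ω ^ (1 / (d + 1)) *
                  (T : ℝ) ^ ((d + 2) / (d + 3)))} := by
  obtain ⟨A, p, h⟩ := theorem6_general d κ hd hκ
  exact ⟨A, p, fun X _ _ _ _ _ hX => h X hX⟩
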